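/- Let $\mathsf{LO}$ be the category of linear orders and order embeddings (strictly increasing functions), and let $\mathsf{Nat}$ be its full subcategory with objects $n=\{0,\dots,n-1\}$ for $n\in\mathbb N$. A Goodstein dilator is a functor $D:\mathsf{Nat}\to\mathsf{LO}$ such that (a) each $D(n)$ is equal to an initial segment of $\mathbb N$ with the usual order, (b) $D$ preserves pullbacks, and (c) $0\in D(0)$, and for every $b\in\mathbb N$ the empty function $\operatorname{emp}_b:0\to b$ satisfies $D(\operatorname{emp}_b)(0)=0\in D(b)$. A Goodstein system is a pair $(b,c)$ of a non-decreasing function $b:\mathbb N\to\mathbb N$ with $b(0)>0$ and a family $c=\langle c_i\rangle_{i\in\mathbb N}$ of strictly increasing functions $c_i:\{0,\dots,b(i)-1\}\to\{0,\dots,b(i+1)-1\}$ such that for every $d:\mathbb N\to\mathbb N$ with $d(i)<b(i)$ for all $i$ and every infinite $Y\subseteq\mathbb N$ there are $i<j$ in $Y$ with $c_{ij}(d(i))\le d(j)$, where $c_{ij}:=c_{j-1}\circ\dots\circ c_i$. For a Goodstein dilator $D$, a Goodstein system $(b,c)$ and $m\in D(b(0))$, the Goodstein sequence $G^D_{b,c,m}$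 is given by $G^D_{b,c,m}(0)=m$, and $G^D_{b,c,m}(i+1)=0$ if $G^D_{b,c,m}(i)=0$, and $G^D_{b,c,m}(i+1)=D(c_i)(G^D_{b,c,m}(i))-1$ otherwise. For a Goodstein dilator $D$ there is a unique natural transformation $\operatorname{supp}:D\Rightarrow[\cdot]^{<\omega}$ into the finite subset functor such that $\operatorname{supp}_n(\sigma)\subseteq\operatorname{rng}(f)$ implies $\sigma\in\operatorname{rng}(D(f))$ for all morphisms $f:m\to n$ and all $\sigma\in D(n)$. For a linear order $X$, let $\overline D(X)$ be the set of pairs $(a,\sigma)$ where $a\subseteq X$ is finite and $\sigma\in D(|a|)$ satisfies $\operatorname{supp}_{|a|}(\sigma)=\{0,\dots,|a|-1\}$. It is ordered by $(a,\sigma)<(b,\tau)$ if and only if $D(|\iota_a|)(\sigma)<D(|\iota_b|)(\tau)$, where $|\iota_a|:|a|\to|a\cup b|$ and $|\iota_b|:|b|\to|a\cup b|$ are the strictly increasing functions induced by the inclusions of $a$ and $b$ into $a\cup b$. Theorem. The theory $\mathbf{RCA}_0$ proves (equivalently, by the completeness theorem, it is true in every model of $\mathbf{RCA}_0$) that for every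 Goodstein dilator $D$ the following are equivalent: (i) the extended Goodstein theorem for $D$: for every Goodstein system $(b,c)$ and every $m\in D(b(0))$ there is an $i\in\mathbb N$ with $G^D_{b,c,m}(i)=0$; (ii) the extension $\overline D$ of $D$ preserves well foundedness: for every well order $X$, the order $\overline D(X)$ is well founded. Here all objects are those of second order arithmetic: functors on $\mathsf{Nat}$, linear orders and sequences are coded by sets of natural numbers, finite sets and functions are coded by numbers, and an order is well founded if it has no infinite descending sequence. -/

import Mathlib

/-!
# Second order arithmetic, the theory RCA₀, and Goodstein dilators inside RCA₀

Numbers and sets of numbers form two sorts.  The assertion that RCA₀ proves a sentence is expressed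
by the relation `Theory.Entails`: the sentence holds in every model `(M, S)` of RCA₀, where the
number part `M` may be nonstandard and `S` is any nonempty collection of subsets of `M`.  By the
completeness theorem of first order logic this is the same as derivability.
-/

namespace SOA

universe u

/-! ## Syntax -/

/-- Number terms of the language of second order arithmetic. -/
inductive Term where
  | var (i : ℕ)
  | zero
  | one
  | add (s t : Term)
  | mul (s t : Term)

instance : Zero Term := ⟨Term.zero⟩
instance : One Term := ⟨Term.one⟩
instance : Add Term := ⟨Term.add⟩
instance : Mul Term := ⟨Term.mul⟩

/-- The number variables that occur in a term. -/
def Term.vars : Term → Set ℕ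
  | .var i => {i}
  | .zero => ∅
  | .one => ∅
  | .add s t => s.vars ∪ t.vars
  | .mul s t => s.vars ∪ t.vars

/-- Formulas of the language of second order arithmetic.  Number variables and set variables are
both named by natural numbers, in two separate name spaces. -/
inductive Formula where
  | eq (s t : Term)
  | lt (s t : Term)
  | mem (t : Term) (X : ℕ)
  | neg (φ : Formula)
  | and (φ ψ : Formula)
  | or (φ ψ : Formula)
  | imp (φ ψ : Formula)
  | all (x : ℕ) (φ : Formula)
  | ex (x : ℕ) (φ : Formula)
  | allSet (X : ℕ) (φ : Formula)
  | exSet (X : ℕ) (φ : Formula)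

namespace Formula

/-- `φ ↔ ψ`, as an abbreviation. -/
def iff (φ ψ : Formula) : Formula := and (imp φ ψ) (imp ψ φ)

/-- The number variables that occur freely in a formula. -/
def freeNum : Formula → Set ℕ
  | eq s t => s.vars ∪ t.vars
  | lt s t => s.vars ∪ t.vars
  | mem t _ => t.vars
  | neg φ => φ.freeNum
  | and φ ψ => φ.freeNum ∪ ψ.freeNum
  | or φ ψ => φ.freeNum ∪ ψ.freeNum
  | imp φ ψ => φ.freeNum ∪ ψ.freeNum
  | all x φ => φ.freeNum \ {x}
  | ex x φ => φ.freeNum \ {x}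
  | allSet _ φ => φ.freeNum
  | exSet _ φ => φ.freeNum

/-- The set variables that occur freely in a formula. -/
def freeSet : Formula → Set ℕ
  | eq _ _ => ∅
  | lt _ _ => ∅
  | mem _ X => {X}
  | neg φ => φ.freeSet
  | and φ ψ => φ.freeSet ∪ ψ.freeSet
  | or φ ψ => φ.freeSet ∪ ψ.freeSet
  | imp φ ψ => φ.freeSet ∪ ψ.freeSet
  | all _ φ => φ.freeSet
  | ex _ φ => φ.freeSet
  | allSet X φ => φ.freeSet \ {X}
  | exSet X φ => φ.freeSet \ {X}

/-- Bounded quantifier formulas: all quantifiers are number quantifiers of the form `∀ x < t` or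
`∃ x < t`, where the variable `x` does not occur in the term `t`. -/
inductive IsBounded : Formula → Prop
  | eq (s t : Term) : IsBounded (eq s t)
  | lt (s t : Term) : IsBounded (lt s t)
  | mem (t : Term) (X : ℕ) : IsBounded (mem t X)
  | neg {φ : Formula} : IsBounded φ → IsBounded (neg φ)
  | and {φ ψ : Formula} : IsBounded φ → IsBounded ψ → IsBounded (and φ ψ)
  | or {φ ψ : Formula} : IsBounded φ → IsBounded ψ → IsBounded (or φ ψ)
  | imp {φ ψ : Formula} : IsBounded φ → IsBounded ψ → IsBounded (imp φ ψ)
  | all {x : ℕ} {t : Term} {φ : Formula} : x ∉ t.vars → IsBounded φ →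
      IsBounded (all x (imp (lt (.var x) t) φ))
  | ex {x : ℕ} {t : Term} {φ : Formula} : x ∉ t.vars → IsBounded φ →
      IsBounded (ex x (and (lt (.var x) t) φ))

/-- `Σ⁰₁` formulas: `∃ x θ` with `θ` bounded (number and set parameters are allowed). -/
def IsSigma01 (φ : Formula) : Prop := ∃ (x : ℕ) (θ : Formula), θ.IsBounded ∧ φ = ex x θ

/-- `Π⁰₁` formulas: `∀ x θ` with `θ` bounded (number and set parameters are allowed). -/
def IsPi01 (φ : Formula) : Prop := ∃ (x : ℕ) (θ : Formula), θ.IsBounded ∧ φ = all x θ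

end Formula

/-! ## Semantics -/

/-- Structures for the language of second order arithmetic. -/
structure Model where
  /-- the range of the number variables -/
  Num : Type u
  zero : Num
  one : Num
  add : Num → Num → Num
  mul : Num → Num → Num
  lt : Num → Num → Prop
  /-- the range of the set variables -/
  sets : Set (Set Num)
  sets_nonempty : sets.Nonempty

/-- The value of a term under an assignment to the number variables. -/
def Term.eval (𝔐 : Model.{u}) (v : ℕ → 𝔐.Num) : Term → 𝔐.Num
  | .var i => v i
  | .zero => 𝔐.zero
  | .one => 𝔐.one
  | .add s t => 𝔐.add (s.eval 𝔐 v) (t.eval 𝔐 v)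
  | .mul s t => 𝔐.mul (s.eval 𝔐 v) (t.eval 𝔐 v)

/-- Truth of a formula under assignments to the number variables and to the set variables. -/
def Formula.eval (𝔐 : Model.{u}) : Formula → (ℕ → 𝔐.Num) → (ℕ → 𝔐.sets) → Prop
  | .eq s t, v, _ => s.eval 𝔐 v = t.eval 𝔐 v
  | .lt s t, v, _ => 𝔐.lt (s.eval 𝔐 v) (t.eval 𝔐 v)
  | .mem t X, v, w => t.eval 𝔐 v ∈ (w X : Set 𝔐.Num)
  | .neg φ, v, w => ¬ φ.eval 𝔐 v w
  | .and φ ψ, v, w => φ.eval 𝔐 v w ∧ ψ.eval 𝔐 v w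
  | .or φ ψ, v, w => φ.eval 𝔐 v w ∨ ψ.eval 𝔐 v w
  | .imp φ ψ, v, w => φ.eval 𝔐 v w → ψ.eval 𝔐 v w
  | .all x φ, v, w => ∀ a : 𝔐.Num, φ.eval 𝔐 (Function.update v x a) w
  | .ex x φ, v, w => ∃ a : 𝔐.Num, φ.eval 𝔐 (Function.update v x a) w
  | .allSet X φ, v, w => ∀ A : 𝔐.sets, φ.eval 𝔐 v (Function.update w X A)
  | .exSet X φ, v, w => ∃ A : 𝔐.sets, φ.eval 𝔐 v (Function.update w X A)

/-- A formula is true in a structure if it holds under all assignments (so free variables are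
understood as universally quantified). -/
def Model.Satisfies (𝔐 : Model.{u}) (φ : Formula) : Prop := ∀ v w, φ.eval 𝔐 v w

/-- A theory is a set of formulas (its axioms). -/
abbrev Theory := Set Formula

/-- `T.Entails φ`: the theory `T` proves `φ`, i.e. `φ` is true in every model of `T`. -/
def Theory.Entails (T : Theory) (φ : Formula) : Prop :=
  ∀ 𝔐 : Model.{u}, (∀ ψ ∈ T, 𝔐.Satisfies ψ) → 𝔐.Satisfies φ

/-! ## The axioms of RCA₀ -/

open Formula in
/-- The basic axioms on `0`, `1`, `+`, `·` and `<`. -/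
def basicAxioms : Theory :=
  let m : Term := .var 0
  let n : Term := .var 1
  { neg (eq (n + 1) 0),
    imp (eq (m + 1) (n + 1)) (eq m n),
    eq (m + 0) m,
    eq (m + (n + 1)) ((m + n) + 1),
    eq (m * 0) 0,
    eq (m * (n + 1)) ((m * n) + m),
    neg (lt m 0),
    iff (lt m (n + 1)) (or (lt m n) (eq m n)) }

open Formula in
/-- Induction for `φ` with respect to the variable `x`,
`φ(0) ∧ ∀ x (φ(x) → φ(x + 1)) → ∀ x φ(x)`.
Here `φ(0)` is written as `∀ x (x = 0 → φ)`, and `φ(x + 1)` is written as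
`∀ y (y = x + 1 → ∀ x (x = y → φ))`, with an auxiliary variable `y`. -/
def inductionAxiom (x y : ℕ) (φ : Formula) : Formula :=
  imp
    (and (all x (imp (eq (.var x) 0) φ))
      (all x (imp φ (all y (imp (eq (.var y) (.var x + 1)) (all x (imp (eq (.var x) (.var y)) φ)))))))
    (all x φ)

open Formula in
/-- Comprehension for `Δ⁰₁` sets: `∀ x (φ(x) ↔ ψ(x)) → ∃ X ∀ x (x ∈ X ↔ φ(x))`. -/
def comprehensionAxiom (x X : ℕ) (φ ψ : Formula) : Formula :=
  imp (all x (iff φ ψ)) (exSet X (all x (iff (mem (.var x) X) φ)))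

/-- The theory RCA₀: basic axioms, `Σ⁰₁` induction and `Δ⁰₁` comprehension. -/
def RCA0 : Theory :=
  basicAxioms
    ∪ {θ | ∃ (x y : ℕ) (φ : Formula), φ.IsSigma01 ∧ y ≠ x ∧ y ∉ φ.freeNum ∧
        θ = inductionAxiom x y φ}
    ∪ {θ | ∃ (x X : ℕ) (φ ψ : Formula), φ.IsSigma01 ∧ ψ.IsPi01 ∧ X ∉ φ.freeSet ∧
        θ = comprehensionAxiom x X φ ψ}

/-! ## Writing formulas

To write formulas with readable bound variables, we use functions `Fm = ℕ → Formula` whose argument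
`n` is the next unused variable name: a quantifier binds the variable `n` and passes `n + 1` to its
scope, so that distinct nested quantifiers always bind distinct variables. -/

/-- A formula that depends on the next unused variable name. -/
abbrev Fm := ℕ → Formula

/-- The name of a set variable. -/
abbrev SetVar := ℕ

/-- A closed `Fm` yields a sentence. -/
def sentence (φ : Fm) : Formula := φ 0

namespace Fm

def eq (s t : Term) : Fm := fun _ => .eq s t
def lt (s t : Term) : Fm := fun _ => .lt s t
def mem (t : Term) (X : SetVar) : Fm := fun _ => .mem t X
def neg (φ : Fm) : Fm := fun n => .neg (φ n)
def and (φ ψ : Fm) : Fm := fun n => .and (φ n) (ψ n)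
def or (φ ψ : Fm) : Fm := fun n => .or (φ n) (ψ n)
def imp (φ ψ : Fm) : Fm := fun n => .imp (φ n) (ψ n)
def iff (φ ψ : Fm) : Fm := fun n => .iff (φ n) (ψ n)
def all (φ : Term → Fm) : Fm := fun n => .all n (φ (.var n) (n + 1))
def ex (φ : Term → Fm) : Fm := fun n => .ex n (φ (.var n) (n + 1))
def allSet (φ : SetVar → Fm) : Fm := fun n => .allSet n (φ n (n + 1))
def exSet (φ : SetVar → Fm) : Fm := fun n => .exSet n (φ n (n + 1))

/-- Blocks of number quantifiers. -/
def all₂ (φ : Term → Term → Fm) : Fm := all fun x => all fun y => φ x y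
def all₃ (φ : Term → Term → Term → Fm) : Fm := all fun x => all₂ fun y z => φ x y z
def all₄ (φ : Term → Term → Term → Term → Fm) : Fm := all fun x => all₃ fun y z t => φ x y z t
def ex₂ (φ : Term → Term → Fm) : Fm := ex fun x => ex fun y => φ x y
def ex₃ (φ : Term → Term → Term → Fm) : Fm := ex fun x => ex₂ fun y z => φ x y z
def ex₄ (φ : Term → Term → Term → Term → Fm) : Fm := ex fun x => ex₃ fun y z t => φ x y z t

end Fm

open Fm

scoped infix:50 " ≐ " => Fm.eq
scoped infix:50 " ≺ " => Fm.lt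
scoped infix:50 " ∊ " => Fm.mem
scoped prefix:max "∼" => Fm.neg
scoped infixr:36 " ⋏ " => Fm.and
scoped infixr:34 " ⋎ " => Fm.or
scoped infixr:30 " ➝ " => Fm.imp
scoped infix:28 " ⭤ " => Fm.iff

/-! ## Coding in second order arithmetic -/

/-- `s ≤ t` -/
def le (s t : Term) : Fm := s ≺ t ⋎ s ≐ t

/-- The number `(s, t) = (s + t)² + s` codes the ordered pair of `s` and `t`. -/
def pair (s t : Term) : Term := (s + t) * (s + t) + s

/-- The triple `(s, (t, r))`. -/
def triple (s t r : Term) : Term := pair s (pair t r)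

/-- `i` belongs to the finite set described by `a`: we have `a = (k, (m, n))`, `i < k`, and
`m (i + 1) + 1` divides `n`. -/
def inFin (i a : Term) : Fm :=
  ex₃ fun k m n => a ≐ triple k m n ⋏ i ≺ k ⋏ ex fun q => n ≐ (m * (i + 1) + 1) * q

/-- `a` has the form `(k, (m, n))`. -/
def isTriple (a : Term) : Fm := ex₃ fun k m n => a ≐ triple k m n

/-- `a` is the code of a finite set, i.e. the least number of the form `(k, (m, n))` that describes
this set.  Each finite set has exactly one code. -/
def isFin (a : Term) : Fm :=
  isTriple a ⋏ all fun b => b ≺ a ⋏ isTriple b ➝ ∼(all fun i => inFin i a ⭤ inFin i b)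

/-- `f` codes a morphism `m → n` of the category of natural numbers, i.e. a strictly increasing
function from `{0, …, m - 1}` to `{0, …, n - 1}`: we have `f = (m, (n, g))`, where `g` is the code
of the graph of the function, which is a finite set of pairs. -/
def isMor (f m n : Term) : Fm :=
  ex fun g => f ≐ triple m n g ⋏ isFin g
    ⋏ (all fun p => inFin p g ➝ ex₂ fun i j => p ≐ pair i j ⋏ i ≺ m ⋏ j ≺ n)
    ⋏ (all fun i => i ≺ m ➝ ex fun j => inFin (pair i j) g)
    ⋏ (all₃ fun i j j' => inFin (pair i j) g ⋏ inFin (pair i j') g ➝ j ≐ j')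
    ⋏ (all₄ fun i j i' j' => inFin (pair i j) g ⋏ inFin (pair i' j') g ⋏ i ≺ i' ➝ j ≺ j')

/-- `f(i) = j`, where `f` is the code of a morphism. -/
def val (f i j : Term) : Fm := ex₃ fun m n g => f ≐ triple m n g ⋏ inFin (pair i j) g

/-- `h = g ∘ f`, for composable morphisms `f` and `g` (codes) and a morphism `h` with the same
domain and codomain as the composition. -/
def isComp (g f h : Term) : Fm := all₃ fun i j k => val f i j ⋏ val g j k ➝ val h i k

/-- `F(i) = j`, where the function `F` is given as a set of pairs. -/
def maps (F : SetVar) (i j : Term) : Fm := pair i j ∊ F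

/-- `F` is a function from the set of all numbers to itself. -/
def isFun (F : SetVar) : Fm :=
  (all fun i => ex fun j => maps F i j) ⋏ (all₃ fun i j j' => maps F i j ⋏ maps F i j' ➝ j ≐ j')

/-- `(X, L)` is a linear order: `L` is a strict linear order on the set `X`. -/
def isLinearOrder (X L : SetVar) : Fm :=
  (all₂ fun x y => pair x y ∊ L ➝ x ∊ X ⋏ y ∊ X)
    ⋏ (all fun x => ∼(pair x x ∊ L))
    ⋏ (all₃ fun x y z => pair x y ∊ L ⋏ pair y z ∊ L ➝ pair x z ∊ L)
    ⋏ (all₂ fun x y => x ∊ X ⋏ y ∊ X ➝ pair x y ∊ L ⋎ x ≐ y ⋎ pair y x ∊ L)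

/-- `(X, L)` is a well order: a linear order without infinite descending sequences. -/
def isWellOrder (X L : SetVar) : Fm :=
  isLinearOrder X L
    ⋏ ∼(exSet fun F => isFun F
        ⋏ (all₂ fun i x => maps F i x ➝ x ∊ X)
        ⋏ (all₃ fun i x y => maps F i x ⋏ maps F (i + 1) y ➝ pair y x ∊ L))

/-! ## Goodstein dilators

A functor `D` from natural numbers to linear orders, with initial segments of `ℕ` as values, is
given by two sets: the set `DO` of all pairs `(n, σ)` with `σ ∈ D(n)`, and the set `DM` of all
triples `(f, (σ, τ))` with `D(f)(σ) = τ`.  The order on `D(n)` is the usual order on numbers. -/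

/-- `σ ∈ D(n)` -/
def inD (DO : SetVar) (n σ : Term) : Fm := pair n σ ∊ DO

/-- `D(f)(σ) = τ` -/
def app (DM : SetVar) (f σ τ : Term) : Fm := triple f σ τ ∊ DM

/-- The values `D(n)` are initial segments of the natural numbers. -/
def hasInitialSegments (DO : SetVar) : Fm :=
  all₃ fun n σ τ => inD DO n σ ⋏ τ ≺ σ ➝ inD DO n τ

/-- `D` is a functor: for any morphism `f : m → n`, `D(f)` is a strictly increasing function from
`D(m)` to `D(n)`, and `D` respects identities and compositions. -/
def isFunctor (DO DM : SetVar) : Fm :=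
  (all₃ fun f m n => isMor f m n ➝
    (all₂ fun σ τ => app DM f σ τ ➝ inD DO m σ ⋏ inD DO n τ)
      ⋏ (all fun σ => inD DO m σ ➝ ex fun τ => app DM f σ τ)
      ⋏ (all₃ fun σ τ τ' => app DM f σ τ ⋏ app DM f σ τ' ➝ τ ≐ τ')
      ⋏ (all₄ fun σ τ σ' τ' => app DM f σ τ ⋏ app DM f σ' τ' ⋏ σ ≺ σ' ➝ τ ≺ τ'))
    ⋏ (all₂ fun f n => isMor f n n ⋏ (all fun i => i ≺ n ➝ val f i i) ➝
        all fun σ => inD DO n σ ➝ app DM f σ σ)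
    ⋏ (all₃ fun l m n => all₃ fun f g h =>
        isMor f l m ⋏ isMor g m n ⋏ isMor h l n ⋏ isComp g f h ➝
          all₃ fun ρ σ τ => app DM f ρ σ ⋏ app DM g σ τ ➝ app DM h ρ τ)

/-- The morphisms `p : l → m`, `p' : l → m'`, `e : m → n`, `e' : m' → n` (codes) form a commutative
square, i.e. `e ∘ p = e' ∘ p'`. -/
def commutes (p p' e e' : Term) : Fm :=
  all₄ fun x i j y => val p x i ⋏ val p' x j ⋏ val e i y ➝ val e' j y

/-- The morphisms `p : l → m`, `p' : l → m'`, `e : m → n`, `e' : m' → n` form a pullback square in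
the category of natural numbers. -/
def isPullbackNat (l m m' p p' e e' : Term) : Fm :=
  commutes p p' e e'
    ⋏ all₃ fun k g g' => isMor g k m ⋏ isMor g' k m' ⋏ commutes g g' e e' ➝
        (ex fun h => isMor h k l ⋏ isComp p h g ⋏ isComp p' h g')
          ⋏ (all₂ fun h h' => isMor h k l ⋏ isComp p h g ⋏ isComp p' h g'
              ⋏ isMor h' k l ⋏ isComp p h' g ⋏ isComp p' h' g' ➝ h ≐ h')

/-- `U` is an order embedding of the linear order `(W, L)` into `D(m)`. -/
def isEmbedding (DO W L : SetVar) (m : Term) (U : SetVar) : Fm :=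
  (all₂ fun w x => maps U w x ➝ w ∊ W ⋏ inD DO m x)
    ⋏ (all fun w => w ∊ W ➝ ex fun x => maps U w x)
    ⋏ (all₃ fun w x x' => maps U w x ⋏ maps U w x' ➝ x ≐ x')
    ⋏ (all₄ fun w x w' x' => maps U w x ⋏ maps U w' x' ⋏ pair w w' ∊ L ➝ x ≺ x')

/-- `D(p) ∘ H = U`, for an embedding `H` into the domain of `D(p)`. -/
def factors (DM : SetVar) (p : Term) (H U : SetVar) : Fm :=
  all₃ fun w x y => maps H w x ⋏ app DM p x y ➝ maps U w y

/-- For morphisms `p : l → m`, `p' : l → m'`, `e : m → n`, `e' : m' → n`, the morphisms `D(p)`,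
`D(p')`, `D(e)`, `D(e')` form a pullback square in the category of linear orders. -/
def isPullbackLO (DO DM : SetVar) (l m m' p p' e e' : Term) : Fm :=
  (all₄ fun ρ σ σ' τ => app DM p ρ σ ⋏ app DM p' ρ σ' ⋏ app DM e σ τ ➝ app DM e' σ' τ)
    ⋏ allSet fun W => allSet fun L => allSet fun U => allSet fun U' =>
        isLinearOrder W L ⋏ isEmbedding DO W L m U ⋏ isEmbedding DO W L m' U'
          ⋏ (all₄ fun w x x' y => maps U w x ⋏ maps U' w x' ⋏ app DM e x y ➝ app DM e' x' y) ➝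
        (exSet fun H => isEmbedding DO W L l H ⋏ factors DM p H U ⋏ factors DM p' H U')
          ⋏ (allSet fun H => allSet fun H' =>
              isEmbedding DO W L l H ⋏ factors DM p H U ⋏ factors DM p' H U'
                ⋏ isEmbedding DO W L l H' ⋏ factors DM p H' U ⋏ factors DM p' H' U' ➝
              all₂ fun w x => maps H w x ⭤ maps H' w x)

/-- The functor `D` preserves pullbacks. -/
def preservesPullbacks (DO DM : SetVar) : Fm :=
  all₄ fun l m m' n => all₄ fun p p' e e' =>
    isMor p l m ⋏ isMor p' l m' ⋏ isMor e m n ⋏ isMor e' m' n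
      ⋏ isPullbackNat l m m' p p' e e' ➝
    isPullbackLO DO DM l m m' p p' e e'

/-- `D` is a Goodstein dilator: a pullback preserving functor with initial segments of `ℕ` as values,
such that `0 ∈ D(0)`, and `D(f)(0) = 0 ∈ D(b)` holds for the empty function `f : 0 → b`. -/
def isGoodsteinDilator (DO DM : SetVar) : Fm :=
  hasInitialSegments DO ⋏ isFunctor DO DM ⋏ preservesPullbacks DO DM
    ⋏ inD DO 0 0 ⋏ (all₂ fun b f => isMor f 0 b ➝ app DM f 0 0 ⋏ inD DO b 0)

/-! ## Goodstein systems and Goodstein sequences -/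

/-- `c_{ij}(x) = y` for `i ≤ j`, where `c_{ij} = c_{j-1} ∘ … ∘ c_i` and `C` is the function that maps
`i` to the code of the morphism `c_i`: there is a finite set `s` of pairs that is the graph of a
function on `{i, …, j}` with `s(i) = x`, `s(j) = y`, and `s(k + 1) = c_k(s(k))` for `i ≤ k < j`. -/
def iterVal (C : SetVar) (i j x y : Term) : Fm :=
  ex fun s => isFin s
    ⋏ (all₃ fun k u u' => inFin (pair k u) s ⋏ inFin (pair k u') s ➝ u ≐ u')
    ⋏ inFin (pair i x) s ⋏ inFin (pair j y) s
    ⋏ (all fun k => le i k ⋏ k ≺ j ➝ ex₃ fun f u u' =>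
        maps C k f ⋏ inFin (pair k u) s ⋏ inFin (pair (k + 1) u') s ⋏ val f u u')

/-- The set `Y` is infinite. -/
def isInfinite (Y : SetVar) : Fm := all fun k => ex fun y => k ≺ y ⋏ y ∊ Y

/-- `(B, C)` is a Goodstein system: `B` is a non-decreasing function `b` with `b(0) > 0`, and `C` is
a function that maps `i` to (the code of) a morphism `c_i : b(i) → b(i + 1)`, such that for any
function `d` with `d(i) < b(i)` for all `i` and for any infinite set `Y` there are `i < j` in `Y`
with `c_{ij}(d(i)) ≤ d(j)`. -/
def isGoodsteinSystem (B C : SetVar) : Fm :=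
  isFun B
    ⋏ (all₄ fun i j m n => maps B i m ⋏ maps B j n ⋏ le i j ➝ le m n)
    ⋏ (all fun n => maps B 0 n ➝ 0 ≺ n)
    ⋏ isFun C
    ⋏ (all₄ fun i f m n => maps C i f ⋏ maps B i m ⋏ maps B (i + 1) n ➝ isMor f m n)
    ⋏ (allSet fun d => allSet fun Y =>
        isFun d ⋏ (all₃ fun i x n => maps d i x ⋏ maps B i n ➝ x ≺ n) ⋏ isInfinite Y ➝
        ex₂ fun i j => i ∊ Y ⋏ j ∊ Y ⋏ i ≺ j
          ⋏ ex₃ fun x y z => maps d i x ⋏ maps d j y ⋏ iterVal C i j x z ⋏ le z y)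

/-- `G` is the Goodstein sequence for `D`, `C` and the start value `m`: we have `G(0) = m`, while
`G(i + 1)` is `0` if `G(i) = 0`, and `D(c_i)(G(i)) - 1` otherwise. -/
def isGoodsteinSequence (DM C : SetVar) (m : Term) (G : SetVar) : Fm :=
  isFun G ⋏ maps G 0 m
    ⋏ (all₄ fun i f x y => maps C i f ⋏ maps G i x ⋏ maps G (i + 1) y ➝
        (x ≐ 0 ➝ y ≐ 0) ⋏ (∼(x ≐ 0) ➝ app DM f x (y + 1)))

/-- The extended Goodstein theorem for `D`: for any Goodstein system `(b, c)` and any `m ∈ D(b(0))`,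
the Goodstein sequence reaches `0`. -/
def extendedGoodsteinTheorem (DO DM : SetVar) : Fm :=
  allSet fun B => allSet fun C => isGoodsteinSystem B C ➝
    all₂ fun n m => maps B 0 n ⋏ inD DO n m ➝
      exSet fun G => isGoodsteinSequence DM C m G ⋏ ex fun i => maps G i 0

/-! ## The extension of a Goodstein dilator to linear orders -/

/-- `S` is a natural transformation `supp : D ⇒ [·]^{<ω}`, given as a set of triples `(n, (σ, s))`
with `supp_n(σ) = s` (code of a finite subset of `{0, …, n - 1}`), such that
`supp_n(σ) ⊆ rng(f)` implies `σ ∈ rng(D(f))` for any morphism `f : m → n` and any `σ ∈ D(n)`. -/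
def isSupport (DO DM S : SetVar) : Fm :=
  (all₂ fun n σ => inD DO n σ ➝
    (ex fun s => triple n σ s ∊ S ⋏ isFin s ⋏ all fun i => inFin i s ➝ i ≺ n)
      ⋏ (all₂ fun s s' => triple n σ s ∊ S ⋏ triple n σ s' ∊ S ➝ s ≐ s'))
    ⋏ (all₃ fun f m n => isMor f m n ➝
        all₄ fun σ τ s t => app DM f σ τ ⋏ triple m σ s ∊ S ⋏ triple n τ t ∊ S ➝
          all fun j => inFin j t ⭤ ex fun i => inFin i s ⋏ val f i j)
    ⋏ (all₃ fun f m n => isMor f m n ➝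
        all₂ fun σ s => inD DO n σ ⋏ triple n σ s ∊ S
            ⋏ (all fun j => inFin j s ➝ ex fun i => val f i j) ➝
          ex fun ρ => app DM f ρ σ)

/-- `e` describes (the graph of) the order isomorphism between `{0, …, n - 1}` and the finite
suborder `a` (code) of a linear order with order relation `L`.  In particular `n = |a|`. -/
def isEnum (L : SetVar) (a n e : Term) : Fm :=
  (all₂ fun i x => inFin (pair i x) e ➝ i ≺ n ⋏ inFin x a)
    ⋏ (all fun i => i ≺ n ➝ ex fun x => inFin (pair i x) e)
    ⋏ (all fun x => inFin x a ➝ ex fun i => inFin (pair i x) e)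
    ⋏ (all₃ fun i x y => inFin (pair i x) e ⋏ inFin (pair i y) e ➝ x ≐ y)
    ⋏ (all₄ fun i x j y => inFin (pair i x) e ⋏ inFin (pair j y) e ⋏ i ≺ j ➝ pair x y ∊ L)

/-- `f` is (the code of) the morphism `|ι| : |a| → |u|` that is induced by the inclusion `ι` of `a`
into `u`, for finite suborders `a ⊆ u` (codes) of a linear order with order relation `L`. -/
def isInclusion (L : SetVar) (a u f : Term) : Fm :=
  ex₄ fun m n d e => isEnum L a m d ⋏ isEnum L u n e ⋏ isMor f m n
    ⋏ all₃ fun i j x => inFin (pair i x) d ⋏ val f i j ➝ inFin (pair j x) e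

/-- `p` is an element of the extension `D̄(X)`: it is a pair `(a, σ)` of (the code of) a finite
subset `a` of `X` and an element `σ ∈ D(|a|)` with `supp_{|a|}(σ) = {0, …, |a| - 1}`. -/
def inExt (DO S X L : SetVar) (p : Term) : Fm :=
  ex₂ fun a σ => p ≐ pair a σ ⋏ isFin a ⋏ (all fun x => inFin x a ➝ x ∊ X)
    ⋏ ex₃ fun n e s => isEnum L a n e ⋏ inD DO n σ ⋏ triple n σ s ∊ S
        ⋏ all fun i => inFin i s ⭤ i ≺ n

/-- `(a, σ) < (b, τ)` in `D̄(X)`: we have `D(|ι|)(σ) < D(|ι'|)(τ)` for the inclusions `ι` and `ι'` of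
`a` and `b` into `a ∪ b`. -/
def ltExt (DM L : SetVar) (p q : Term) : Fm :=
  ex₄ fun a σ b τ => p ≐ pair a σ ⋏ q ≐ pair b τ
    ⋏ ex₃ fun u f g => isFin u ⋏ (all fun x => inFin x u ⭤ inFin x a ⋎ inFin x b)
        ⋏ isInclusion L a u f ⋏ isInclusion L b u g
        ⋏ ex₂ fun σ' τ' => app DM f σ σ' ⋏ app DM g τ τ' ⋏ σ' ≺ τ'

/-- The order `D̄(X)` is well founded: it contains no infinite descending sequence. -/
def extIsWellFounded (DO DM S X L : SetVar) : Fm :=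
  ∼(exSet fun F => isFun F
      ⋏ (all₂ fun i p => maps F i p ➝ inExt DO S X L p)
      ⋏ (all₃ fun i p q => maps F i p ⋏ maps F (i + 1) q ➝ ltExt DM L q p))

/-- The extension `D̄` of `D` preserves well foundedness: for the (unique) support transformation of
`D` that is used in the definition of `D̄`, the order `D̄(X)` is well founded for any well order
`X`. -/
def extPreservesWellFoundedness (DO DM : SetVar) : Fm :=
  exSet fun S => isSupport DO DM S
    ⋏ allSet fun X => allSet fun L => isWellOrder X L ➝ extIsWellFounded DO DM S X L

end SOA

/-! ### Semantics of second order arithmetic, and the ordered semiring of a model of RCA₀. -/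

namespace SOA

universe u

/-! ## Evaluation of terms and formulas -/

section Evaluation

variable (𝔐 : Model.{u})

/-! Both directions translate between descending sequences in the extension and Goodstein sequences
that stay positive.

Termination implies preservation (`extPreserves_of_goodsteinTerminates`): let (a_i, σ_i) descend in
the extension over a nonempty well order X. Let U_i consist of a fixed point of X and a_0, …, a_i,
and take the cardinalities b(i) = |U_i| with the maps c_i induced by inclusion. Well foundedness of
X makes this a Goodstein system: a counterexample d, Y picks out points of X that descend along Y.
The image τ_i of σ_i in D(b(i)) satisfies τ_{i+1} < D(c_i)(τ_i), and no τ_i is 0 because D(c_i)(0) =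
0. The Goodstein sequence from τ_0 stays above τ_i, since it loses only 1 at each step, and so it
cannot reach 0. Over the empty order, the sequence descends in D(0), which consists of numbers.

Preservation implies termination (`goodsteinTerminates_of_extPreserves`): the direct limit X of a
Goodstein system is a well order, by the defining condition on d and Y
(`IsIteration.wellFoundedOn`). If the Goodstein sequence G never vanishes, the support of G(i) is a
finite subset of b(i), hence the image of a finite set a_i of points of X, and G(i) comes from some
σ_i ∈ D(|a_i|) with full support. As D(c_i)(G(i)) = G(i+1) + 1, the pairs (a_i, σ_i) descend,
contrary to the assumption.

All of this must happen in a possibly nonstandard model with little comprehension. Hence the notion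
`Comp` of functions whose graph belongs to the model, with closure under composition, bounded
quantifiers, least witnesses (`exists_comp_choice`), finite comprehension (`exists_isFin`) and
primitive recursion (`exists_primrec`). Effectiveness of the dilator rests on one observation: D(f)
is strictly increasing between initial segments of the numbers, so it never lowers its argument, and
a search for preimages is bounded. This makes supports computable (`exists_isSupport`). Finally, the
classes `Den` and `Holds` turn formulas into statements about the model by instance search. -/

@[simp] theorem Term.eval_var (v : ℕ → 𝔐.Num) (i : ℕ) : (Term.var i).eval 𝔐 v = v i := rfl
@[simp] theorem Term.eval_zero (v : ℕ → 𝔐.Num) : (0 : Term).eval 𝔐 v = 𝔐.zero := rfl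
@[simp] theorem Term.eval_one (v : ℕ → 𝔐.Num) : (1 : Term).eval 𝔐 v = 𝔐.one := rfl
@[simp] theorem Term.eval_add (v : ℕ → 𝔐.Num) (s t : Term) :
    (s + t).eval 𝔐 v = 𝔐.add (s.eval 𝔐 v) (t.eval 𝔐 v) := rfl
@[simp] theorem Term.eval_mul (v : ℕ → 𝔐.Num) (s t : Term) :
    (s * t).eval 𝔐 v = 𝔐.mul (s.eval 𝔐 v) (t.eval 𝔐 v) := rfl

@[simp] theorem Term.vars_var (i : ℕ) : (Term.var i).vars = {i} := rfl
@[simp] theorem Term.vars_zero : (0 : Term).vars = ∅ := rfl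
@[simp] theorem Term.vars_one : (1 : Term).vars = ∅ := rfl
@[simp] theorem Term.vars_add (s t : Term) : (s + t).vars = s.vars ∪ t.vars := rfl
@[simp] theorem Term.vars_mul (s t : Term) : (s * t).vars = s.vars ∪ t.vars := rfl

theorem Term.eval_congr {v v' : ℕ → 𝔐.Num} :
    ∀ {t : Term}, (∀ i ∈ t.vars, v i = v' i) → t.eval 𝔐 v = t.eval 𝔐 v'
  | .var i, h => h i rfl
  | .zero, _ => rfl
  | .one, _ => rfl
  | .add _ _, h => congrArg₂ 𝔐.add (eval_congr fun i hi => h i (.inl hi))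
      (eval_congr fun i hi => h i (.inr hi))
  | .mul _ _, h => congrArg₂ 𝔐.mul (eval_congr fun i hi => h i (.inl hi))
      (eval_congr fun i hi => h i (.inr hi))

theorem Term.finite_vars (t : Term) : t.vars.Finite := by
  induction t <;> simp_all [Term.vars]

/-- Finiteness guarantees a fresh name, as the side condition of the induction scheme demands. -/
theorem Formula.finite_freeNum (φ : Formula) : φ.freeNum.Finite := by
  induction φ <;> simp_all [Formula.freeNum, Term.finite_vars, Set.Finite.sdiff]

theorem Formula.finite_freeSet (φ : Formula) : φ.freeSet.Finite := by
  induction φ <;> simp_all [Formula.freeSet, Set.Finite.sdiff]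

theorem Formula.eval_congr {φ : Formula} : ∀ {v v' : ℕ → 𝔐.Num} {w w' : ℕ → 𝔐.sets},
    (∀ i ∈ φ.freeNum, v i = v' i) → (∀ X ∈ φ.freeSet, w X = w' X) →
      (φ.eval 𝔐 v w ↔ φ.eval 𝔐 v' w') := by
  induction φ with
  | eq s t =>
    intro v v' w w' h _
    simp only [Formula.eval]
    rw [Term.eval_congr 𝔐 fun i hi => h i (.inl hi), Term.eval_congr 𝔐 fun i hi => h i (.inr hi)]
  | lt s t =>
    intro v v' w w' h _
    simp only [Formula.eval]
    rw [Term.eval_congr 𝔐 fun i hi => h i (.inl hi), Term.eval_congr 𝔐 fun i hi => h i (.inr hi)]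
  | mem t X =>
    intro v v' w w' h h'
    simp only [Formula.eval]
    rw [Term.eval_congr 𝔐 fun i hi => h i hi, h' X rfl]
  | neg φ ih =>
    intro v v' w w' h h'
    exact not_congr (ih h h')
  | and φ ψ ih ih' =>
    intro v v' w w' h h'
    exact and_congr (ih (fun i hi => h i (.inl hi)) fun i hi => h' i (.inl hi))
      (ih' (fun i hi => h i (.inr hi)) fun i hi => h' i (.inr hi))
  | or φ ψ ih ih' =>
    intro v v' w w' h h'
    exact or_congr (ih (fun i hi => h i (.inl hi)) fun i hi => h' i (.inl hi))
      (ih' (fun i hi => h i (.inr hi)) fun i hi => h' i (.inr hi))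
  | imp φ ψ ih ih' =>
    intro v v' w w' h h'
    exact imp_congr (ih (fun i hi => h i (.inl hi)) fun i hi => h' i (.inl hi))
      (ih' (fun i hi => h i (.inr hi)) fun i hi => h' i (.inr hi))
  | all x φ ih =>
    intro v v' w w' h h'
    refine forall_congr' fun a => ih (fun i hi => ?_) h'
    by_cases hx : i = x
    · subst hx; simp
    · simpa [hx] using h i ⟨hi, hx⟩
  | ex x φ ih =>
    intro v v' w w' h h'
    refine exists_congr fun a => ih (fun i hi => ?_) h'
    by_cases hx : i = x
    · subst hx; simp
    · simpa [hx] using h i ⟨hi, hx⟩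
  | allSet X φ ih =>
    intro v v' w w' h h'
    refine forall_congr' fun a => ih h fun i hi => ?_
    by_cases hx : i = X
    · subst hx; simp
    · simpa [hx] using h' i ⟨hi, hx⟩
  | exSet X φ ih =>
    intro v v' w w' h h'
    refine exists_congr fun a => ih h fun i hi => ?_
    by_cases hx : i = X
    · subst hx; simp
    · simpa [hx] using h' i ⟨hi, hx⟩

end Evaluation

/-! ### Recognising bounded formulas. -/

section Bounded

open Formula

@[simp] theorem isBounded_eq (s t : Term) : (Formula.eq s t).IsBounded := .eq s t
@[simp] theorem isBounded_lt (s t : Term) : (Formula.lt s t).IsBounded := .lt s t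
@[simp] theorem isBounded_mem (s : Term) (X : ℕ) : (Formula.mem s X).IsBounded := .mem s X
-- These rules are equivalences so that `simp` settles the boundedness of any concrete formula.
@[simp] theorem isBounded_neg {φ : Formula} : (neg φ).IsBounded ↔ φ.IsBounded :=
  ⟨fun h => by cases h; assumption, .neg⟩
@[simp] theorem isBounded_and {φ ψ : Formula} :
    (and φ ψ).IsBounded ↔ φ.IsBounded ∧ ψ.IsBounded :=
  ⟨fun h => by cases h; constructor <;> assumption, fun h => .and h.1 h.2⟩
@[simp] theorem isBounded_or {φ ψ : Formula} :
    (or φ ψ).IsBounded ↔ φ.IsBounded ∧ ψ.IsBounded :=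
  ⟨fun h => by cases h; constructor <;> assumption, fun h => .or h.1 h.2⟩
@[simp] theorem isBounded_imp {φ ψ : Formula} :
    (imp φ ψ).IsBounded ↔ φ.IsBounded ∧ ψ.IsBounded :=
  ⟨fun h => by cases h; constructor <;> assumption, fun h => .imp h.1 h.2⟩

/-- The formula `∃ x < t, φ`. -/
def exLt (x : ℕ) (t : Term) (φ : Formula) : Formula := ex x (and (lt (.var x) t) φ)

/-- The formula `∀ x < t, φ`. -/
def allLt (x : ℕ) (t : Term) (φ : Formula) : Formula := all x (imp (lt (.var x) t) φ)

@[simp] theorem isBounded_exLt {x : ℕ} {t : Term} {φ : Formula} :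
    (exLt x t φ).IsBounded ↔ x ∉ t.vars ∧ φ.IsBounded :=
  ⟨fun h => by cases h; constructor <;> assumption, fun h => .ex h.1 h.2⟩

@[simp] theorem isBounded_allLt {x : ℕ} {t : Term} {φ : Formula} :
    (allLt x t φ).IsBounded ↔ x ∉ t.vars ∧ φ.IsBounded :=
  ⟨fun h => by cases h; constructor <;> assumption, fun h => .all h.1 h.2⟩

end Bounded

/-! ## Induction and comprehension in models of RCA₀ -/

open Function (update)

namespace Model

/-- The structure is a model of `RCA0`. -/
class IsRCA0 (𝔐 : Model.{u}) : Prop where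
  satisfies : ∀ ψ ∈ RCA0, 𝔐.Satisfies ψ

variable {𝔐 : Model.{u}} [𝔐.IsRCA0]

/-- Variable 0 carries the induction and variable 1 the existential witness, which leaves the names
from 2 on for parameters. The auxiliary variable of the axiom is chosen fresh, and
`Formula.eval_congr` removes its value again. -/
theorem sigma_induction {θ : Formula}
    (hθ : θ.IsBounded) (v : ℕ → 𝔐.Num) (w : ℕ → 𝔐.sets)
    (h0 : ∃ b, θ.eval 𝔐 (update (update v 0 𝔐.zero) 1 b) w)
    (hs : ∀ a, (∃ b, θ.eval 𝔐 (update (update v 0 a) 1 b) w) →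
      ∃ b, θ.eval 𝔐 (update (update v 0 (𝔐.add a 𝔐.one)) 1 b) w) (a : 𝔐.Num) :
    ∃ b, θ.eval 𝔐 (update (update v 0 a) 1 b) w := by
  set φ : Formula := .ex 1 θ
  obtain ⟨y, hy⟩ := ((φ.finite_freeNum).union (Set.finite_singleton 0)).exists_notMem
  have hy0 : y ≠ 0 := fun h => hy (.inr h)
  have hyφ : y ∉ φ.freeNum := fun h => hy (.inl h)
  have := IsRCA0.satisfies (inductionAxiom 0 y φ) (.inl (.inr ⟨0, y, φ, ⟨1, θ, hθ, rfl⟩, hy0, hyφ, rfl⟩)) v w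
  refine this ⟨?_, ?_⟩ a
  · rintro a ha
    have : a = 𝔐.zero := by simpa [Formula.eval] using ha
    subst this
    exact h0
  · rintro a ha b hb c hc
    have hb' : b = 𝔐.add a 𝔐.one := by simpa [Formula.eval, hy0.symm] using hb
    have hc' : c = b := by simpa [Formula.eval, hy0] using hc
    subst hb' hc'
    refine (Formula.eval_congr 𝔐 (φ := φ) (fun i hi => ?_) fun _ _ => rfl).1 (hs a ha)
    have : i ≠ y := fun h => hyφ (h ▸ hi)
    by_cases hi0 : i = 0
    · simp [hi0]
    · simp [hi0, this]

theorem delta_comprehension {θ η : Formula}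
    (hθ : θ.IsBounded) (hη : η.IsBounded) (v : ℕ → 𝔐.Num) (w : ℕ → 𝔐.sets)
    (h : ∀ a, (∃ b, θ.eval 𝔐 (update (update v 0 a) 1 b) w) ↔
      ∀ b, η.eval 𝔐 (update (update v 0 a) 1 b) w) :
    {a | ∃ b, θ.eval 𝔐 (update (update v 0 a) 1 b) w} ∈ 𝔐.sets := by
  set φ : Formula := .ex 1 θ
  obtain ⟨X, hX⟩ := φ.finite_freeSet.exists_notMem
  have := IsRCA0.satisfies (comprehensionAxiom 0 X φ (.all 1 η))
    (.inr ⟨0, X, φ, .all 1 η, ⟨1, θ, hθ, rfl⟩, ⟨1, η, hη, rfl⟩, hX, rfl⟩) v w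
  obtain ⟨A, hA⟩ := this fun a => ⟨(h a).1, (h a).2⟩
  have : {a | ∃ b, θ.eval 𝔐 (update (update v 0 a) 1 b) w} = A := by
    ext a
    have h1 : a ∈ (A : Set 𝔐.Num) ↔ φ.eval 𝔐 (update v 0 a) (update w X A) := by
      have := hA a
      simp only [Formula.iff, Formula.eval, Term.eval_var, Function.update_self] at this
      exact ⟨this.1, this.2⟩
    rw [h1]
    refine (Formula.eval_congr 𝔐 (φ := φ) (fun _ _ => rfl) fun i hi => ?_)
    rw [Function.update_of_ne fun h : i = X => hX (h ▸ hi)]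
  rw [this]
  exact A.2

/-- Induction for bounded formulas. -/
theorem bounded_induction {θ : Formula}
    (hθ : θ.IsBounded) (v : ℕ → 𝔐.Num) (w : ℕ → 𝔐.sets) {P : 𝔐.Num → Prop}
    (hP : ∀ a b, P a ↔ θ.eval 𝔐 (update (update v 0 a) 1 b) w)
    (h0 : P 𝔐.zero) (hs : ∀ a, P a → P (𝔐.add a 𝔐.one)) (a : 𝔐.Num) : P a := by
  obtain ⟨b, hb⟩ := sigma_induction hθ v w ⟨𝔐.zero, (hP _ _).1 h0⟩
    (fun a ⟨b, hb⟩ => ⟨b, (hP _ _).1 (hs a ((hP _ _).2 hb))⟩) a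
  exact (hP _ _).2 hb

end Model

/-! ## Models of RCA₀ as ordered semirings -/

/-- The structure for second order arithmetic that is given by an ordered semiring and a collection
of sets. -/
@[reducible] def structureOf (M : Type u) [CommSemiring M] [LinearOrder M] (S : Set (Set M))
    (hS : S.Nonempty) : Model.{u} where
  Num := M
  zero := 0
  one := 1
  add a b := a + b
  mul a b := a * b
  lt a b := a < b
  sets := S
  sets_nonempty := hS

/-- A model of RCA₀, given as an ordered semiring together with a collection of sets. -/
class RCA (M : Type u) extends CommSemiring M, LinearOrder M, IsStrictOrderedRing M,
    CanonicallyOrderedAdd M where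
  sets : Set (Set M)
  sets_nonempty : sets.Nonempty
  isRCA0 : (structureOf M sets sets_nonempty).IsRCA0
  lt_add_one_iff' : ∀ a b : M, a < b + 1 ↔ a ≤ b

/-! ## Arithmetic in models of RCA₀ -/

namespace Model

variable {𝔐 : Model.{u}}

local instance : Zero 𝔐.Num := ⟨𝔐.zero⟩
local instance : One 𝔐.Num := ⟨𝔐.one⟩
local instance : Add 𝔐.Num := ⟨𝔐.add⟩
local instance : Mul 𝔐.Num := ⟨𝔐.mul⟩
local instance : LT 𝔐.Num := ⟨𝔐.lt⟩

theorem add_def (a b : 𝔐.Num) : 𝔐.add a b = a + b := rfl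
theorem mul_def (a b : 𝔐.Num) : 𝔐.mul a b = a * b := rfl
theorem lt_def (a b : 𝔐.Num) : 𝔐.lt a b ↔ a < b := Iff.rfl
theorem zero_def : 𝔐.zero = 0 := rfl
theorem one_def : 𝔐.one = 1 := rfl

variable [𝔐.IsRCA0]

theorem succ_ne_zero' (n : 𝔐.Num) : n + 1 ≠ 0 := by
  have := IsRCA0.satisfies _ (.inl (.inl (.inl rfl))) (fun _ => n) fun _ => ⟨_, 𝔐.sets_nonempty.some_mem⟩
  simpa [Formula.eval, Formula.iff, add_def, mul_def, lt_def, zero_def, one_def, iff_iff_implies_and_implies] using this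

theorem succ_inj' {m n : 𝔐.Num} : m + 1 = n + 1 → m = n := by
  have := IsRCA0.satisfies _ (.inl (.inl (.inr <| .inl rfl))) (fun i => if i = 0 then m else n) fun _ => ⟨_, 𝔐.sets_nonempty.some_mem⟩
  simpa [Formula.eval, Formula.iff, add_def, mul_def, lt_def, zero_def, one_def, iff_iff_implies_and_implies] using this

theorem add_zero' (m : 𝔐.Num) : m + 0 = m := by
  have := IsRCA0.satisfies _ (.inl (.inl (.inr <| .inr <| .inl rfl))) (fun _ => m) fun _ => ⟨_, 𝔐.sets_nonempty.some_mem⟩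
  simpa [Formula.eval, Formula.iff, add_def, mul_def, lt_def, zero_def, one_def, iff_iff_implies_and_implies] using this

theorem add_succ' (m n : 𝔐.Num) : m + (n + 1) = (m + n) + 1 := by
  have := IsRCA0.satisfies _ (.inl (.inl (.inr <| .inr <| .inr <| .inl rfl))) (fun i => if i = 0 then m else n) fun _ => ⟨_, 𝔐.sets_nonempty.some_mem⟩
  simpa [Formula.eval, Formula.iff, add_def, mul_def, lt_def, zero_def, one_def, iff_iff_implies_and_implies] using this

theorem mul_zero' (m : 𝔐.Num) : m * 0 = 0 := by
  have := IsRCA0.satisfies _ (.inl (.inl (.inr <| .inr <| .inr <| .inr <| .inl rfl))) (fun _ => m) fun _ => ⟨_, 𝔐.sets_nonempty.some_mem⟩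
  simpa [Formula.eval, Formula.iff, add_def, mul_def, lt_def, zero_def, one_def, iff_iff_implies_and_implies] using this

theorem mul_succ' (m n : 𝔐.Num) : m * (n + 1) = m * n + m := by
  have := IsRCA0.satisfies _ (.inl (.inl (.inr <| .inr <| .inr <| .inr <| .inr <| .inl rfl))) (fun i => if i = 0 then m else n) fun _ => ⟨_, 𝔐.sets_nonempty.some_mem⟩
  simpa [Formula.eval, Formula.iff, add_def, mul_def, lt_def, zero_def, one_def, iff_iff_implies_and_implies] using this

theorem not_lt_zero' (m : 𝔐.Num) : ¬ m < 0 := by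
  have := IsRCA0.satisfies _ (.inl (.inl (.inr <| .inr <| .inr <| .inr <| .inr <| .inr <| .inl rfl))) (fun _ => m) fun _ => ⟨_, 𝔐.sets_nonempty.some_mem⟩
  simpa [Formula.eval, Formula.iff, add_def, mul_def, lt_def, zero_def, one_def, iff_iff_implies_and_implies] using this

theorem lt_succ' (m n : 𝔐.Num) : m < n + 1 ↔ m < n ∨ m = n := by
  have := IsRCA0.satisfies _ (.inl (.inl (.inr <| .inr <| .inr <| .inr <| .inr <| .inr <| .inr <| rfl))) (fun i => if i = 0 then m else n) fun _ => ⟨_, 𝔐.sets_nonempty.some_mem⟩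
  simpa [Formula.eval, Formula.iff, add_def, mul_def, lt_def, zero_def, one_def, iff_iff_implies_and_implies] using this

/-- Induction for a statement that is expressed by the bounded formula `θ`. -/
theorem induction_of_eval (θ : Formula) (hθ : θ.IsBounded) (x y z : 𝔐.Num) {P : 𝔐.Num → Prop}
    (hP : ∀ a b, P a ↔ θ.eval 𝔐
      (update (update (fun i => if i = 2 then x else if i = 3 then y else z) 0 a) 1 b)
      fun _ => ⟨_, 𝔐.sets_nonempty.some_mem⟩)
    (h0 : P 0) (hs : ∀ a, P a → P (a + 1)) (a : 𝔐.Num) : P a :=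
  bounded_induction hθ _ _ hP h0 hs a

/-- The algebraic laws come from induction for quantifier-free formulas: variable 0 runs through the
induction, variables 2 and 3 hold the parameters. -/
theorem add_assoc' (a b c : 𝔐.Num) : a + b + c = a + (b + c) := by
  induction c using induction_of_eval
    (.eq (.var 2 + .var 3 + .var 0) (.var 2 + (.var 3 + .var 0))) (by simp) a b 0 with
  | hP => simp [Formula.eval, add_def]
  | h0 => simp [add_zero']
  | hs c ih => simp [add_succ', ih]

theorem zero_add' (a : 𝔐.Num) : 0 + a = a := by
  induction a using induction_of_eval (.eq (0 + .var 0) (.var 0)) (by simp) (0 : 𝔐.Num) 0 0 with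
  | hP => simp [Formula.eval, add_def, zero_def]
  | h0 => simp [add_zero']
  | hs c ih => simp [add_succ', ih]

theorem succ_add' (a b : 𝔐.Num) : a + 1 + b = a + b + 1 := by
  induction b using induction_of_eval
    (.eq (.var 2 + 1 + .var 0) (.var 2 + .var 0 + 1)) (by simp) a 0 0 with
  | hP => simp [Formula.eval, add_def, one_def]
  | h0 => simp [add_zero']
  | hs c ih => simp [add_succ', ih]

theorem add_comm' (a b : 𝔐.Num) : a + b = b + a := by
  induction b using induction_of_eval
    (.eq (.var 2 + .var 0) (.var 0 + .var 2)) (by simp) a 0 0 with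
  | hP => simp [Formula.eval, add_def]
  | h0 => simp [add_zero', zero_add']
  | hs c ih => simp [add_succ', succ_add', ih]

theorem zero_mul' (a : 𝔐.Num) : 0 * a = 0 := by
  induction a using induction_of_eval (.eq (0 * .var 0) 0) (by simp) (0 : 𝔐.Num) 0 0 with
  | hP => simp [Formula.eval, mul_def, zero_def]
  | h0 => simp [mul_zero']
  | hs c ih => simp [mul_succ', ih, add_zero']

theorem succ_mul' (a b : 𝔐.Num) : (a + 1) * b = a * b + b := by
  induction b using induction_of_eval
    (.eq ((.var 2 + 1) * .var 0) (.var 2 * .var 0 + .var 0)) (by simp) a 0 0 with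
  | hP => simp [Formula.eval, add_def, mul_def, one_def]
  | h0 => simp [add_zero', mul_zero']
  | hs c ih =>
    rw [mul_succ', ih, mul_succ', ← add_assoc', ← add_assoc', add_assoc' (a * c) c a, add_comm' c a,
      ← add_assoc']

theorem mul_comm' (a b : 𝔐.Num) : a * b = b * a := by
  induction b using induction_of_eval
    (.eq (.var 2 * .var 0) (.var 0 * .var 2)) (by simp) a 0 0 with
  | hP => simp [Formula.eval, mul_def]
  | h0 => simp [mul_zero', zero_mul']
  | hs c ih => simp [mul_succ', succ_mul', ih]

theorem mul_add' (a b c : 𝔐.Num) : a * (b + c) = a * b + a * c := by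
  induction c using induction_of_eval
    (.eq (.var 2 * (.var 3 + .var 0)) (.var 2 * .var 3 + .var 2 * .var 0)) (by simp) a b 0 with
  | hP => simp [Formula.eval, add_def, mul_def]
  | h0 => simp [add_zero', mul_zero']
  | hs c ih => rw [add_succ', mul_succ', ih, mul_succ', add_assoc']

theorem mul_assoc' (a b c : 𝔐.Num) : a * b * c = a * (b * c) := by
  induction c using induction_of_eval
    (.eq (.var 2 * .var 3 * .var 0) (.var 2 * (.var 3 * .var 0))) (by simp) a b 0 with
  | hP => simp [Formula.eval, mul_def]
  | h0 => simp [mul_zero']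
  | hs c ih => rw [mul_succ', ih, mul_succ', mul_add']

theorem mul_one' (a : 𝔐.Num) : a * 1 = a := by
  rw [← zero_add' 1, mul_succ', mul_zero', zero_add']

theorem add_right_cancel' {a b c : 𝔐.Num} : a + c = b + c → a = b := by
  induction c using induction_of_eval
    (.imp (.eq (.var 2 + .var 0) (.var 3 + .var 0)) (.eq (.var 2) (.var 3))) (by simp) a b 0 with
  | hP => simp [Formula.eval, add_def]
  | h0 => simp [add_zero']
  | hs c ih => exact fun h => ih (succ_inj' (by simpa [add_succ'] using h))

theorem lt_add_succ (a c : 𝔐.Num) : a < a + (c + 1) := by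
  induction c using induction_of_eval
    (.lt (.var 2) (.var 2 + (.var 0 + 1))) (by simp) a 0 0 with
  | hP => simp [Formula.eval, add_def, lt_def, one_def]
  | h0 => rw [zero_add', lt_succ']; exact .inr rfl
  | hs c ih => rw [add_succ', lt_succ']; exact .inl ih

/-- This induction has a real existential quantifier: the difference is the witness in variable 1.
At 0 the premise fails and any witness will do. -/
theorem exists_of_lt {a b : 𝔐.Num} : a < b → ∃ c, b = a + (c + 1) := by
  have := sigma_induction (𝔐 := 𝔐)
    (θ := .imp (.lt (.var 2) (.var 0)) (.eq (.var 0) (.var 2 + (.var 1 + 1)))) (by simp)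
    (fun _ => a) (fun _ => ⟨_, 𝔐.sets_nonempty.some_mem⟩)
  simp only [Formula.eval, Term.eval_var, Term.eval_add, Term.eval_one, add_def, zero_def,
    lt_def, one_def, ne_eq, not_false_eq_true, Function.update_of_ne,
    Function.update_self, OfNat.ofNat_ne_zero,
    OfNat.ofNat_ne_one, zero_ne_one] at this
  intro hab
  obtain ⟨c, hc⟩ := this ⟨0, fun h => (not_lt_zero' _ h).elim⟩ (fun b ⟨c, hc⟩ => by
    by_cases hb : a < b
    · exact ⟨c + 1, fun _ => by rw [hc hb, ← add_succ']⟩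
    · refine ⟨0, fun h => ?_⟩
      rw [zero_add', ((lt_succ' _ _).1 h).resolve_left hb]) b
  exact ⟨c, hc hab⟩

theorem lt_iff_exists (a b : 𝔐.Num) : a < b ↔ ∃ c, b = a + (c + 1) :=
  ⟨exists_of_lt, fun ⟨c, hc⟩ => hc ▸ lt_add_succ a c⟩

theorem zero_lt_succ (a : 𝔐.Num) : 0 < a + 1 := by simpa [zero_add'] using lt_add_succ 0 a

theorem eq_zero_or_lt (a : 𝔐.Num) : a = 0 ∨ 0 < a := by
  induction a using induction_of_eval
    (.or (.eq (.var 0) 0) (.lt 0 (.var 0))) (by simp) (0 : 𝔐.Num) 0 0 with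
  | hP => simp [Formula.eval, lt_def, zero_def]
  | h0 => exact .inl rfl
  | hs c ih => exact .inr (zero_lt_succ c)

theorem lt_trichotomy' (a b : 𝔐.Num) : a < b ∨ a = b ∨ b < a := by
  induction b using induction_of_eval
    (.or (.lt (.var 2) (.var 0)) (.or (.eq (.var 2) (.var 0)) (.lt (.var 0) (.var 2))))
    (by simp) a 0 0 with
  | hP => simp [Formula.eval, lt_def]
  | h0 => exact .inr (eq_zero_or_lt a)
  | hs b ih =>
    rcases ih with h | h | h
    · exact .inl ((lt_succ' _ _).2 (.inl h))
    · exact .inl ((lt_succ' _ _).2 (.inr h))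
    -- If b lies below a, then b + 1 equals a or still lies below it, according to whether the
    -- difference is 1 or more.
    · obtain ⟨c, rfl⟩ := exists_of_lt h
      rcases eq_zero_or_lt c with rfl | hc
      · rw [zero_add']; exact .inr (.inl rfl)
      · obtain ⟨d, rfl⟩ := exists_of_lt hc
        refine .inr (.inr ?_)
        rw [zero_add', add_succ' b, ← succ_add']
        exact lt_add_succ _ _

theorem lt_irrefl' (a : 𝔐.Num) : ¬ a < a := fun h => by
  obtain ⟨c, hc⟩ := exists_of_lt h
  rw [add_comm'] at hc
  refine succ_ne_zero' c (add_right_cancel' (c := a) ?_)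
  rw [zero_add', ← hc]

theorem lt_trans' {a b c : 𝔐.Num} (h : a < b) (h' : b < c) : a < c := by
  obtain ⟨d, rfl⟩ := exists_of_lt h
  obtain ⟨e, rfl⟩ := exists_of_lt h'
  rw [add_assoc', add_succ' (d + 1)]
  exact lt_add_succ _ _

theorem add_lt_add_right' {a b : 𝔐.Num} (h : a < b) (c : 𝔐.Num) : a + c < b + c := by
  obtain ⟨d, rfl⟩ := exists_of_lt h
  rw [add_assoc', add_comm' (d + 1), ← add_assoc']
  exact lt_add_succ _ _

theorem mul_pos' {a b : 𝔐.Num} (ha : 0 < a) (hb : 0 < b) : 0 < a * b := by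
  obtain ⟨d, rfl⟩ := exists_of_lt ha
  obtain ⟨e, rfl⟩ := exists_of_lt hb
  rw [zero_add', zero_add', mul_succ', add_succ']
  exact zero_lt_succ _

/-- The ordered semiring of a model of RCA₀. -/
@[reducible] def commSemiring : CommSemiring 𝔐.Num where
  add := 𝔐.add
  mul := 𝔐.mul
  zero := 𝔐.zero
  one := 𝔐.one
  add_assoc := add_assoc'
  zero_add := zero_add'
  add_zero := add_zero'
  add_comm := add_comm'
  mul_assoc := mul_assoc'
  one_mul a := (mul_comm' _ _).trans (mul_one' a)
  mul_one := mul_one'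
  mul_comm := mul_comm'
  zero_mul := zero_mul'
  mul_zero := mul_zero'
  left_distrib := mul_add'
  nsmul := nsmulRec
  right_distrib a b c := by
    exact (mul_comm' _ _).trans ((mul_add' _ _ _).trans (congrArg₂ _ (mul_comm' _ _) (mul_comm' _ _)))

open Classical in
/-- The order of a model of RCA₀. -/
@[reducible] noncomputable def linearOrder : LinearOrder 𝔐.Num where
  lt := 𝔐.lt
  le a b := 𝔐.lt a b ∨ a = b
  le_refl _ := .inr rfl
  le_trans a b c := by
    rintro (h | rfl) (h' | rfl)
    exacts [.inl (lt_trans' h h'), .inl h, .inl h', .inr rfl]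
  lt_iff_le_not_ge a b := by
    constructor
    · refine fun h => ⟨.inl h, ?_⟩
      rintro (h' | rfl)
      exacts [lt_irrefl' _ (lt_trans' h h'), lt_irrefl' _ h]
    · rintro ⟨h | rfl, h'⟩
      exacts [h, (h' (.inr rfl)).elim]
  le_antisymm a b := by
    rintro (h | rfl) (h' | h')
    exacts [(lt_irrefl' _ (lt_trans' h h')).elim, h'.symm, rfl, rfl]
  le_total a b := by
    rcases lt_trichotomy' a b with h | h | h
    exacts [.inl (.inl h), .inl (.inr h), .inr (.inl h)]
  toDecidableLE := Classical.decRel _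

/-- A model of RCA₀, viewed as an ordered semiring together with a collection of sets. -/
@[reducible] noncomputable def rca : RCA 𝔐.Num :=
  { commSemiring, linearOrder with
    sets := 𝔐.sets
    sets_nonempty := 𝔐.sets_nonempty
    isRCA0 := inferInstance
    lt_add_one_iff' := lt_succ'
    add_le_add_left := fun a b h c => by
      rcases h with h | rfl
      exacts [.inl (add_lt_add_right' h c), .inr rfl]
    le_of_add_le_add_left := fun a b c h => by
      rcases h with h | h
      · rcases lt_trichotomy' b c with h' | h' | h'
        · exact .inl h'
        · exact .inr h'
        · have := add_lt_add_right' h' a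
          rw [add_comm' c a, add_comm' b a] at this
          exact (lt_irrefl' _ (lt_trans' h this)).elim
      · have h' : a + b = a + c := h
        rw [add_comm' a b, add_comm' a c] at h'
        exact .inr (add_right_cancel' h')
    zero_le_one := .inl ((lt_iff_exists (0 : 𝔐.Num) 1).2 ⟨0, by rw [zero_add', zero_add']⟩)
    exists_pair_ne := ⟨0, 1, fun h => by
      have := succ_ne_zero' (0 : 𝔐.Num)
      rw [zero_add'] at this
      exact this h.symm⟩
    mul_lt_mul_of_pos_left := fun a ha b c h => by
      obtain ⟨d, rfl⟩ := exists_of_lt h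
      obtain ⟨e, he⟩ := exists_of_lt (mul_pos' ha (zero_lt_succ d))
      refine (lt_iff_exists (a * b) (a * (b + (d + 1)))).2 ⟨e, ?_⟩
      rw [mul_add', he, zero_add']
    mul_lt_mul_of_pos_right := fun a ha b c h => by
      obtain ⟨d, rfl⟩ := exists_of_lt h
      obtain ⟨e, he⟩ := exists_of_lt (mul_pos' ha (zero_lt_succ d))
      refine (lt_iff_exists (b * a) ((b + (d + 1)) * a)).2 ⟨e, ?_⟩
      rw [mul_comm' _ a, mul_comm' _ a, mul_add', he, zero_add']
    exists_add_of_le := fun {a b} h => by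
      rcases h with h | rfl
      · obtain ⟨c, rfl⟩ := exists_of_lt h
        exact ⟨c + 1, rfl⟩
      · exact ⟨0, (add_zero' a).symm⟩
    le_self_add := fun a b => by
      rcases eq_zero_or_lt b with rfl | hb
      · exact .inr (add_zero' a).symm
      · obtain ⟨c, rfl⟩ := exists_of_lt hb
        rw [zero_add']
        exact .inl (lt_add_succ a c)
    le_add_self := fun a b => by
      rw [add_comm']
      rcases eq_zero_or_lt b with rfl | hb
      · exact .inr (add_zero' a).symm
      · obtain ⟨c, rfl⟩ := exists_of_lt hb
        rw [zero_add']
        exact .inl (lt_add_succ a c) }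

end Model

end SOA

/-! ### Computable functions inside a model. -/

namespace SOA

open Function (update)

universe u

variable {M : Type u} [RCA M]

/-! ## Order and pairing -/

theorem lt_succ_iff {a b : M} : a < b + 1 ↔ a ≤ b := RCA.lt_add_one_iff' a b

theorem lt_succ_self (a : M) : a < a + 1 := lt_succ_iff.2 le_rfl

theorem succ_le_iff {a b : M} : a + 1 ≤ b ↔ a < b := by
  rw [← not_lt, lt_succ_iff, not_le]

theorem pos_of_ne_zero' {a : M} (h : a ≠ 0) : 0 < a := lt_of_le_of_ne zero_le h.symm

theorem exists_eq_succ {a : M} (h : a ≠ 0) : ∃ b, a = b + 1 := by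
  obtain ⟨c, hc⟩ := exists_add_of_le (succ_le_iff.2 (pos_of_ne_zero' h))
  exact ⟨c, by rw [hc]; ring⟩

theorem le_mul_self' (a : M) : a ≤ a * a := by
  by_cases h : a = 0
  · simp [h]
  · exact le_mul_of_one_le_left zero_le
      (by simpa using succ_le_iff.2 (pos_of_ne_zero' h))

/-- The code of a pair. -/
def pr (a b : M) : M := (a + b) * (a + b) + a

theorem left_le_pr (a b : M) : a ≤ pr a b := le_add_self

theorem right_le_pr (a b : M) : b ≤ pr a b :=
  (le_add_self.trans (le_mul_self' (a + b))).trans le_self_add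

theorem left_lt_succ_pr (a b : M) : a < pr a b + 1 := lt_succ_iff.2 (left_le_pr a b)

theorem right_lt_succ_pr (a b : M) : b < pr a b + 1 := lt_succ_iff.2 (right_le_pr a b)

/-- The code of a pair with sum s lies between s² and (s + 1)², so codes are sorted by the sum
first. Injectivity of the pairing follows. -/
theorem pr_lt_pr_of_add_lt {a b c d : M} (h : a + b < c + d) : pr a b < pr c d := by
  have h1 : a + b + 1 ≤ c + d := succ_le_iff.2 h
  have h2 : (a + b + 1) * (a + b + 1) ≤ (c + d) * (c + d) := mul_le_mul' h1 h1
  have h3 : pr a b < (a + b + 1) * (a + b + 1) := by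
    have : (a + b + 1) * (a + b + 1) = pr a b + 1 + (a + b + b) := by unfold pr; ring
    rw [this]
    exact lt_of_lt_of_le (lt_succ_self _) le_self_add
  exact (h3.trans_le h2).trans_le le_self_add

theorem pr_lt_pr {a b c d : M} (h : a < c) (h' : b < d) : pr a b < pr c d :=
  pr_lt_pr_of_add_lt (add_lt_add h h')

theorem pr_inj {a b c d : M} : pr a b = pr c d ↔ a = c ∧ b = d := by
  constructor
  · intro h
    rcases lt_trichotomy (a + b) (c + d) with h' | h' | h'
    · exact absurd h (pr_lt_pr_of_add_lt h').ne
    · have : a = c := by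
        unfold pr at h
        rw [h'] at h
        exact add_left_cancel h
      subst this
      exact ⟨rfl, add_left_cancel h'⟩
    · exact absurd h (pr_lt_pr_of_add_lt h').ne'
  · rintro ⟨rfl, rfl⟩; rfl

/-- The components of a pair are at most its code, so decoding costs only bounded quantifiers. -/
theorem bounded_exists_pr {z : M} {P : M → M → Prop} :
    (∃ a, a < z + 1 ∧ ∃ b, b < z + 1 ∧ z = pr a b ∧ P a b) ↔ ∃ a b, z = pr a b ∧ P a b := by
  constructor
  · rintro ⟨a, -, b, -, h⟩
    exact ⟨a, b, h⟩
  · rintro ⟨a, b, rfl, h⟩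
    exact ⟨a, left_lt_succ_pr a b, b, right_lt_succ_pr a b, rfl, h⟩

/-! ## Sets of the model -/

variable (M) in
/-- The structure for the language of second order arithmetic. -/
abbrev toModel : Model.{u} := structureOf M RCA.sets RCA.sets_nonempty

instance : (toModel M).IsRCA0 := RCA.isRCA0

/-- The set belongs to the model. -/
def IsSet (A : Set M) : Prop := A ∈ RCA.sets (M := M)

@[simp] theorem eval_pair (v : ℕ → M) (s t : Term) :
    (pair s t).eval (toModel M) v = pr (s.eval (toModel M) v) (t.eval (toModel M) v) := rfl

@[simp] theorem vars_pair (s t : Term) : (pair s t).vars = s.vars ∪ t.vars := by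
  ext; simp [pair]; tauto

@[simp] theorem eval_exLt (x : ℕ) (t : Term) (φ : Formula) (v : ℕ → M) (w : ℕ → (toModel M).sets) :
    (exLt x t φ).eval (toModel M) v w ↔ ∃ a : M, a < t.eval (toModel M) (update v x a) ∧
      φ.eval (toModel M) (update v x a) w := by
  simp [exLt, Formula.eval]

@[simp] theorem eval_allLt (x : ℕ) (t : Term) (φ : Formula) (v : ℕ → M)
    (w : ℕ → (toModel M).sets) :
    (allLt x t φ).eval (toModel M) v w ↔ ∀ a : M, a < t.eval (toModel M) (update v x a) →
      φ.eval (toModel M) (update v x a) w := by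
  simp [allLt, Formula.eval]

/-- An assignment to the set variables. -/
def setAssign {A B C : Set M} (hA : IsSet A) (hB : IsSet B) (hC : IsSet C) :
    ℕ → (toModel M).sets :=
  fun i => if i = 0 then ⟨A, hA⟩ else if i = 1 then ⟨B, hB⟩ else ⟨C, hC⟩

theorem IsSet.of_iff {A B : Set M} (hA : IsSet A) (h : ∀ z, z ∈ B ↔ z ∈ A) : IsSet B :=
  Set.ext h ▸ hA

/-- Variable 1 is a dummy: with a vacuous quantifier the same bounded formula serves as the Σ⁰₁ and
as the Π⁰₁ side of comprehension. All variables that are not assigned otherwise hold `c`. -/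
theorem isSet_of_bounded {P : M → Prop} (θ : Formula) (hθ : θ.IsBounded) (c : M) {A B C : Set M}
    (hA : IsSet A) (hB : IsSet B) (hC : IsSet C)
    (h : ∀ a y, P a ↔ θ.eval (toModel M) (update (update (fun _ => c) 0 a) 1 y)
      (setAssign hA hB hC)) : IsSet {a | P a} := by
  have := Model.delta_comprehension (𝔐 := toModel M) hθ hθ (fun _ => c) (setAssign hA hB hC)
    (fun a => ⟨fun ⟨y, hy⟩ z => (h a z).1 ((h a y).2 hy), fun h' => ⟨c, h' c⟩⟩)
  refine IsSet.of_iff this fun a => ?_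
  exact ⟨fun ha => ⟨c, (h a c).1 ha⟩, fun ⟨y, hy⟩ => (h a y).2 hy⟩

theorem isSet_pairs {P : M → M → Prop} (θ : Formula) (hθ : θ.IsBounded) (c : M) {A B C : Set M}
    (hA : IsSet A) (hB : IsSet B) (hC : IsSet C)
    (h : ∀ z y a b, P a b ↔ θ.eval (toModel M)
      (update (update (update (update (fun _ => c) 0 z) 1 y) 2 a) 3 b)
      (setAssign hA hB hC)) : IsSet {z | ∃ a b, z = pr a b ∧ P a b} := by
  refine isSet_of_bounded (exLt 2 (.var 0 + 1) (exLt 3 (.var 0 + 1)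
    (.and (.eq (.var 0) (pair (.var 2) (.var 3))) θ))) (by simp [hθ]) c hA hB hC fun z y => ?_
  rw [← bounded_exists_pr]
  simp [Formula.eval, ← h]

/-- A projection is a priori only Σ⁰₁. The set `B` of refutations provides the matching Π⁰₁
description. -/
theorem isSet_delta {A B D : Set M} (hA : IsSet A) (hB : IsSet B) (hD : IsSet D)
    (h : ∀ x, (∃ y, pr x y ∈ A) ↔ x ∈ D ∧ ∀ y, pr x y ∉ B) : IsSet {x | ∃ y, pr x y ∈ A} := by
  have := Model.delta_comprehension (𝔐 := toModel M)
    (θ := .mem (pair (.var 0) (.var 1)) 0)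
    (η := .and (.mem (.var 0) 2) (.neg (.mem (pair (.var 0) (.var 1)) 1))) (by simp) (by simp)
    (fun _ => (0 : M)) (setAssign hA hB hD) (fun x => by
      simp only [Formula.eval]
      refine (h x).trans ?_
      exact ⟨fun h y => ⟨h.1, h.2 y⟩, fun h => ⟨(h 0).1, fun y => (h y).2⟩⟩)
  exact this

/-! ## Computable functions -/

variable (M) in
/-- A type whose elements are coded by numbers. -/
class Enc (α : Type*) where
  enc : α → M
  enc_inj : Function.Injective enc
  isSet_range : IsSet {z | ∃ a, z = enc a}

open Enc

theorem exists_isSet : ∃ A : Set M, IsSet A := RCA.sets_nonempty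

instance instEncSelf : Enc M M where
  enc := id
  enc_inj := fun _ _ h => h
  isSet_range := by
    obtain ⟨A, hA⟩ := exists_isSet (M := M)
    convert isSet_of_bounded (P := fun _ => True) (.eq 0 0) (by simp) 0 hA hA hA (by
      simp [Formula.eval])
    simp

-- With truth values coded by 1 and 0, a predicate is a function into `Prop`, and one notion of
-- computability covers functions and predicates.
open Classical in
noncomputable instance : Enc M Prop where
  enc p := if p then 1 else 0
  enc_inj p q h := by by_cases hp : p <;> by_cases hq : q <;> simp_all
  isSet_range := by
    obtain ⟨A, hA⟩ := exists_isSet (M := M)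
    convert isSet_of_bounded (P := fun z : M => z = 0 ∨ z = 1)
      (.or (.eq (.var 0) 0) (.eq (.var 0) 1)) (by simp) 0 hA hA hA (by
      simp [Formula.eval]) with z
    constructor
    · rintro ⟨p, rfl⟩; by_cases hp : p <;> simp [hp]
    · rintro (rfl | rfl)
      exacts [⟨False, by simp⟩, ⟨True, by simp⟩]

noncomputable instance {α β : Type*} [Enc M α] [Enc M β] : Enc M (α × β) where
  enc p := pr (enc p.1) (enc p.2)
  enc_inj p q h := by
    obtain ⟨h1, h2⟩ := pr_inj.1 h
    exact Prod.ext (enc_inj h1) (enc_inj h2)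
  isSet_range := by
    convert isSet_pairs (P := fun a b : M => (∃ x : α, a = enc x) ∧ ∃ y : β, b = enc y)
      (.and (.mem (.var 2) 0) (.mem (.var 3) 1)) (by simp) 0 (isSet_range (α := α))
      (isSet_range (α := β)) (isSet_range (α := β)) (by
        simp [Formula.eval, setAssign]) with z
    constructor
    · rintro ⟨⟨x, y⟩, rfl⟩; exact ⟨_, _, rfl, ⟨_, rfl⟩, _, rfl⟩
    · rintro ⟨_, _, rfl, ⟨_, rfl⟩, _, rfl⟩; exact ⟨(_, _), rfl⟩

theorem enc_self (a : M) : @enc M ‹_› M instEncSelf a = a := rfl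

variable {α β γ : Type*} [Enc M α] [Enc M β] [Enc M γ]

variable (M) in
/-- The graph of the function belongs to the model. -/
@[fun_prop]
def Comp (f : α → β) : Prop := IsSet {z : M | ∃ a b, z = pr a b ∧ ∃ x, a = enc x ∧ b = enc (f x)}

theorem enc_inj_iff {x y : α} : enc (M := M) x = enc y ↔ x = y := enc_inj.eq_iff

theorem comp_prop_iff {P : α → Prop} : Comp M P ↔ IsSet {z : M | ∃ x, z = enc x ∧ P x} := by
  constructor
  · intro h
    refine IsSet.of_iff (isSet_of_bounded (P := fun z : M => pr z 1 ∈
      {z : M | ∃ a b, z = pr a b ∧ ∃ x, a = enc x ∧ b = enc (P x)})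
      (.mem (pair (.var 0) 1) 0) (by simp) 0 h h h
      fun _ _ => Iff.rfl) fun z => ?_
    simp only [Set.mem_ofPred_eq, pr_inj]
    constructor
    · rintro ⟨x, rfl, hx⟩
      exact ⟨_, _, ⟨rfl, rfl⟩, x, rfl, by simp [enc, hx]⟩
    · rintro ⟨_, _, ⟨rfl, rfl⟩, x, rfl, hx⟩
      refine ⟨x, rfl, ?_⟩
      by_contra hP
      simp [enc, hP] at hx
  · intro h
    refine IsSet.of_iff (isSet_pairs (P := fun a b : M => (∃ x : α, a = enc x) ∧
      ((a ∈ {z : M | ∃ x, z = enc x ∧ P x} ∧ b = 1) ∨ (¬ a ∈ {z : M | ∃ x, z = enc x ∧ P x} ∧ b = 0)))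
      (.and (.mem (.var 2) 0) (.or (.and (.mem (.var 2) 1) (.eq (.var 3) 1))
        (.and (.neg (.mem (.var 2) 1)) (.eq (.var 3) 0)))) (by simp) 0 (isSet_range (α := α)) h h (by
        simp [Formula.eval, setAssign])) fun z => ?_
    simp only [Set.mem_ofPred_eq]
    refine exists_congr fun a => exists_congr fun b => and_congr_right fun _ => ?_
    constructor
    · rintro ⟨x, rfl, rfl⟩
      refine ⟨⟨x, rfl⟩, ?_⟩
      by_cases hP : P x
      · left; exact ⟨⟨x, rfl, hP⟩, by simp [enc, hP]⟩
      · right; refine ⟨?_, by simp [enc, hP]⟩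
        rintro ⟨y, hy, hP'⟩
        rw [enc_inj_iff] at hy
        exact hP (hy ▸ hP')
    · rintro ⟨⟨x, rfl⟩, h⟩
      refine ⟨x, rfl, ?_⟩
      rcases h with ⟨⟨y, hy, hP⟩, rfl⟩ | ⟨hP, rfl⟩
      · rw [enc_inj_iff] at hy
        simp [enc, hy, hP]
      · have : ¬ P x := fun h => hP ⟨x, rfl, h⟩
        simp [enc, this]

namespace Comp

-- Closure properties are registered with `fun_prop`, which then verifies computability of composite
-- expressions without further argument.
@[fun_prop] theorem id' : Comp M (fun x : α => x) := by
  refine IsSet.of_iff (isSet_pairs (P := fun a b : M => (∃ x : α, a = enc x) ∧ a = b)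
      (.and (.mem (.var 2) 0) (.eq (.var 2) (.var 3))) (by simp) 0 (isSet_range (α := α))
      (isSet_range (α := α)) (isSet_range (α := α)) (by simp [Formula.eval, setAssign])) fun z => ?_
  simp only [Set.mem_ofPred_eq]
  refine exists_congr fun a => exists_congr fun b => and_congr_right fun _ => ?_
  constructor
  · rintro ⟨x, rfl, rfl⟩; exact ⟨⟨x, rfl⟩, rfl⟩
  · rintro ⟨⟨x, rfl⟩, rfl⟩; exact ⟨x, rfl, rfl⟩

@[fun_prop] theorem const (c : β) : Comp M (fun _ : α => c) := by
  refine IsSet.of_iff (isSet_pairs (P := fun a b : M => (∃ x : α, a = enc x) ∧ b = enc c)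
      (.and (.mem (.var 2) 0) (.eq (.var 3) (.var 4))) (by simp) (enc c : M) (isSet_range (α := α))
      (isSet_range (α := α)) (isSet_range (α := α)) (by simp [Formula.eval, setAssign])) fun z => ?_
  simp only [Set.mem_ofPred_eq]
  refine exists_congr fun a => exists_congr fun b => and_congr_right fun _ => ?_
  constructor
  · rintro ⟨x, rfl, rfl⟩; exact ⟨⟨x, rfl⟩, rfl⟩
  · rintro ⟨⟨x, rfl⟩, rfl⟩; exact ⟨x, rfl, rfl⟩

-- The intermediate value is unbounded, so this is where full Δ⁰₁ comprehension is used: g(f(x)) = b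
-- holds if some t has f(x) = t and g(t) = b, and fails exactly if some t has f(x) = t and g(t) ≠ b.
@[fun_prop] theorem comp {g : β → γ} {f : α → β} (hg : Comp M g) (hf : Comp M f) :
    Comp M (fun x => g (f x)) := by
  have hA := isSet_pairs (P := fun z t : M => ∃ a b, z = pr a b ∧
      pr a t ∈ {z : M | ∃ a b, z = pr a b ∧ ∃ x, a = enc x ∧ b = enc (f x)} ∧
      pr t b ∈ {z : M | ∃ a b, z = pr a b ∧ ∃ x, a = enc x ∧ b = enc (g x)})
    (exLt 4 (.var 2 + 1) (exLt 5 (.var 2 + 1) (.and (.eq (.var 2) (pair (.var 4) (.var 5)))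
      (.and (.mem (pair (.var 4) (.var 3)) 0) (.mem (pair (.var 3) (.var 5)) 1)))))
    (by simp) 0 hf hg hg (fun z y a b => by
      rw [← bounded_exists_pr]
      simp [Formula.eval, setAssign])
  have hB := isSet_pairs (P := fun z t : M => ∃ a b, z = pr a b ∧
      pr a t ∈ {z : M | ∃ a b, z = pr a b ∧ ∃ x, a = enc x ∧ b = enc (f x)} ∧
      ¬ pr t b ∈ {z : M | ∃ a b, z = pr a b ∧ ∃ x, a = enc x ∧ b = enc (g x)})
    (exLt 4 (.var 2 + 1) (exLt 5 (.var 2 + 1) (.and (.eq (.var 2) (pair (.var 4) (.var 5)))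
      (.and (.mem (pair (.var 4) (.var 3)) 0) (.neg (.mem (pair (.var 3) (.var 5)) 1))))))
    (by simp) 0 hf hg hg (fun z y a b => by
      rw [← bounded_exists_pr]
      simp [Formula.eval, setAssign])
  have hD := isSet_pairs (P := fun a _ : M => ∃ x : α, a = enc x) (.mem (.var 2) 0) (by simp) 0
    (isSet_range (α := α)) (isSet_range (α := α)) (isSet_range (α := α))
    (by simp [Formula.eval, setAssign])
  unfold Comp
  convert isSet_delta hA hB hD (fun z => ?_) using 1
  · ext z
    constructor
    · rintro ⟨_, _, rfl, x, rfl, rfl⟩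
      exact ⟨enc (f x), _, _, rfl, _, _, rfl, ⟨_, _, rfl, x, rfl, rfl⟩, _, _, rfl, _, rfl, rfl⟩
    · rintro ⟨y, _, _, h, a, b, rfl, ⟨a', y', h', x, rfl, rfl⟩, y'', b', h'', x', rfl, rfl⟩
      simp only [pr_inj] at h h' h''
      obtain ⟨rfl, rfl⟩ := h
      obtain ⟨rfl, rfl⟩ := h'
      obtain ⟨h1, rfl⟩ := h''
      rw [enc_inj_iff] at h1
      exact ⟨_, _, rfl, x, rfl, by subst h1; rfl⟩
  · simp only [Set.mem_ofPred_eq]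
    constructor
    · rintro ⟨y, _, _, h, a, b, rfl, ⟨a', y', h', x, rfl, rfl⟩, y'', b', h'', x', rfl, rfl⟩
      simp only [pr_inj] at h h' h''
      obtain ⟨rfl, rfl⟩ := h
      obtain ⟨rfl, rfl⟩ := h'
      obtain ⟨h1, rfl⟩ := h''
      rw [enc_inj_iff] at h1
      subst h1
      refine ⟨⟨_, _, rfl, x, rfl⟩, ?_⟩
      rintro y ⟨_, _, h1, a, b, rfl, ⟨_, _, h2, x'', rfl, rfl⟩, h3⟩
      simp only [pr_inj] at h1 h2
      obtain ⟨⟨rfl, rfl⟩, rfl⟩ := h1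
      obtain ⟨h2, rfl⟩ := h2
      rw [enc_inj_iff] at h2
      subst h2
      exact h3 ⟨_, _, rfl, _, rfl, rfl⟩
    · rintro ⟨⟨_, b, rfl, x, rfl⟩, h⟩
      refine ⟨enc (f x), _, _, rfl, _, _, rfl, ⟨_, _, rfl, x, rfl, rfl⟩, ?_⟩
      by_contra hb
      exact h (enc (f x)) ⟨_, _, rfl, _, _, rfl, ⟨_, _, rfl, x, rfl, rfl⟩, hb⟩

@[fun_prop] theorem prodMk {f : α → β} {g : α → γ} (hf : Comp M f) (hg : Comp M g) :
    Comp M (fun x => (f x, g x)) := by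
  refine IsSet.of_iff (isSet_pairs (P := fun x t : M => ∃ a b, t = pr a b ∧
      pr x a ∈ {z : M | ∃ a b, z = pr a b ∧ ∃ x, a = enc x ∧ b = enc (f x)} ∧
      pr x b ∈ {z : M | ∃ a b, z = pr a b ∧ ∃ x, a = enc x ∧ b = enc (g x)})
    (exLt 4 (.var 3 + 1) (exLt 5 (.var 3 + 1) (.and (.eq (.var 3) (pair (.var 4) (.var 5)))
      (.and (.mem (pair (.var 2) (.var 4)) 0) (.mem (pair (.var 2) (.var 5)) 1)))))
    (by simp) 0 hf hg hg (fun z y a b => by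
      rw [← bounded_exists_pr]
      simp [Formula.eval, setAssign])) fun z => ?_
  simp only [Set.mem_ofPred_eq]
  refine exists_congr fun a => exists_congr fun b => and_congr_right fun _ => ?_
  constructor
  · rintro ⟨x, rfl, rfl⟩
    exact ⟨_, _, rfl, ⟨_, _, rfl, x, rfl, rfl⟩, _, _, rfl, x, rfl, rfl⟩
  · rintro ⟨_, _, rfl, ⟨_, _, h, x, rfl, rfl⟩, _, _, h', x', rfl, rfl⟩
    simp only [pr_inj] at h h'
    obtain ⟨rfl, rfl⟩ := h
    obtain ⟨h', rfl⟩ := h'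
    rw [enc_inj_iff] at h'
    subst h'
    exact ⟨x, rfl, rfl⟩

theorem fst' : Comp M (fun x : α × β => x.1) := by
  refine IsSet.of_iff (isSet_pairs (P := fun t c : M => ∃ a b, t = pr a b ∧
      a ∈ {z : M | ∃ x : α, z = enc x} ∧ b ∈ {z : M | ∃ x : β, z = enc x} ∧ c = a)
    (exLt 4 (.var 2 + 1) (exLt 5 (.var 2 + 1) (.and (.eq (.var 2) (pair (.var 4) (.var 5)))
      (.and (.mem (.var 4) 0) (.and (.mem (.var 5) 1) (.eq (.var 3) (.var 4)))))))
    (by simp) 0 (isSet_range (α := α)) (isSet_range (α := β)) (isSet_range (α := β))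
    (fun z y a b => by
      rw [← bounded_exists_pr]
      simp [Formula.eval, setAssign, -Set.mem_ofPred_eq])) fun z => ?_
  simp only [Set.mem_ofPred_eq]
  refine exists_congr fun a => exists_congr fun b => and_congr_right fun _ => ?_
  constructor
  · rintro ⟨x, rfl, rfl⟩
    exact ⟨_, _, rfl, ⟨_, rfl⟩, ⟨_, rfl⟩, rfl⟩
  · rintro ⟨_, _, rfl, ⟨x, rfl⟩, ⟨y, rfl⟩, rfl⟩
    exact ⟨(x, y), rfl, rfl⟩

theorem snd' : Comp M (fun x : α × β => x.2) := by
  refine IsSet.of_iff (isSet_pairs (P := fun t c : M => ∃ a b, t = pr a b ∧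
      a ∈ {z : M | ∃ x : α, z = enc x} ∧ b ∈ {z : M | ∃ x : β, z = enc x} ∧ c = b)
    (exLt 4 (.var 2 + 1) (exLt 5 (.var 2 + 1) (.and (.eq (.var 2) (pair (.var 4) (.var 5)))
      (.and (.mem (.var 4) 0) (.and (.mem (.var 5) 1) (.eq (.var 3) (.var 5)))))))
    (by simp) 0 (isSet_range (α := α)) (isSet_range (α := β)) (isSet_range (α := β))
    (fun z y a b => by
      rw [← bounded_exists_pr]
      simp [Formula.eval, setAssign, -Set.mem_ofPred_eq])) fun z => ?_
  simp only [Set.mem_ofPred_eq]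
  refine exists_congr fun a => exists_congr fun b => and_congr_right fun _ => ?_
  constructor
  · rintro ⟨x, rfl, rfl⟩
    exact ⟨_, _, rfl, ⟨_, rfl⟩, ⟨_, rfl⟩, rfl⟩
  · rintro ⟨_, _, rfl, ⟨x, rfl⟩, ⟨y, rfl⟩, rfl⟩
    exact ⟨(x, y), rfl, rfl⟩

@[fun_prop] theorem fst {f : α → β × γ} (hf : Comp M f) : Comp M (fun x => (f x).1) :=
  comp fst' hf

@[fun_prop] theorem snd {f : α → β × γ} (hf : Comp M f) : Comp M (fun x => (f x).2) :=
  comp snd' hf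

@[fun_prop] theorem not {P : α → Prop} (hP : Comp M P) : Comp M (fun x => ¬ P x) := by
  rw [comp_prop_iff] at hP ⊢
  convert isSet_of_bounded (P := fun z : M => z ∈ {z : M | ∃ x : α, z = enc x} ∧
    ¬ z ∈ {z : M | ∃ x, z = enc x ∧ P x})
    (.and (.mem (.var 0) 0) (.neg (.mem (.var 0) 1))) (by simp) 0 (isSet_range (α := α)) hP hP
    (by simp [Formula.eval, setAssign]) with z
  simp only [Set.mem_ofPred_eq]
  constructor
  · rintro ⟨x, rfl, hx⟩
    refine ⟨⟨x, rfl⟩, ?_⟩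
    rintro ⟨y, hy, hP⟩
    rw [enc_inj_iff] at hy
    exact hx (hy ▸ hP)
  · rintro ⟨⟨x, rfl⟩, h⟩
    exact ⟨x, rfl, fun hx => h ⟨x, rfl, hx⟩⟩

@[fun_prop] theorem and {P Q : α → Prop} (hP : Comp M P) (hQ : Comp M Q) :
    Comp M (fun x => P x ∧ Q x) := by
  rw [comp_prop_iff] at hP hQ ⊢
  convert isSet_of_bounded (P := fun z : M => z ∈ {z : M | ∃ x, z = enc x ∧ P x} ∧
    z ∈ {z : M | ∃ x, z = enc x ∧ Q x})
    (.and (.mem (.var 0) 0) (.mem (.var 0) 1)) (by simp) 0 hP hQ hQ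
    (by simp [Formula.eval, setAssign]) with z
  simp only [Set.mem_ofPred_eq]
  constructor
  · rintro ⟨x, rfl, hx, hx'⟩
    exact ⟨⟨x, rfl, hx⟩, x, rfl, hx'⟩
  · rintro ⟨⟨x, rfl, hx⟩, y, hy, hx'⟩
    rw [enc_inj_iff] at hy
    exact ⟨x, rfl, hx, hy ▸ hx'⟩

theorem of_iff {P Q : α → Prop} (hP : Comp M P) (h : ∀ x, Q x ↔ P x) : Comp M Q := by
  rwa [show Q = P from funext fun x => propext (h x)]

@[fun_prop] theorem or {P Q : α → Prop} (hP : Comp M P) (hQ : Comp M Q) :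
    Comp M (fun x => P x ∨ Q x) :=
  of_iff (P := fun x => ¬ (¬ P x ∧ ¬ Q x)) (by fun_prop) fun x => by tauto

@[fun_prop] theorem imp {P Q : α → Prop} (hP : Comp M P) (hQ : Comp M Q) :
    Comp M (fun x => P x → Q x) :=
  of_iff (P := fun x => ¬ (P x ∧ ¬ Q x)) (by fun_prop) fun x => by tauto

@[fun_prop] theorem iff {P Q : α → Prop} (hP : Comp M P) (hQ : Comp M Q) :
    Comp M (fun x => P x ↔ Q x) :=
  of_iff (P := fun x => (P x → Q x) ∧ (Q x → P x)) (by fun_prop) fun x => by tauto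

theorem eq' : Comp M (fun x : α × α => x.1 = x.2) := by
  rw [comp_prop_iff]
  convert isSet_pairs (P := fun a b : M => a ∈ {z : M | ∃ x : α, z = enc x} ∧ a = b)
    (.and (.mem (.var 2) 0) (.eq (.var 2) (.var 3)))
    (by simp) 0 (isSet_range (α := α)) (isSet_range (α := α)) (isSet_range (α := α))
    (by simp [Formula.eval, setAssign]) with z
  constructor
  · rintro ⟨⟨x, y⟩, rfl, h⟩
    simp only at h; subst h
    exact ⟨_, _, rfl, ⟨_, rfl⟩, rfl⟩
  · rintro ⟨_, _, rfl, ⟨x, rfl⟩, rfl⟩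
    exact ⟨(x, x), rfl, rfl⟩

@[fun_prop] theorem eq {f g : α → β} (hf : Comp M f) (hg : Comp M g) :
    Comp M (fun x => f x = g x) := comp eq' (prodMk hf hg)

theorem graph_iff {f : α → β} : Comp M f ↔ Comp M (fun p : α × β => f p.1 = p.2) := by
  rw [comp_prop_iff]
  unfold Comp
  refine iff_of_eq (congrArg _ ?_)
  ext z
  constructor
  · rintro ⟨_, _, rfl, x, rfl, rfl⟩
    exact ⟨(x, f x), rfl, rfl⟩
  · rintro ⟨⟨x, y⟩, rfl, h⟩
    simp only at h; subst h
    exact ⟨_, _, rfl, x, rfl, rfl⟩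

/-- This admits functions that are introduced by classical choice, as long as their values are
pinned down by a computable relation. -/
theorem of_graph {f : α → β} {P : α → β → Prop} (hP : Comp M (fun p : α × β => P p.1 p.2))
    (h : ∀ x y, f x = y ↔ P x y) : Comp M f :=
  graph_iff.2 (hP.of_iff fun p => h p.1 p.2)

theorem lt' : Comp M (fun x : M × M => x.1 < x.2) := by
  rw [comp_prop_iff]
  convert isSet_pairs (P := fun a b : M => a < b) (.lt (.var 2) (.var 3))
    (by simp) 0 (isSet_range (α := M)) (isSet_range (α := M)) (isSet_range (α := M))
    (by simp [Formula.eval]) with z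
  constructor
  · rintro ⟨⟨x, y⟩, rfl, h⟩
    exact ⟨_, _, rfl, h⟩
  · rintro ⟨a, b, rfl, h⟩
    exact ⟨(a, b), rfl, h⟩

@[fun_prop] theorem lt {f g : α → M} (hf : Comp M f) (hg : Comp M g) :
    Comp M (fun x => f x < g x) := comp lt' (prodMk hf hg)

@[fun_prop] theorem le {f g : α → M} (hf : Comp M f) (hg : Comp M g) :
    Comp M (fun x => f x ≤ g x) :=
  of_iff (P := fun x => ¬ g x < f x) (by fun_prop) fun x => not_lt.symm

theorem add' : Comp M (fun x : M × M => x.1 + x.2) := by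
  rw [graph_iff, comp_prop_iff]
  convert isSet_pairs (P := fun t c : M => ∃ a b, t = pr a b ∧ a + b = c)
    (exLt 4 (.var 2 + 1) (exLt 5 (.var 2 + 1) (.and (.eq (.var 2) (pair (.var 4) (.var 5)))
      (.eq (.var 4 + .var 5) (.var 3)))))
    (by simp) 0 (isSet_range (α := M)) (isSet_range (α := M)) (isSet_range (α := M))
    (fun z y a b => by
      rw [← bounded_exists_pr]
      simp [Formula.eval]) with z
  constructor
  · rintro ⟨⟨⟨x, y⟩, z⟩, rfl, h⟩
    exact ⟨_, _, rfl, _, _, rfl, h⟩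
  · rintro ⟨_, z, rfl, a, b, rfl, h⟩
    exact ⟨((a, b), z), rfl, h⟩

theorem mul' : Comp M (fun x : M × M => x.1 * x.2) := by
  rw [graph_iff, comp_prop_iff]
  convert isSet_pairs (P := fun t c : M => ∃ a b, t = pr a b ∧ a * b = c)
    (exLt 4 (.var 2 + 1) (exLt 5 (.var 2 + 1) (.and (.eq (.var 2) (pair (.var 4) (.var 5)))
      (.eq (.var 4 * .var 5) (.var 3)))))
    (by simp) 0 (isSet_range (α := M)) (isSet_range (α := M)) (isSet_range (α := M))
    (fun z y a b => by
      rw [← bounded_exists_pr]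
      simp [Formula.eval]) with z
  constructor
  · rintro ⟨⟨⟨x, y⟩, z⟩, rfl, h⟩
    exact ⟨_, _, rfl, _, _, rfl, h⟩
  · rintro ⟨_, z, rfl, a, b, rfl, h⟩
    exact ⟨((a, b), z), rfl, h⟩

@[fun_prop] theorem add {f g : α → M} (hf : Comp M f) (hg : Comp M g) :
    Comp M (fun x => f x + g x) := comp add' (prodMk hf hg)

@[fun_prop] theorem mul {f g : α → M} (hf : Comp M f) (hg : Comp M g) :
    Comp M (fun x => f x * g x) := comp mul' (prodMk hf hg)

@[fun_prop] theorem pr {f g : α → M} (hf : Comp M f) (hg : Comp M g) :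
    Comp M (fun x => pr (f x) (g x)) := by
  unfold SOA.pr
  fun_prop

theorem forall_lt' {P : α → M → Prop} (hP : Comp M fun p : α × M => P p.1 p.2) :
    Comp M (fun x : α × M => ∀ y, y < x.2 → P x.1 y) := by
  rw [comp_prop_iff] at hP ⊢
  convert isSet_pairs (P := fun a b : M => a ∈ {z : M | ∃ x : α, z = enc x} ∧
      ∀ y, y < b → SOA.pr a y ∈ {z : M | ∃ x : α × M, z = enc x ∧ P x.1 x.2})
    (.and (.mem (.var 2) 0) (allLt 4 (.var 3) (.mem (pair (.var 2) (.var 4)) 1)))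
    (by simp) 0 (isSet_range (α := α)) hP hP
    (by
      intros
      simp [Formula.eval, setAssign]) with z
  constructor
  · rintro ⟨⟨x, n⟩, rfl, h⟩
    exact ⟨_, _, rfl, ⟨x, rfl⟩, fun y hy => ⟨(x, y), rfl, h y hy⟩⟩
  · rintro ⟨_, n, rfl, ⟨x, rfl⟩, h⟩
    refine ⟨(x, n), rfl, fun y hy => ?_⟩
    obtain ⟨⟨x', y'⟩, h1, h2⟩ := h y hy
    obtain ⟨h3, h4⟩ := pr_inj.1 h1
    rw [enc_inj_iff] at h3
    simp only [enc_self] at h3 h4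
    subst h3 h4
    exact h2

@[fun_prop] theorem forall_lt {f : α → M} {P : α → M → Prop} (hf : Comp M f)
    (hP : Comp M fun p : α × M => P p.1 p.2) : Comp M (fun x => ∀ y, y < f x → P x y) :=
  comp (forall_lt' hP) (prodMk id' hf)

@[fun_prop] theorem exists_lt {f : α → M} {P : α → M → Prop} (hf : Comp M f)
    (hP : Comp M fun p : α × M => P p.1 p.2) : Comp M (fun x => ∃ y, y < f x ∧ P x y) :=
  of_iff (P := fun x => ¬ ∀ y, y < f x → ¬ P x y) (by fun_prop) fun x => by push Not; rfl

@[fun_prop] theorem ite {P : α → Prop} [DecidablePred P] {f g : α → β} (hP : Comp M P) (hf : Comp M f)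
    (hg : Comp M g) : Comp M (fun x => if P x then f x else g x) :=
  of_graph (P := fun x y => (P x → f x = y) ∧ (¬ P x → g x = y)) (by fun_prop) fun x y => by
    by_cases h : P x <;> simp [h]

theorem mem_set {A : Set M} (hA : IsSet A) : Comp M (fun z : M => z ∈ A) := by
  rw [comp_prop_iff]
  convert hA using 1
  ext z
  exact ⟨fun ⟨x, hx, hx'⟩ => hx ▸ hx', fun hz => ⟨z, rfl, hz⟩⟩

theorem isSet {P : M → Prop} (hP : Comp M P) : IsSet {z | P z} := by
  rw [comp_prop_iff] at hP
  convert hP using 1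
  ext z
  exact ⟨fun hz => ⟨z, rfl, hz⟩, fun ⟨x, hx, hx'⟩ => hx ▸ hx'⟩

end Comp

/-! ## Induction and choice -/

/-- The relation is turned into a set parameter, so that the atomic formula "the pair lies in A"
carries the induction. -/
theorem sigma_induction {P : M → M → Prop} (hP : Comp M fun p : M × M => P p.1 p.2)
    (h0 : ∃ y, P 0 y) (hs : ∀ n, (∃ y, P n y) → ∃ y, P (n + 1) y) (n : M) : ∃ y, P n y := by
  have hA : IsSet {z | ∃ a b, z = pr a b ∧ P a b} := by
    have := comp_prop_iff.1 hP
    convert this using 1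
    ext z
    exact ⟨fun ⟨a, b, hz, h⟩ => ⟨(a, b), hz, h⟩, fun ⟨⟨a, b⟩, hz, h⟩ => ⟨a, b, hz, h⟩⟩
  have key : ∀ a b, P a b ↔ pr a b ∈ {z | ∃ a b, z = pr a b ∧ P a b} := fun a b =>
    ⟨fun h => ⟨a, b, rfl, h⟩, by
      rintro ⟨a', b', h, h'⟩
      obtain ⟨rfl, rfl⟩ := pr_inj.1 h
      exact h'⟩
  refine (exists_congr fun y => key n y).2 ?_
  exact Model.sigma_induction (𝔐 := toModel M) (θ := .mem (pair (.var 0) (.var 1)) 0) (by simp)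
    (fun _ => (0 : M)) (setAssign hA hA hA)
    (h0.imp fun y => (key 0 y).1) (fun n h => (hs n (h.imp fun y => (key n y).2)).imp
      fun y => (key (n + 1) y).1) n

theorem comp_induction {P : M → Prop} (hP : Comp M P) (h0 : P 0) (hs : ∀ n, P n → P (n + 1))
    (n : M) : P n := by
  obtain ⟨-, h⟩ := sigma_induction (P := fun n _ => P n) (by fun_prop) ⟨0, h0⟩
    (fun n ⟨_, h⟩ => ⟨0, hs n h⟩) n
  exact h

theorem comp_strong_induction {P : M → Prop} (hP : Comp M P)
    (hs : ∀ n, (∀ k, k < n → P k) → P n) (n : M) : P n := by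
  refine hs n (comp_induction (P := fun n => ∀ k, k < n → P k) (by fun_prop) (fun k hk => ?_)
    (fun n ih k hk => ?_) n)
  · exact absurd hk (not_lt.2 zero_le)
  · rcases (lt_succ_iff.1 hk).lt_or_eq with h | rfl
    exacts [ih k h, hs k ih]

theorem exists_least {P : M → Prop} (hP : Comp M P) (h : ∃ n, P n) :
    ∃ n, P n ∧ ∀ k, k < n → ¬ P k := by
  by_contra hc
  push Not at hc
  obtain ⟨n, hn⟩ := h
  refine comp_strong_induction (P := fun n => ¬ P n) (by fun_prop) (fun n ih hn => ?_) n hn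
  obtain ⟨k, hk, hk'⟩ := hc n hn
  exact ih k hk hk'

/-- Choose the least witness: minimality is a bounded condition, so the graph is computable. -/
theorem exists_comp_choice {P : α → M → Prop} (hP : Comp M fun p : α × M => P p.1 p.2)
    (h : ∀ x, ∃ y, P x y) : ∃ f : α → M, Comp M f ∧ ∀ x, P x (f x) := by
  choose f hf hf' using fun x => exists_least (P := fun y => P x y)
    (hP.comp (f := fun y => (x, y)) (by fun_prop)) (h x)
  refine ⟨f, Comp.of_graph (P := fun x y => P x y ∧ ∀ z, z < y → ¬ P x z) ?_ ?_, hf⟩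
  · refine Comp.and hP (Comp.forall_lt (by fun_prop) (Comp.not ?_))
    exact hP.comp (f := fun p : (α × M) × M => (p.1.1, p.2)) (by fun_prop)
  · intro x y
    constructor
    · rintro rfl
      exact ⟨hf x, hf' x⟩
    · rintro ⟨h1, h2⟩
      rcases lt_trichotomy (f x) y with h | h | h
      exacts [(h2 _ h (hf x)).elim, h, (hf' x y h h1).elim]

/-- Choice, with the value `0` where there is nothing to choose. -/
theorem exists_comp_choice_of {P : α → M → Prop} {Q : α → Prop}
    (hP : Comp M fun p : α × M => P p.1 p.2) (hQ : Comp M Q)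
    (h : ∀ x, Q x → ∃ y, P x y) : ∃ f : α → M, Comp M f ∧ ∀ x, Q x → P x (f x) := by
  obtain ⟨f, hf, hf'⟩ := exists_comp_choice (P := fun x y => Q x → P x y) (by fun_prop) fun x => by
    by_cases hx : Q x
    · obtain ⟨y, hy⟩ := h x hx
      exact ⟨y, fun _ => hy⟩
    · exact ⟨0, fun h => (hx h).elim⟩
  exact ⟨f, hf, hf'⟩

end SOA

/-! ### Coding of finite sets and of sequences. -/

namespace SOA

universe u

variable {M : Type u} [RCA M] {α β γ : Type*} [Enc M α] [Enc M β] [Enc M γ]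

/-! ## Divisibility -/

theorem dvd_iff_lt {a b : M} : a ∣ b ↔ ∃ q, q < b + 1 ∧ b = a * q := by
  constructor
  · rintro ⟨q, rfl⟩
    by_cases ha : a = 0
    · exact ⟨0, by simp [ha], by simp [ha]⟩
    · refine ⟨q, lt_succ_iff.2 (le_mul_of_one_le_left zero_le ?_), rfl⟩
      simpa using succ_le_iff.2 (pos_of_ne_zero' ha)
  · rintro ⟨q, -, h⟩
    exact ⟨q, h⟩

@[fun_prop] theorem Comp.dvd {f g : α → M} (hf : Comp M f) (hg : Comp M g) :
    Comp M (fun x => f x ∣ g x) :=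
  Comp.of_iff (P := fun x => ∃ q, q < g x + 1 ∧ g x = f x * q) (by fun_prop) fun _ => dvd_iff_lt

/-- There is no subtraction, so the two quotients are compared and the difference is taken between
them. -/
theorem dvd_of_dvd_add {p x r : M} (h : p ∣ x) (h' : p ∣ x + r) : p ∣ r := by
  obtain ⟨a, rfl⟩ := h
  obtain ⟨b, hb⟩ := h'
  by_cases hp : p = 0
  · subst hp
    simp only [zero_mul, zero_add] at hb
    exact hb ▸ dvd_rfl
  · have hab : a ≤ b := by
      by_contra hab
      have h1 := mul_lt_mul_of_pos_left (not_le.1 hab) (pos_of_ne_zero' hp)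
      rw [← hb] at h1
      exact absurd h1 (not_lt.2 le_self_add)
    obtain ⟨c, rfl⟩ := exists_add_of_le hab
    rw [mul_add] at hb
    exact ⟨c, add_left_cancel hb⟩

/-- A substitute for the factorial, which cannot be defined yet: primitive recursion depends on the
coding that is built from this lemma. -/
theorem exists_common_multiple (k : M) :
    ∃ m : M, 0 < m ∧ ∀ j, j < k + 1 → 0 < j → j ∣ m := by
  refine sigma_induction (P := fun k m : M => 0 < m ∧ ∀ j, j < k + 1 → 0 < j → j ∣ m)
    (by fun_prop) ⟨1, zero_lt_one, fun j hj hj' => ?_⟩ (fun k ⟨m, hm, h⟩ => ?_) k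
  · rw [lt_succ_iff] at hj
    exact absurd hj' (not_lt.2 hj)
  · refine ⟨m * (k + 1), mul_pos hm (zero_le.trans_lt (lt_succ_self k)), fun j hj hj' => ?_⟩
    rcases (lt_succ_iff.1 hj).lt_or_eq with h1 | rfl
    · exact (h j h1 hj').mul_right _
    · exact dvd_mul_left _ _

/-- The numbers `m(i + 1) + 1` for `i < k` are pairwise coprime if `m` is a multiple of all positive
numbers up to `k`. -/
theorem dvd_of_dvd_mul_of_ne {k m n i l : M} (hm : ∀ j, j < k + 1 → 0 < j → j ∣ m) (hi : i < k)
    (hl : l < k) (hil : i ≠ l) (h : m * (i + 1) + 1 ∣ n * (m * (l + 1) + 1)) :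
    m * (i + 1) + 1 ∣ n := by
  suffices H : ∃ d, 0 < d ∧ d < k + 1 ∧ m * (i + 1) + 1 ∣ n * d by
    obtain ⟨d, hd, hd', h⟩ := H
    obtain ⟨e, rfl⟩ := hm d hd' hd
    -- With m = d e and p = m (i + 1) + 1, one has n d e (i + 1) + n = n p, so that p divides n as
    -- soon as it divides n d.
    refine dvd_of_dvd_add (x := n * d * e * (i + 1)) ((h.mul_right _).mul_right _) ?_
    exact ⟨n, by ring⟩
  -- Eliminate m: the numbers (i + 1)(m(l + 1) + 1) and (l + 1)(m(i + 1) + 1) differ by the distance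
  -- of i and l, which is the required d.
  rcases hil.lt_or_gt with h' | h'
  · obtain ⟨d, rfl⟩ := exists_add_of_le h'.le
    refine ⟨d, pos_of_ne_zero' (by rintro rfl; simp at h'),
      lt_succ_iff.2 (le_add_self.trans hl.le), ?_⟩
    refine dvd_of_dvd_add (h.mul_right (i + 1)) ⟨n * (i + d + 1), by ring⟩
  · obtain ⟨d, rfl⟩ := exists_add_of_le h'.le
    refine ⟨d, pos_of_ne_zero' (by rintro rfl; simp at h'),
      lt_succ_iff.2 (le_add_self.trans hi.le), ?_⟩
    refine dvd_of_dvd_add (x := (m * (l + d + 1) + 1) * (n * (l + 1))) (dvd_mul_right _ _) ?_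
    convert h.mul_right (l + d + 1) using 1
    ring

/-! ## Codes of finite sets -/

/-- `i` belongs to the finite set described by `a`. -/
def Mem (i a : M) : Prop := ∃ k m n, a = pr k (pr m n) ∧ i < k ∧ ∃ q, n = (m * (i + 1) + 1) * q

/-- The number is a triple. -/
def IsTriple (a : M) : Prop := ∃ k m n, a = pr k (pr m n)

/-- The number is the code of a finite set. -/
def IsFin (a : M) : Prop := IsTriple a ∧ ∀ b, b < a ∧ IsTriple b → ¬ ∀ i, Mem i a ↔ Mem i b

theorem Mem.lt {i a : M} (h : Mem i a) : i < a := by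
  obtain ⟨k, m, n, rfl, h, -⟩ := h
  exact h.trans_le (left_le_pr _ _)

theorem mem_iff_bounded {i a : M} : Mem i a ↔ ∃ k, k < a + 1 ∧ ∃ m, m < a + 1 ∧ ∃ n, n < a + 1 ∧
    a = pr k (pr m n) ∧ i < k ∧ (m * (i + 1) + 1) ∣ n := by
  constructor
  · rintro ⟨k, m, n, rfl, h⟩
    exact ⟨k, left_lt_succ_pr _ _, m, lt_succ_iff.2 ((left_le_pr _ _).trans (right_le_pr _ _)),
      n, lt_succ_iff.2 ((right_le_pr _ _).trans (right_le_pr _ _)), rfl, h⟩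
  · rintro ⟨k, -, m, -, n, -, h⟩
    exact ⟨k, m, n, h⟩

theorem isTriple_iff_bounded {a : M} :
    IsTriple a ↔ ∃ k, k < a + 1 ∧ ∃ m, m < a + 1 ∧ ∃ n, n < a + 1 ∧ a = pr k (pr m n) := by
  constructor
  · rintro ⟨k, m, n, rfl⟩
    exact ⟨k, left_lt_succ_pr _ _, m, lt_succ_iff.2 ((left_le_pr _ _).trans (right_le_pr _ _)),
      n, lt_succ_iff.2 ((right_le_pr _ _).trans (right_le_pr _ _)), rfl⟩
  · rintro ⟨k, -, m, -, n, -, h⟩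
    exact ⟨k, m, n, h⟩

@[fun_prop] theorem Comp.mem {f g : α → M} (hf : Comp M f) (hg : Comp M g) :
    Comp M (fun x => Mem (f x) (g x)) :=
  Comp.of_iff (by fun_prop) fun _ => mem_iff_bounded

@[fun_prop] theorem Comp.isTriple {f : α → M} (hf : Comp M f) : Comp M (fun x => IsTriple (f x)) :=
  Comp.of_iff (by fun_prop) fun _ => isTriple_iff_bounded

theorem mem_iff_mem_iff_bounded {a b : M} :
    (∀ i, Mem i a ↔ Mem i b) ↔ ∀ i, i < a + b → (Mem i a ↔ Mem i b) :=
  ⟨fun h i _ => h i, fun h i => ⟨fun hi => (h i (hi.lt.trans_le le_self_add)).1 hi,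
    fun hi => (h i (hi.lt.trans_le le_add_self)).2 hi⟩⟩

@[fun_prop] theorem Comp.isFin {f : α → M} (hf : Comp M f) : Comp M (fun x => IsFin (f x)) :=
  Comp.of_iff (P := fun x => IsTriple (f x) ∧ ∀ b, b < f x → IsTriple b →
    ¬ ∀ i, i < f x + b → (Mem i (f x) ↔ Mem i b)) (by fun_prop) fun x => by
      simp only [IsFin, mem_iff_mem_iff_bounded, and_imp]

theorem IsFin.ext {a b : M} (ha : IsFin a) (hb : IsFin b) (h : ∀ i, Mem i a ↔ Mem i b) : a = b := by
  rcases lt_trichotomy a b with h' | h' | h'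
  · exact (hb.2 a ⟨h', ha.1⟩ fun i => (h i).symm).elim
  · exact h'
  · exact (ha.2 b ⟨h', hb.1⟩ h).elim

theorem exists_isFin_of_isTriple {a : M} (ha : IsTriple a) :
    ∃ b, IsFin b ∧ ∀ i, Mem i b ↔ Mem i a := by
  obtain ⟨b, ⟨hb, hba⟩, hb'⟩ := exists_least
    (P := fun b => IsTriple b ∧ ∀ i, i < b + a → (Mem i b ↔ Mem i a))
    (by fun_prop) ⟨a, ha, fun _ _ => Iff.rfl⟩
  rw [← mem_iff_mem_iff_bounded] at hba
  refine ⟨b, ⟨hb, fun c ⟨hc, hc'⟩ h => hb' c hc ⟨hc', ?_⟩⟩, hba⟩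
  exact fun i _ => (h i).symm.trans (hba i)

/-- Finite comprehension. -/
theorem exists_isFin {P : M → Prop} (hP : Comp M P) (k : M) :
    ∃ a, IsFin a ∧ ∀ i, Mem i a ↔ i < k ∧ P i := by
  obtain ⟨m, hm, hm'⟩ := exists_common_multiple k
  -- The witness n is the product of the moduli m (j + 1) + 1 over the j < l in the set; by
  -- coprimality no other modulus divides it. It starts as the empty product 1, and m > 0 ensures
  -- that no modulus equals 1.
  have key : ∀ l : M, ∃ n : M, ∀ i, i < k → ((m * (i + 1) + 1) ∣ n ↔ i < l ∧ P i) := by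
    refine sigma_induction
      (P := fun l n : M => ∀ i, i < k → ((m * (i + 1) + 1) ∣ n ↔ i < l ∧ P i)) (by fun_prop)
      ⟨1, fun i _ => ⟨fun h => ?_, fun h => absurd h.1 (not_lt.2 zero_le)⟩⟩
      (fun l ⟨n, hn⟩ => ?_)
    · obtain ⟨q, -, hq⟩ := dvd_iff_lt.1 h
      have h1 : 0 < m * (i + 1) := mul_pos hm (zero_le.trans_lt (lt_succ_self i))
      have h2 : q ≠ 0 := by rintro rfl; simp at hq
      have h3 : m * (i + 1) + 1 ≤ 1 :=
        le_of_le_of_eq (le_mul_of_one_le_right zero_le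
          (by simpa using succ_le_iff.2 (pos_of_ne_zero' h2))) hq.symm
      exact absurd (succ_le_iff.1 h3) (not_lt.2 (by simpa using succ_le_iff.2 h1))
    · by_cases hl : P l ∧ l < k
      · refine ⟨n * (m * (l + 1) + 1), fun i hi => ⟨fun h => ?_, fun ⟨h, h'⟩ => ?_⟩⟩
        · by_cases hil : i = l
          · subst hil
            exact ⟨lt_succ_self i, hl.1⟩
          · obtain ⟨h1, h2⟩ := (hn i hi).1 (dvd_of_dvd_mul_of_ne hm' hi hl.2 hil h)
            exact ⟨h1.trans (lt_succ_self l), h2⟩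
        · rcases (lt_succ_iff.1 h).lt_or_eq with h1 | rfl
          · exact ((hn i hi).2 ⟨h1, h'⟩).mul_right _
          · exact dvd_mul_left _ _
      · refine ⟨n, fun i hi => (hn i hi).trans
          ⟨fun h => ⟨h.1.trans (lt_succ_self l), h.2⟩, fun ⟨h, h'⟩ => ⟨?_, h'⟩⟩⟩
        rcases (lt_succ_iff.1 h).lt_or_eq with h1 | rfl
        · exact h1
        · exact (hl ⟨h', hi⟩).elim
  obtain ⟨n, hn⟩ := key k
  obtain ⟨a, ha, ha'⟩ := exists_isFin_of_isTriple (a := pr k (pr m n)) ⟨k, m, n, rfl⟩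
  refine ⟨a, ha, fun i => (ha' i).trans ⟨?_, fun ⟨h, h'⟩ => ⟨k, m, n, rfl, h, (hn i h).2 ⟨h, h'⟩⟩⟩⟩
  rintro ⟨k', m', n', h, hi, hi'⟩
  obtain ⟨rfl, h'⟩ := pr_inj.1 h
  obtain ⟨rfl, rfl⟩ := pr_inj.1 h'
  exact (hn i hi).1 hi'

open Classical in
/-- The code of the finite set `{i < k | P i}`. -/
noncomputable def mkFin (k : M) (P : M → Prop) : M :=
  if h : ∃ a, IsFin a ∧ ∀ i, Mem i a ↔ i < k ∧ P i then h.choose else 0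

section mkFin

variable {k : M} {P : M → Prop}

/-- For a computable predicate the default value 0 in the definition never comes into play. -/
theorem mkFin_spec (hP : Comp M P) :
    IsFin (mkFin k P) ∧ ∀ i, Mem i (mkFin k P) ↔ i < k ∧ P i := by
  have h := exists_isFin hP k
  rw [mkFin, dif_pos h]
  exact h.choose_spec

theorem isFin_mkFin (hP : Comp M P) : IsFin (mkFin k P) := (mkFin_spec hP).1

theorem mem_mkFin (hP : Comp M P) {i : M} : Mem i (mkFin k P) ↔ i < k ∧ P i := (mkFin_spec hP).2 i

end mkFin

-- Codes are unique and members lie below their code, so a bounded comparison of members determines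
-- the graph.
@[fun_prop] theorem Comp.mkFin {f : α → M} {P : α → M → Prop} (hf : Comp M f)
    (hP : Comp M fun p : α × M => P p.1 p.2) : Comp M (fun x => mkFin (f x) (fun y => P x y)) := by
  have hP' : ∀ x, Comp M (P x) := fun x => hP.comp (f := fun y => (x, y)) (by fun_prop)
  refine Comp.of_graph (P := fun x a => IsFin a ∧ ∀ i, i < a + f x → (Mem i a ↔ i < f x ∧ P x i))
    (by fun_prop) fun x a => ?_
  constructor
  · rintro rfl
    exact ⟨isFin_mkFin (hP' x), fun i _ => mem_mkFin (hP' x)⟩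
  · rintro ⟨ha, h⟩
    refine (isFin_mkFin (hP' x)).ext ha fun i => (mem_mkFin (hP' x)).trans ?_
    exact ⟨fun hi => (h i (hi.1.trans_le le_add_self)).2 hi,
      fun hi => (h i (hi.lt.trans_le le_self_add)).1 hi⟩

/-! ## Primitive recursion -/

/-- A bound on the values is needed to fit the graph of an initial segment of F into a finite set.
-/
theorem exists_bound {F : M → M} (hF : Comp M F) (n : M) : ∃ b, ∀ k, k < n → F k < b := by
  refine sigma_induction (P := fun n b : M => ∀ k, k < n → F k < b) (by fun_prop)
    ⟨0, fun k hk => absurd hk (not_lt.2 zero_le)⟩ (fun n ⟨b, hb⟩ => ?_) n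
  refine ⟨b + F n + 1, fun k hk => lt_succ_iff.2 ?_⟩
  rcases (lt_succ_iff.1 hk).lt_or_eq with h | rfl
  exacts [(hb k h).le.trans le_self_add, le_add_self]

/-- A sequence is coded by its finite graph. Whether an entry exists is a bounded question, since
the entries lie below the code; hence decoding is total and computable. -/
theorem exists_seq_decoding : ∃ get : M → M → M, Comp M (fun p : M × M => get p.1 p.2) ∧
    ∀ F : M → M, Comp M F → ∀ n, ∃ s, ∀ k, k < n → get s k = F k := by
  obtain ⟨f, hf, hf'⟩ := exists_comp_choice_of (α := M × M) (P := fun p u => Mem (pr p.2 u) p.1)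
    (Q := fun p => ∃ u, u < p.1 ∧ Mem (pr p.2 u) p.1) (by fun_prop) (by fun_prop)
    fun p ⟨u, _, hu⟩ => ⟨u, hu⟩
  refine ⟨fun s k => f (s, k), by fun_prop, fun F hF n => ?_⟩
  obtain ⟨b, hb⟩ := exists_bound hF n
  have hC : Comp M fun z => ∃ k, k < n ∧ z = pr k (F k) := by fun_prop
  refine ⟨mkFin (pr n b) fun z => ∃ k, k < n ∧ z = pr k (F k), fun k hk => ?_⟩
  have h1 : Mem (pr k (F k)) (mkFin (pr n b) fun z => ∃ k, k < n ∧ z = pr k (F k)) :=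
    (mem_mkFin hC).2 ⟨pr_lt_pr hk (hb k hk), k, hk, rfl⟩
  have h2 := (mem_mkFin hC).1 (hf' (_, k) ⟨F k, (right_le_pr _ _).trans_lt h1.lt, h1⟩)
  obtain ⟨-, k', -, h⟩ := h2
  obtain ⟨rfl, h⟩ := pr_inj.1 h
  exact h

/-- Σ⁰₁ induction yields a code for each finite computation, and the value at n is the last entry of
the least code for n. Codes chosen for n and n + 1 may differ, but their entries up to n agree by
induction, which gives the recursion equation. -/
theorem exists_primrec {f : α → M} {g : α → M → M → M} (hf : Comp M f)
    (hg : Comp M fun p : α × M × M => g p.1 p.2.1 p.2.2) :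
    ∃ h : α → M → M, Comp M (fun p : α × M => h p.1 p.2) ∧ (∀ x, h x 0 = f x) ∧
      ∀ x n, h x (n + 1) = g x n (h x n) := by
  obtain ⟨get, hget, hget'⟩ := exists_seq_decoding (M := M)
  have hg1 : Comp M fun p : ((α × M) × M) × M => g p.1.1.1 p.2 (get p.1.2 p.2) :=
    hg.comp (f := fun p : ((α × M) × M) × M => (p.1.1.1, p.2, get p.1.2 p.2)) (by fun_prop)
  have hR : Comp M fun p : (α × M) × M => get p.2 0 = f p.1.1 ∧
      ∀ k, k < p.1.2 → get p.2 (k + 1) = g p.1.1 k (get p.2 k) := by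
    fun_prop
  obtain ⟨s, hs, hs'⟩ := exists_comp_choice (α := α × M) (P := fun p s => get s 0 = f p.1 ∧
      ∀ k, k < p.2 → get s (k + 1) = g p.1 k (get s k)) hR fun p => by
    obtain ⟨x, n⟩ := p
    have hx : Comp M fun p : M × M => get p.2 0 = f x ∧
        ∀ k, k < p.1 → get p.2 (k + 1) = g x k (get p.2 k) :=
      hR.comp (f := fun p : M × M => ((x, p.1), p.2)) (by fun_prop)
    refine sigma_induction (P := fun n s : M => get s 0 = f x ∧
      ∀ k, k < n → get s (k + 1) = g x k (get s k)) hx ?_ (fun n ⟨s, hs0, hs⟩ => ?_) n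
    · obtain ⟨s, hs⟩ := hget' (fun _ => f x) (by fun_prop) 1
      exact ⟨s, hs 0 zero_lt_one, fun k hk => absurd hk (not_lt.2 zero_le)⟩
    · classical
      obtain ⟨t, ht⟩ := hget' (fun k => if k < n + 1 then get s k else g x n (get s n))
        (by fun_prop) (n + 1 + 1)
      refine ⟨t, ?_, fun k hk => ?_⟩
      · rw [ht 0 (zero_le.trans_lt (lt_succ_self _)), if_pos (zero_le.trans_lt (lt_succ_self _)), hs0]
      · rw [ht k (hk.trans (lt_succ_self _)), if_pos hk,
          ht (k + 1) (lt_succ_iff.2 (succ_le_iff.2 hk))]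
        rcases (lt_succ_iff.1 hk).lt_or_eq with h | rfl
        · rw [if_pos (lt_succ_iff.2 (succ_le_iff.2 h)), hs k h]
        · rw [if_neg (lt_irrefl _)]
  refine ⟨fun x n => get (s (x, n)) n, by fun_prop, fun x => (hs' (x, 0)).1, fun x n => ?_⟩
  have key : ∀ k, k < n + 1 → get (s (x, n + 1)) k = get (s (x, n)) k := by
    refine comp_induction (P := fun k => k < n + 1 → get (s (x, n + 1)) k = get (s (x, n)) k)
      (by fun_prop) (fun _ => ?_) (fun k ih hk => ?_)
    · rw [(hs' (x, n + 1)).1, (hs' (x, n)).1]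
    · rw [(hs' (x, n + 1)).2 k ((lt_succ_self k).trans hk),
        (hs' (x, n)).2 k (succ_le_iff.1 (lt_succ_iff.1 hk)), ih ((lt_succ_self k).trans hk)]
  simp only
  rw [(hs' (x, n + 1)).2 n (lt_succ_self n), key n (lt_succ_self n)]

end SOA

/-! ### Increasing maps between finite ordinals, and finite suborders. -/

namespace SOA

universe u

variable {M : Type u} [RCA M] {α β γ : Type*} [Enc M α] [Enc M β] [Enc M γ]

/-! ## Projections and predecessor -/

open Classical in
/-- The first component of a pair. -/
noncomputable def π₁ (z : M) : M := if h : ∃ a b, z = pr a b then h.choose else 0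

open Classical in
/-- The second component of a pair. -/
noncomputable def π₂ (z : M) : M := if h : ∃ a b, z = pr a b then h.choose_spec.choose else 0

@[simp] theorem π₁_pr (a b : M) : π₁ (pr a b) = a := by
  have h : ∃ a' b', pr a b = pr a' b' := ⟨a, b, rfl⟩
  rw [π₁, dif_pos h]
  exact (pr_inj.1 h.choose_spec.choose_spec).1.symm

@[simp] theorem π₂_pr (a b : M) : π₂ (pr a b) = b := by
  have h : ∃ a' b', pr a b = pr a' b' := ⟨a, b, rfl⟩
  rw [π₂, dif_pos h]
  exact (pr_inj.1 h.choose_spec.choose_spec).2.symm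

@[fun_prop] theorem Comp.π₁ {f : α → M} (hf : Comp M f) : Comp M (fun x => π₁ (f x)) := by
  refine Comp.comp (g := SOA.π₁) (Comp.of_graph (P := fun z a => (∃ b, b < z + 1 ∧ z = SOA.pr a b) ∨
    ((¬ ∃ a, a < z + 1 ∧ ∃ b, b < z + 1 ∧ z = SOA.pr a b) ∧ a = 0)) (by fun_prop) fun z a => ?_) hf
  by_cases h : ∃ a b, z = SOA.pr a b
  · obtain ⟨a', b, rfl⟩ := h
    rw [π₁_pr]
    constructor
    · rintro rfl
      exact .inl ⟨b, right_lt_succ_pr _ _, rfl⟩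
    · rintro (⟨b', -, h⟩ | ⟨h, -⟩)
      · exact (pr_inj.1 h).1
      · exact (h ⟨a', left_lt_succ_pr _ _, b, right_lt_succ_pr _ _, rfl⟩).elim
  · rw [SOA.π₁, dif_neg h]
    constructor
    · rintro rfl
      exact .inr ⟨fun ⟨a, _, b, _, h'⟩ => h ⟨a, b, h'⟩, rfl⟩
    · rintro (⟨b', -, h'⟩ | ⟨-, h⟩)
      exacts [(h ⟨_, _, h'⟩).elim, h.symm]

@[fun_prop] theorem Comp.π₂ {f : α → M} (hf : Comp M f) : Comp M (fun x => π₂ (f x)) := by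
  refine Comp.comp (g := SOA.π₂) (Comp.of_graph (P := fun z b => (∃ a, a < z + 1 ∧ z = SOA.pr a b) ∨
    ((¬ ∃ a, a < z + 1 ∧ ∃ b, b < z + 1 ∧ z = SOA.pr a b) ∧ b = 0)) (by fun_prop) fun z b => ?_) hf
  by_cases h : ∃ a b, z = SOA.pr a b
  · obtain ⟨a, b', rfl⟩ := h
    rw [π₂_pr]
    constructor
    · rintro rfl
      exact .inl ⟨a, left_lt_succ_pr _ _, rfl⟩
    · rintro (⟨a', -, h⟩ | ⟨h, -⟩)
      · exact (pr_inj.1 h).2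
      · exact (h ⟨a, left_lt_succ_pr _ _, b', right_lt_succ_pr _ _, rfl⟩).elim
  · rw [SOA.π₂, dif_neg h]
    constructor
    · rintro rfl
      exact .inr ⟨fun ⟨a, _, b, _, h'⟩ => h ⟨a, b, h'⟩, rfl⟩
    · rintro (⟨b', -, h'⟩ | ⟨-, h⟩)
      exacts [(h ⟨_, _, h'⟩).elim, h.symm]

theorem exists_pred : ∃ pd : M → M, Comp M pd ∧ ∀ i, pd (i + 1) = i := by
  obtain ⟨f, hf, hf'⟩ := exists_comp_choice_of (α := M) (P := fun i j : M => i = j + 1)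
    (Q := fun i => i ≠ 0) (by fun_prop) (by fun_prop) fun i hi => exists_eq_succ hi
  refine ⟨f, hf, fun i => ?_⟩
  have := hf' (i + 1) (zero_le.trans_lt (lt_succ_self i)).ne'
  exact (add_right_cancel this).symm

/-! ## Morphisms -/

/-- `f` maps `i` to `j`, for the code `f` of a morphism. -/
def Val (f i j : M) : Prop := ∃ m n g, f = pr m (pr n g) ∧ Mem (pr i j) g

/-- `f` is the code of a strictly increasing function from `{0, …, m - 1}` to `{0, …, n - 1}`. -/
def IsMor (f m n : M) : Prop :=
  ∃ g, f = pr m (pr n g) ∧ IsFin g ∧ (∀ p, Mem p g → ∃ i j, p = pr i j ∧ i < m ∧ j < n) ∧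
    (∀ i, i < m → ∃ j, Mem (pr i j) g) ∧
    (∀ i j j', Mem (pr i j) g ∧ Mem (pr i j') g → j = j') ∧
    ∀ i j i' j', Mem (pr i j) g ∧ Mem (pr i' j') g ∧ i < i' → j < j'

/-- `f` restricts to a strictly increasing function from `{0, …, m - 1}` to `{0, …, n - 1}`. -/
def Inc (m n : M) (f : M → M) : Prop :=
  (∀ i, i < m → f i < n) ∧ ∀ i j, i < j → j < m → f i < f j

/-- The code of a function as a morphism. -/
noncomputable def mkMor (m n : M) (f : M → M) : M :=
  pr m (pr n (mkFin (pr m n) fun z => ∃ i, i < m ∧ z = pr i (f i)))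

@[fun_prop] theorem Comp.mkMor {m n : α → M} {f : α → M → M} (hm : Comp M m) (hn : Comp M n)
    (hf : Comp M fun p : α × M => f p.1 p.2) :
    Comp M (fun x => mkMor (m x) (n x) fun i => f x i) := by
  unfold SOA.mkMor
  fun_prop

/-- Only values below `m` enter the code, so equality of morphisms is checked pointwise. -/
theorem mkMor_congr {m n : M} {f g : M → M} (h : ∀ i, i < m → f i = g i) :
    mkMor m n f = mkMor m n g := by
  have : (fun z => ∃ i, i < m ∧ z = pr i (f i)) = fun z => ∃ i, i < m ∧ z = pr i (g i) :=
    funext fun z => propext (exists_congr fun i => and_congr_right fun hi => by rw [h i hi])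
  rw [mkMor, mkMor, this]

section

variable {m n k : M} {f g : M → M}

theorem Inc.injOn (hf : Inc m n f) {i j : M} (hi : i < m) (hj : j < m) (h : f i = f j) : i = j := by
  rcases lt_trichotomy i j with h' | h' | h'
  exacts [absurd h (hf.2 i j h' hj).ne, h', absurd h (hf.2 j i h' hi).ne']

theorem Inc.lt_iff (hf : Inc m n f) {i j : M} (hi : i < m) (hj : j < m) : f i < f j ↔ i < j := by
  refine ⟨fun h => ?_, fun h => hf.2 i j h hj⟩
  rcases lt_trichotomy i j with h' | h' | h'
  exacts [h', absurd h (h' ▸ lt_irrefl _), absurd h (hf.2 j i h' hi).not_gt]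

theorem Inc.comp (hg : Inc n k g) (hf : Inc m n f) : Inc m k (fun i => g (f i)) :=
  ⟨fun i hi => hg.1 _ (hf.1 i hi), fun i j hij hj => hg.2 _ _ (hf.2 i j hij hj) (hf.1 j hj)⟩

theorem Inc.le_apply (hf : Inc m n f) (hfc : Comp M f) {i : M} (hi : i < m) : i ≤ f i := by
  refine comp_induction (P := fun i => i < m → i ≤ f i) (by fun_prop) (fun _ => zero_le)
    (fun i ih hi => ?_) i hi
  have h := (ih ((lt_succ_self i).trans hi)).trans_lt (hf.2 i (i + 1) (lt_succ_self i) hi)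
  exact succ_le_iff.2 h

theorem mem_mkMor (hfc : Comp M f) (hf : Inc m n f) {z : M} :
    Mem z (mkFin (pr m n) fun z => ∃ i, i < m ∧ z = pr i (f i)) ↔ ∃ i, i < m ∧ z = pr i (f i) := by
  rw [mem_mkFin (by fun_prop)]
  refine ⟨fun h => h.2, fun h => ⟨?_, h⟩⟩
  obtain ⟨i, hi, rfl⟩ := h
  exact pr_lt_pr hi (hf.1 i hi)

theorem mem_mkMor_pr (hfc : Comp M f) (hf : Inc m n f) {i j : M} :
    Mem (pr i j) (mkFin (pr m n) fun z => ∃ i, i < m ∧ z = pr i (f i)) ↔ i < m ∧ j = f i := by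
  rw [mem_mkMor hfc hf]
  constructor
  · rintro ⟨i', hi, h⟩
    obtain ⟨rfl, rfl⟩ := pr_inj.1 h
    exact ⟨hi, rfl⟩
  · rintro ⟨hi, rfl⟩
    exact ⟨i, hi, rfl⟩

theorem val_mkMor (hfc : Comp M f) (hf : Inc m n f) {i j : M} :
    Val (mkMor m n f) i j ↔ i < m ∧ j = f i := by
  rw [← mem_mkMor_pr hfc hf]
  constructor
  · rintro ⟨m', n', g, h, h'⟩
    obtain ⟨rfl, h2⟩ := pr_inj.1 h
    obtain ⟨rfl, rfl⟩ := pr_inj.1 h2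
    exact h'
  · exact fun h => ⟨m, n, _, rfl, h⟩

theorem isMor_mkMor (hfc : Comp M f) (hf : Inc m n f) : IsMor (mkMor m n f) m n := by
  refine ⟨_, rfl, isFin_mkFin (by fun_prop), fun p hp => ?_, fun i hi => ?_, fun i j j' h => ?_,
    fun i j i' j' h => ?_⟩
  · obtain ⟨i, hi, rfl⟩ := (mem_mkMor hfc hf).1 hp
    exact ⟨i, _, rfl, hi, hf.1 i hi⟩
  · exact ⟨f i, (mem_mkMor_pr hfc hf).2 ⟨hi, rfl⟩⟩
  · rw [mem_mkMor_pr hfc hf, mem_mkMor_pr hfc hf] at h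
    rw [h.1.2, h.2.2]
  · rw [mem_mkMor_pr hfc hf, mem_mkMor_pr hfc hf] at h
    rw [h.1.2, h.2.1.2]
    exact hf.2 _ _ h.2.2 h.2.1.1

/-- Uniqueness of codes of finite sets makes this an equality of codes. From here on, morphisms can
be handled as computable functions. -/
theorem exists_of_isMor {φ : M} (hφ : IsMor φ m n) :
    ∃ f, Comp M f ∧ Inc m n f ∧ φ = mkMor m n f := by
  obtain ⟨g, rfl, hg, h1, h2, h3, h4⟩ := hφ
  obtain ⟨f, hf, hf'⟩ := exists_comp_choice_of (α := M) (P := fun i j : M => Mem (pr i j) g)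
    (Q := fun i => i < m) (by fun_prop) (by fun_prop) h2
  have hI : Inc m n f := by
    refine ⟨fun i hi => ?_, fun i j hij hj => ?_⟩
    · obtain ⟨i', j', h, -, h'⟩ := h1 _ (hf' i hi)
      obtain ⟨rfl, rfl⟩ := pr_inj.1 h
      exact h'
    · exact h4 _ _ _ _ ⟨hf' i (hij.trans hj), hf' j hj, hij⟩
  refine ⟨f, hf, hI, ?_⟩
  rw [mkMor]
  congr 2
  refine hg.ext (isFin_mkFin (by fun_prop)) fun z => ?_
  rw [mem_mkMor hf hI]
  constructor
  · intro hz
    obtain ⟨i, j, rfl, hi, -⟩ := h1 _ hz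
    exact ⟨i, hi, by rw [h3 i j (f i) ⟨hz, hf' i hi⟩]⟩
  · rintro ⟨i, hi, rfl⟩
    exact hf' i hi

theorem inc_id (m : M) : Inc m m fun i => i := ⟨fun _ hi => hi, fun _ _ hij _ => hij⟩

end

@[fun_prop] theorem Comp.val {f i j : α → M} (hf : Comp M f) (hi : Comp M i) (hj : Comp M j) :
    Comp M (fun x => Val (f x) (i x) (j x)) := by
  refine Comp.of_iff (P := fun x => ∃ m, m < f x + 1 ∧ ∃ n, n < f x + 1 ∧ ∃ g, g < f x + 1 ∧
    f x = SOA.pr m (SOA.pr n g) ∧ Mem (SOA.pr (i x) (j x)) g) (by fun_prop) fun x => ?_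
  constructor
  · rintro ⟨m, n, g, h, h'⟩
    rw [h]
    exact ⟨m, left_lt_succ_pr _ _, n, lt_succ_iff.2 ((left_le_pr _ _).trans (right_le_pr _ _)),
      g, lt_succ_iff.2 ((right_le_pr _ _).trans (right_le_pr _ _)), rfl, h'⟩
  · rintro ⟨m, -, n, -, g, -, h⟩
    exact ⟨m, n, g, h⟩

theorem isMor_iff_bounded {f m n : M} : IsMor f m n ↔ ∃ g, g < f + 1 ∧ f = pr m (pr n g) ∧
    IsFin g ∧ (∀ p, p < g → Mem p g → ∃ i, i < m ∧ ∃ j, j < n ∧ p = pr i j) ∧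
    (∀ i, i < m → ∃ j, j < n ∧ Mem (pr i j) g) ∧
    (∀ i, i < m → ∀ j, j < n → ∀ j', j' < n → Mem (pr i j) g ∧ Mem (pr i j') g → j = j') ∧
    ∀ i, i < m → ∀ j, j < n → ∀ i', i' < m → ∀ j', j' < n →
      Mem (pr i j) g ∧ Mem (pr i' j') g ∧ i < i' → j < j' := by
  constructor
  · rintro ⟨g, rfl, hg, h1, h2, h3, h4⟩
    refine ⟨g, lt_succ_iff.2 ((right_le_pr _ _).trans (right_le_pr _ _)), rfl, hg, fun p _ hp => ?_,
      fun i hi => ?_, fun i _ j _ j' _ => h3 i j j', fun i _ j _ i' _ j' _ => h4 i j i' j'⟩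
    · obtain ⟨i, j, rfl, hi, hj⟩ := h1 p hp
      exact ⟨i, hi, j, hj, rfl⟩
    · obtain ⟨j, hj⟩ := h2 i hi
      obtain ⟨i', j', h, hi', hj'⟩ := h1 _ hj
      obtain ⟨rfl, rfl⟩ := pr_inj.1 h
      exact ⟨j, hj', hj⟩
  · rintro ⟨g, -, rfl, hg, h1, h2, h3, h4⟩
    have h1' : ∀ i j, Mem (pr i j) g → i < m ∧ j < n := fun i j h => by
      obtain ⟨i', hi', j', hj', h⟩ := h1 _ h.lt h
      obtain ⟨rfl, rfl⟩ := pr_inj.1 h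
      exact ⟨hi', hj'⟩
    refine ⟨g, rfl, hg, fun p hp => ?_, fun i hi => ?_,
      fun i j j' h => h3 i (h1' i j h.1).1 j (h1' i j h.1).2 j' (h1' i j' h.2).2 h,
      fun i j i' j' h => h4 i (h1' i j h.1).1 j (h1' i j h.1).2 i' (h1' i' j' h.2.1).1 j'
        (h1' i' j' h.2.1).2 h⟩
    · obtain ⟨i, hi, j, hj, h⟩ := h1 p hp.lt hp
      exact ⟨i, j, h, hi, hj⟩
    · obtain ⟨j, -, hj⟩ := h2 i hi
      exact ⟨j, hj⟩

@[fun_prop] theorem Comp.isMor {f m n : α → M} (hf : Comp M f) (hm : Comp M m) (hn : Comp M n) :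
    Comp M (fun x => IsMor (f x) (m x) (n x)) :=
  Comp.of_iff (by fun_prop) fun _ => isMor_iff_bounded

/-! ## Enumerations of finite orders -/

/-- `R` is a strict linear order on `X`. -/
structure IsLin (X : M → Prop) (R : M → M → Prop) : Prop where
  irrefl : ∀ x, ¬ R x x
  trans : ∀ x y z, R x y → R y z → R x z
  total : ∀ x y, X x → X y → R x y ∨ x = y ∨ R y x

/-- The finite set is a subset of `X`. -/
def SubsetOf (X : M → Prop) (a : M) : Prop := ∀ x, Mem x a → X x

theorem Comp.subsetOf {X : M → Prop} (hX : Comp M X) {f : α → M} (hf : Comp M f) :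
    Comp M (fun x => SubsetOf X (f x)) :=
  Comp.of_iff (P := fun x => ∀ y, y < f x → Mem y (f x) → X y) (by fun_prop) fun _ =>
    ⟨fun h y _ => h y, fun h y hy => h y hy.lt hy⟩

/-- `e` describes the order isomorphism between `{0, …, n - 1}` and the finite suborder `a`. -/
def IsEnum (R : M → M → Prop) (a n e : M) : Prop :=
  (∀ i x, Mem (pr i x) e → i < n ∧ Mem x a) ∧ (∀ i, i < n → ∃ x, Mem (pr i x) e) ∧
    (∀ x, Mem x a → ∃ i, Mem (pr i x) e) ∧
    (∀ i x y, Mem (pr i x) e ∧ Mem (pr i y) e → x = y) ∧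
    ∀ i x j y, Mem (pr i x) e ∧ Mem (pr j y) e ∧ i < j → R x y

/-- `f` is the code of the morphism that is induced by the inclusion of `a` into `u`. -/
def IsInclusion (R : M → M → Prop) (a u f : M) : Prop :=
  ∃ m n d e, IsEnum R a m d ∧ IsEnum R u n e ∧ IsMor f m n ∧
    ∀ i j x, Mem (pr i x) d ∧ Val f i j → Mem (pr j x) e

/-- For a finite subset `a` of the linear order `X`, the number `N a` is the cardinality of `a`,
`el a i` is the element in position `i`, and `ix a x` is the position of `x`. -/
structure Enumerates (X : M → Prop) (R : M → M → Prop) (N : M → M) (el ix : M → M → M) : Prop where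
  isLin : IsLin X R
  compN : Comp M N
  compEl : Comp M fun p : M × M => el p.1 p.2
  compIx : Comp M fun p : M × M => ix p.1 p.2
  el_mem : ∀ {a i}, SubsetOf X a → i < N a → Mem (el a i) a
  ix_lt : ∀ {a x}, SubsetOf X a → Mem x a → ix a x < N a
  el_ix : ∀ {a x}, SubsetOf X a → Mem x a → el a (ix a x) = x
  el_rel : ∀ {a i j}, SubsetOf X a → i < j → j < N a → R (el a i) (el a j)

/-- Insertion sort. Σ⁰₁ induction on k sorts the members of a below k, and least witnesses then make
the sorted lists depend computably on a. -/
theorem exists_enumerates {X : M → Prop} {R : M → M → Prop} (hX : Comp M X)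
    (hR : Comp M fun p : M × M => R p.1 p.2) (hL : IsLin X R) :
    ∃ N el ix, Enumerates X R N el ix := by
  obtain ⟨get, hget, hget'⟩ := exists_seq_decoding (M := M)
  obtain ⟨pd, hpd, hpd'⟩ := exists_pred (M := M)
  have hE : Comp M fun p : (M × M) × M × M =>
      (∀ i, i < p.2.1 → Mem (get p.2.2 i) p.1.1 ∧ get p.2.2 i < p.1.2) ∧
      (∀ x, x < p.1.2 → Mem x p.1.1 → ∃ i, i < p.2.1 ∧ get p.2.2 i = x) ∧
      (∀ j, j < p.2.1 → ∀ i, i < j → R (get p.2.2 i) (get p.2.2 j)) := by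
    fun_prop
  have hQ : Comp M fun a => SubsetOf X a := hX.subsetOf (by fun_prop)
  have key : ∀ a, SubsetOf X a → ∀ k : M, ∃ z : M,
      (∀ i, i < π₁ z → Mem (get (π₂ z) i) a ∧ get (π₂ z) i < k) ∧
      (∀ x, x < k → Mem x a → ∃ i, i < π₁ z ∧ get (π₂ z) i = x) ∧
      (∀ j, j < π₁ z → ∀ i, i < j → R (get (π₂ z) i) (get (π₂ z) j)) := by
    intro a ha
    refine sigma_induction (P := fun k z : M =>
      (∀ i, i < π₁ z → Mem (get (π₂ z) i) a ∧ get (π₂ z) i < k) ∧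
      (∀ x, x < k → Mem x a → ∃ i, i < π₁ z ∧ get (π₂ z) i = x) ∧
      (∀ j, j < π₁ z → ∀ i, i < j → R (get (π₂ z) i) (get (π₂ z) j))) (by fun_prop)
      ⟨pr 0 0, ?_⟩ (fun k ⟨z, h1, h2, h3⟩ => ?_)
    · simp
    · by_cases hk : Mem k a
      -- The new element k is inserted at the first position whose entry is above k, or at the end
      -- of the list if there is none.
      · obtain ⟨p, hp, hp'⟩ := exists_least (P := fun p => p = π₁ z ∨ R k (get (π₂ z) p))
          (by fun_prop) ⟨_, .inl rfl⟩
        have hpn : p ≤ π₁ z := not_lt.1 fun h => hp' _ h (.inl rfl)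
        have hlt : ∀ i, i < p → R (get (π₂ z) i) k := fun i hi => by
          obtain ⟨h4, h5⟩ := h1 i (hi.trans_le hpn)
          rcases hL.total _ _ (ha _ h4) (ha _ hk) with h | h | h
          exacts [h, absurd h h5.ne, (hp' i hi (.inr h)).elim]
        have hgt : ∀ i, p ≤ i → i < π₁ z → R k (get (π₂ z) i) := fun i hi hi' => by
          have h4 := hp.resolve_left (hi.trans_lt hi').ne
          rcases hi.lt_or_eq with h | rfl
          exacts [hL.trans _ _ _ h4 (h3 i hi' p h), h4]
        classical
        obtain ⟨s, hs⟩ := hget' (fun i => if i < p then get (π₂ z) i else if i = p then k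
          else get (π₂ z) (pd i)) (by fun_prop) (π₁ z + 1)
        have hs1 : ∀ i, i < p → get s i = get (π₂ z) i := fun i hi => by
          rw [hs i (hi.trans_le (hpn.trans (lt_succ_self _).le)), if_pos hi]
        have hs2 : get s p = k := by
          rw [hs p (lt_succ_iff.2 hpn), if_neg (lt_irrefl _), if_pos rfl]
        have hs3 : ∀ i, p ≤ i → i < π₁ z → get s (i + 1) = get (π₂ z) i := fun i hi hi' => by
          have h : p < i + 1 := lt_succ_iff.2 hi
          rw [hs (i + 1) (lt_succ_iff.2 (succ_le_iff.2 hi')), if_neg h.not_gt, if_neg h.ne', hpd']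
        have hcase : ∀ i, i < π₁ z + 1 → i < p ∨ i = p ∨ ∃ j, i = j + 1 ∧ p ≤ j ∧ j < π₁ z := by
          intro i hi
          rcases lt_trichotomy i p with h | h | h
          · exact .inl h
          · exact .inr (.inl h)
          · obtain ⟨j, rfl⟩ := exists_eq_succ (zero_le.trans_lt h).ne'
            exact .inr (.inr ⟨j, rfl, lt_succ_iff.1 h, succ_le_iff.1 (lt_succ_iff.1 hi)⟩)
        refine ⟨pr (π₁ z + 1) s, ?_⟩
        simp only [π₁_pr, π₂_pr]
        refine ⟨fun i hi => ?_, fun x hx hx' => ?_, fun j hj i hij => ?_⟩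
        · rcases hcase i hi with h | rfl | ⟨i, rfl, h, h'⟩
          · rw [hs1 i h]
            obtain ⟨h4, h5⟩ := h1 i (h.trans_le hpn)
            exact ⟨h4, h5.trans (lt_succ_self k)⟩
          · rw [hs2]; exact ⟨hk, lt_succ_self k⟩
          · rw [hs3 i h h']
            exact ⟨(h1 i h').1, (h1 i h').2.trans (lt_succ_self k)⟩
        · rcases (lt_succ_iff.1 hx).lt_or_eq with h | rfl
          · obtain ⟨i, hi, rfl⟩ := h2 x h hx'
            rcases lt_or_ge i p with h | h
            · exact ⟨i, hi.trans (lt_succ_self _), hs1 i h⟩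
            · exact ⟨i + 1, lt_succ_iff.2 (succ_le_iff.2 hi), hs3 i h hi⟩
          · exact ⟨p, lt_succ_iff.2 hpn, hs2⟩
        · rcases hcase j hj with h | rfl | ⟨j, rfl, h, h'⟩
          · rw [hs1 j h, hs1 i (hij.trans h)]
            exact h3 j (h.trans_le hpn) i hij
          · rw [hs2, hs1 i hij]
            exact hlt i hij
          · rw [hs3 j h h']
            rcases hcase i (hij.trans hj) with h5 | rfl | ⟨i, rfl, h5, h6⟩
            · rw [hs1 i h5]
              exact h3 j h' i (h5.trans_le h)
            · rw [hs2]
              exact hgt j h h'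
            · rw [hs3 i h5 h6]
              exact h3 j h' i (lt_of_add_lt_add_right hij)
      · refine ⟨z, fun i hi => ⟨(h1 i hi).1, (h1 i hi).2.trans (lt_succ_self k)⟩,
          fun x hx hx' => ?_, h3⟩
        rcases (lt_succ_iff.1 hx).lt_or_eq with h | rfl
        exacts [h2 x h hx', (hk hx').elim]
  obtain ⟨z, hz, hz'⟩ := exists_comp_choice_of (α := M) (P := fun a z : M =>
      (∀ i, i < π₁ z → Mem (get (π₂ z) i) a ∧ get (π₂ z) i < a) ∧
      (∀ x, x < a → Mem x a → ∃ i, i < π₁ z ∧ get (π₂ z) i = x) ∧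
      (∀ j, j < π₁ z → ∀ i, i < j → R (get (π₂ z) i) (get (π₂ z) j))) (by fun_prop)
      hQ fun a ha => key a ha a
  obtain ⟨ix, hix, hix'⟩ := exists_comp_choice_of (α := M × M)
    (P := fun p i => i < π₁ (z p.1) ∧ get (π₂ (z p.1)) i = p.2)
    (Q := fun p => SubsetOf X p.1 ∧ Mem p.2 p.1) (by fun_prop) (by fun_prop)
    fun ⟨a, x⟩ ⟨ha, hx⟩ => (hz' a ha).2.1 x hx.lt hx
  exact ⟨fun a => π₁ (z a), fun a i => get (π₂ (z a)) i, fun a x => ix (a, x), hL, by fun_prop,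
    by fun_prop, by fun_prop, fun {a i} ha hi => ((hz' a ha).1 i hi).1,
    fun {a x} ha hx => (hix' (a, x) ⟨ha, hx⟩).1,
    fun {a x} ha hx => (hix' (a, x) ⟨ha, hx⟩).2,
    fun {a i j} ha hij hj => (hz' a ha).2.2 j hj i hij⟩

namespace Enumerates

variable {X : M → Prop} {R : M → M → Prop} {N : M → M} {el ix : M → M → M}
  {a u : M}

theorem comp_el (H : Enumerates X R N el ix) {f g : α → M} (hf : Comp M f) (hg : Comp M g) :
    Comp M fun x => el (f x) (g x) := H.compEl.comp (hf.prodMk hg)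

theorem comp_ix (H : Enumerates X R N el ix) {f g : α → M} (hf : Comp M f) (hg : Comp M g) :
    Comp M fun x => ix (f x) (g x) := H.compIx.comp (hf.prodMk hg)

theorem el_inj (H : Enumerates X R N el ix) (ha : SubsetOf X a) {i j : M} (hi : i < N a)
    (hj : j < N a) (h : el a i = el a j) : i = j := by
  rcases lt_trichotomy i j with h' | h' | h'
  · exact (H.isLin.irrefl _ (h ▸ H.el_rel ha h' hj)).elim
  · exact h'
  · exact (H.isLin.irrefl _ (h ▸ H.el_rel ha h' hi)).elim

theorem ix_el (H : Enumerates X R N el ix) (ha : SubsetOf X a) {i : M} (hi : i < N a) :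
    ix a (el a i) = i :=
  H.el_inj ha (H.ix_lt ha (H.el_mem ha hi)) hi (H.el_ix ha (H.el_mem ha hi))

theorem ix_lt_ix (H : Enumerates X R N el ix) (ha : SubsetOf X a) {x y : M} (hx : Mem x a)
    (hy : Mem y a) (h : R x y) : ix a x < ix a y := by
  rcases lt_trichotomy (ix a x) (ix a y) with h' | h' | h'
  · exact h'
  · have := H.el_ix ha hx
    rw [h', H.el_ix ha hy] at this
    exact (H.isLin.irrefl _ (this ▸ h)).elim
  · have := H.el_rel ha h' (H.ix_lt ha hx)
    rw [H.el_ix ha hx, H.el_ix ha hy] at this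
    exact (H.isLin.irrefl _ (H.isLin.trans _ _ _ h this)).elim

theorem rel_of_ix_lt (H : Enumerates X R N el ix) (ha : SubsetOf X a) {x y : M} (hx : Mem x a)
    (hy : Mem y a) (h : ix a x < ix a y) : R x y := by
  have := H.el_rel ha h (H.ix_lt ha hy)
  rwa [H.el_ix ha hx, H.el_ix ha hy] at this

theorem inc_incl (H : Enumerates X R N el ix) (hu : SubsetOf X u) (hau : ∀ x, Mem x a → Mem x u) :
    Inc (N a) (N u) fun i => ix u (el a i) := by
  have ha : SubsetOf X a := fun x hx => hu x (hau x hx)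
  refine ⟨fun i hi => H.ix_lt hu (hau _ (H.el_mem ha hi)), fun i j hij hj => ?_⟩
  exact H.ix_lt_ix hu (hau _ (H.el_mem ha (hij.trans hj))) (hau _ (H.el_mem ha hj))
    (H.el_rel ha hij hj)

theorem comp_incl (H : Enumerates X R N el ix) : Comp M fun i => ix u (el a i) :=
  H.comp_ix (by fun_prop) (H.comp_el (by fun_prop) (by fun_prop))

theorem exists_isEnum (H : Enumerates X R N el ix) (ha : SubsetOf X a) :
    ∃ e, IsEnum R a (N a) e ∧ ∀ i x, Mem (pr i x) e ↔ i < N a ∧ x = el a i := by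
  have hc : Comp M fun i => el a i := H.comp_el (by fun_prop) (by fun_prop)
  have key : ∀ i x, Mem (pr i x) (mkFin (pr (N a) a) fun z => ∃ i, i < N a ∧ z = pr i (el a i)) ↔
      i < N a ∧ x = el a i := by
    intro i x
    rw [mem_mkFin (by fun_prop)]
    constructor
    · rintro ⟨-, j, hj, h⟩
      obtain ⟨rfl, rfl⟩ := pr_inj.1 h
      exact ⟨hj, rfl⟩
    · rintro ⟨hi, rfl⟩
      exact ⟨pr_lt_pr hi (H.el_mem ha hi).lt, i, hi, rfl⟩
  refine ⟨_, ⟨fun i x h => ?_, fun i hi => ⟨_, (key _ _).2 ⟨hi, rfl⟩⟩, fun x hx =>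
    ⟨ix a x, (key _ _).2 ⟨H.ix_lt ha hx, (H.el_ix ha hx).symm⟩⟩, fun i x y h => ?_,
    fun i x j y h => ?_⟩, key⟩
  · obtain ⟨hi, rfl⟩ := (key _ _).1 h
    exact ⟨hi, H.el_mem ha hi⟩
  · rw [((key _ _).1 h.1).2, ((key _ _).1 h.2).2]
  · rw [((key _ _).1 h.1).2, ((key _ _).1 h.2.1).2]
    exact H.el_rel ha h.2.2 ((key _ _).1 h.2.1).1

/-- Finite linear orders are rigid: comparing two enumerations gives strictly increasing maps both
ways, and neither lowers its argument. Hence the lengths and the entries coincide. -/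
theorem eq_of_isEnum (H : Enumerates X R N el ix) (ha : SubsetOf X a) {n e : M}
    (he : IsEnum R a n e) : n = N a ∧ ∀ i x, Mem (pr i x) e ↔ i < N a ∧ x = el a i := by
  obtain ⟨h1, h2, h3, h4, h5⟩ := he
  obtain ⟨f, hf, hf'⟩ := exists_comp_choice_of (α := M) (P := fun i x : M => Mem (pr i x) e)
    (Q := fun i => i < n) (by fun_prop) (by fun_prop) h2
  obtain ⟨g, hg, hg'⟩ := exists_comp_choice_of (α := M) (P := fun x i : M => Mem (pr i x) e)
    (Q := fun x => Mem x a) (by fun_prop) (by fun_prop) h3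
  have hfg : ∀ x, Mem x a → f (g x) = x := fun x hx =>
    h4 _ _ _ ⟨hf' _ (h1 _ _ (hg' x hx)).1, hg' x hx⟩
  have hI : Inc n (N a) fun i => ix a (f i) := by
    refine ⟨fun i hi => H.ix_lt ha (h1 _ _ (hf' i hi)).2, fun i j hij hj => ?_⟩
    exact H.ix_lt_ix ha (h1 _ _ (hf' i (hij.trans hj))).2 (h1 _ _ (hf' j hj)).2
      (h5 _ _ _ _ ⟨hf' i (hij.trans hj), hf' j hj, hij⟩)
  have hJ : Inc (N a) n fun i => g (el a i) := by
    refine ⟨fun i hi => (h1 _ _ (hg' _ (H.el_mem ha hi))).1, fun i j hij hj => ?_⟩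
    have hi' := hg' _ (H.el_mem ha (hij.trans hj))
    have hj' := hg' _ (H.el_mem ha hj)
    have hr := H.el_rel ha hij hj
    rcases lt_trichotomy (g (el a i)) (g (el a j)) with h | h | h
    · exact h
    · have h6 : el a i = el a j := h4 _ _ _ ⟨hi', h ▸ hj'⟩
      exact (H.isLin.irrefl _ (h6 ▸ hr)).elim
    · exact (H.isLin.irrefl _ (H.isLin.trans _ _ _ hr (h5 _ _ _ _ ⟨hj', hi', h⟩))).elim
  have hIc : Comp M fun i => ix a (f i) := H.comp_ix (by fun_prop) (by fun_prop)
  have hJc : Comp M fun i => g (el a i) := hg.comp (H.comp_el (by fun_prop) (by fun_prop))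
  have hn : n = N a := by
    rcases lt_trichotomy n (N a) with h | h | h
    · exact absurd (hJ.1 n h) (not_lt.2 (hJ.le_apply hJc h))
    · exact h
    · exact absurd (hI.1 _ h) (not_lt.2 (hI.le_apply hIc h))
  have hel : ∀ i, i < N a → f i = el a i := fun i hi => by
    have h6 := hJ.le_apply hJc hi
    have h7 := hI.le_apply hIc (hJ.1 i hi)
    simp only [hfg _ (H.el_mem ha hi), H.ix_el ha hi] at h7
    rw [le_antisymm h6 h7, hfg _ (H.el_mem ha hi), ← le_antisymm h6 h7]
  refine ⟨hn, fun i x => ⟨fun h => ?_, ?_⟩⟩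
  · have hi := (h1 _ _ h).1
    exact ⟨hn ▸ hi, by rw [← hel i (hn ▸ hi)]; exact h4 _ _ _ ⟨h, hf' i hi⟩⟩
  · rintro ⟨hi, rfl⟩
    rw [← hel i hi]
    exact hf' i (hn ▸ hi)

theorem isInclusion_iff (H : Enumerates X R N el ix) (hu : SubsetOf X u)
    (hau : ∀ x, Mem x a → Mem x u) {φ : M} :
    IsInclusion R a u φ ↔ φ = mkMor (N a) (N u) fun i => ix u (el a i) := by
  have ha : SubsetOf X a := fun x hx => hu x (hau x hx)
  constructor
  · rintro ⟨m, n, d, e, hd, he, hφ, h⟩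
    obtain ⟨rfl, hd'⟩ := H.eq_of_isEnum ha hd
    obtain ⟨rfl, he'⟩ := H.eq_of_isEnum hu he
    obtain ⟨f, hf, hI, rfl⟩ := exists_of_isMor hφ
    refine mkMor_congr fun i hi => ?_
    have := (he' _ _).1 (h i (f i) (el a i) ⟨(hd' _ _).2 ⟨hi, rfl⟩, (val_mkMor hf hI).2 ⟨hi, rfl⟩⟩)
    rw [this.2, H.ix_el hu this.1]
  · rintro rfl
    obtain ⟨d, hd, hd'⟩ := H.exists_isEnum ha
    obtain ⟨e, he, he'⟩ := H.exists_isEnum hu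
    refine ⟨_, _, d, e, hd, he, isMor_mkMor H.comp_incl (H.inc_incl hu hau), fun i j x h => ?_⟩
    rw [hd', val_mkMor H.comp_incl (H.inc_incl hu hau)] at h
    obtain ⟨⟨hi, rfl⟩, -, rfl⟩ := h
    rw [he']
    exact ⟨(H.inc_incl hu hau).1 i hi, (H.el_ix hu (hau _ (H.el_mem ha hi))).symm⟩

end Enumerates

end SOA

/-! ### Dilators as computable functors, and their supports. -/

namespace SOA

universe u

variable {M : Type u} [RCA M] {α β γ : Type*} [Enc M α] [Enc M β] [Enc M γ]

/-! ## Dilators -/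

/-- A pullback preserving functor `D` from natural numbers to linear orders with initial segments as
values: `App φ σ τ` expresses `D(φ)(σ) = τ`, and `A φ σ` is the value `D(φ)(σ)`. -/
structure IsDilator (D : M → M → Prop) (App : M → M → M → Prop) (A : M → M → M) : Prop where
  compD : Comp M fun p : M × M => D p.1 p.2
  compA : Comp M fun p : M × M => A p.1 p.2
  mem_of_lt : ∀ {n σ τ}, D n σ → τ < σ → D n τ
  zero_mem : ∀ n, D n 0
  app_iff : ∀ {φ m n σ τ}, IsMor φ m n → (App φ σ τ ↔ D m σ ∧ A φ σ = τ)
  mem : ∀ {m n f σ}, Comp M f → Inc m n f → D m σ → D n (A (mkMor m n f) σ)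
  lt : ∀ {m n f σ τ}, Comp M f → Inc m n f → D m τ → σ < τ →
    A (mkMor m n f) σ < A (mkMor m n f) τ
  id : ∀ {n σ}, D n σ → A (mkMor n n fun i => i) σ = σ
  comp : ∀ {l m n f g σ}, Comp M f → Comp M g → Inc l m f → Inc m n g → D l σ →
    A (mkMor l n fun i => g (f i)) σ = A (mkMor m n g) (A (mkMor l m f) σ)
  zero : ∀ {m n f}, Comp M f → Inc m n f → A (mkMor m n f) 0 = 0
  pullback : ∀ {l m m' n q e e' σ σ'}, Comp M q → Comp M e → Comp M e' → Inc l n q → Inc m n e →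
    Inc m' n e' → (∀ i, i < l → ∃ j, j < m ∧ e j = q i) → (∀ i, i < l → ∃ j, j < m' ∧ e' j = q i) →
    (∀ j, j < m → ∀ j', j' < m' → e j = e' j' → ∃ i, i < l ∧ q i = e j) → D m σ → D m' σ' →
    A (mkMor m n e) σ = A (mkMor m' n e') σ' → ∃ ρ, D l ρ ∧ A (mkMor l n q) ρ = A (mkMor m n e) σ

namespace IsDilator

variable {D : M → M → Prop} {App : M → M → M → Prop} {A : M → M → M}

theorem comp_D (H : IsDilator D App A) {f g : α → M} (hf : Comp M f) (hg : Comp M g) :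
    Comp M fun x => D (f x) (g x) := H.compD.comp (hf.prodMk hg)

theorem comp_A (H : IsDilator D App A) {f g : α → M} (hf : Comp M f) (hg : Comp M g) :
    Comp M fun x => A (f x) (g x) := H.compA.comp (hf.prodMk hg)

variable {m n l : M} {f g : M → M} {σ τ : M}

theorem inj (H : IsDilator D App A) (hfc : Comp M f) (hf : Inc m n f) (hσ : D m σ) (hτ : D m τ)
    (h : A (mkMor m n f) σ = A (mkMor m n f) τ) : σ = τ := by
  rcases lt_trichotomy σ τ with h' | h' | h'
  exacts [absurd h (H.lt hfc hf hτ h').ne, h', absurd h (H.lt hfc hf hσ h').ne']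

theorem lt_iff (H : IsDilator D App A) (hfc : Comp M f) (hf : Inc m n f) (hσ : D m σ)
    (hτ : D m τ) : A (mkMor m n f) σ < A (mkMor m n f) τ ↔ σ < τ := by
  refine ⟨fun h => ?_, H.lt hfc hf hτ⟩
  rcases lt_trichotomy σ τ with h' | h' | h'
  exacts [h', absurd h (h' ▸ lt_irrefl _), absurd h (H.lt hfc hf hσ h').not_gt]

theorem le_iff (H : IsDilator D App A) (hfc : Comp M f) (hf : Inc m n f) (hσ : D m σ)
    (hτ : D m τ) : A (mkMor m n f) σ ≤ A (mkMor m n f) τ ↔ σ ≤ τ := by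
  rw [← not_lt, ← not_lt, H.lt_iff hfc hf hτ hσ]

/-- A strictly increasing function on an initial segment of the numbers never lowers its argument.
This is where it matters that the values of D are such segments. -/
theorem le_apply (H : IsDilator D App A) (hfc : Comp M f) (hf : Inc m n f) (hσ : D m σ) :
    σ ≤ A (mkMor m n f) σ := by
  have h1 : Comp M fun σ => D m σ := H.comp_D (by fun_prop) (by fun_prop)
  have h2 : Comp M fun σ => A (mkMor m n f) σ := H.comp_A (by fun_prop) (by fun_prop)
  refine comp_induction (P := fun σ => D m σ → σ ≤ A (mkMor m n f) σ) (by fun_prop)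
    (fun _ => zero_le) (fun σ ih hσ => ?_) σ hσ
  have := lt_succ_self σ
  exact succ_le_iff.2 ((ih (H.mem_of_lt hσ this)).trans_lt (H.lt hfc hf hσ this))

/-- `σ` lies in the range of `D(f)`. -/
def Rng (D : M → M → Prop) (A : M → M → M) (m n : M) (f : M → M) (σ : M) : Prop :=
  ∃ ρ, D m ρ ∧ A (mkMor m n f) ρ = σ

/-- A preimage of σ is at most σ, so membership in the range is decidable and not merely Σ⁰₁. -/
theorem rng_iff_lt (H : IsDilator D App A) (hfc : Comp M f) (hf : Inc m n f) :
    Rng D A m n f σ ↔ ∃ ρ, ρ < σ + 1 ∧ D m ρ ∧ A (mkMor m n f) ρ = σ := by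
  constructor
  · rintro ⟨ρ, hρ, rfl⟩
    exact ⟨ρ, lt_succ_iff.2 (H.le_apply hfc hf hρ), hρ, rfl⟩
  · rintro ⟨ρ, -, h⟩
    exact ⟨ρ, h⟩

/-- The hypothesis on ranges lets f factor through g, and functoriality does the rest. -/
theorem Rng.mono (H : IsDilator D App A) (hfc : Comp M f) (hf : Inc m n f) (hgc : Comp M g)
    (hg : Inc l n g) (hfg : ∀ i, i < m → ∃ j, j < l ∧ g j = f i) (h : Rng D A m n f σ) :
    Rng D A l n g σ := by
  obtain ⟨k, hh, hh'⟩ := exists_comp_choice_of (α := M) (P := fun i j : M => j < l ∧ g j = f i)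
    (Q := fun i => i < m) (by fun_prop) (by fun_prop) hfg
  have hI : Inc m l k := by
    refine ⟨fun i hi => (hh' i hi).1, fun i j hij hj => ?_⟩
    rw [← hg.lt_iff (hh' i (hij.trans hj)).1 (hh' j hj).1, (hh' i (hij.trans hj)).2, (hh' j hj).2]
    exact hf.2 i j hij hj
  obtain ⟨ρ, hρ, rfl⟩ := h
  refine ⟨A (mkMor m l k) ρ, H.mem hh hI hρ, ?_⟩
  rw [← H.comp hh hgc hI hg hρ]
  exact congrArg₂ _ (mkMor_congr fun i hi => (hh' i hi).2) rfl

/-- Preservation of pullbacks in the form in which it is used: e enumerates the intersection of the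
ranges of f and g. -/
theorem Rng.inter (H : IsDilator D App A) {k : M} {e : M → M} (hfc : Comp M f) (hf : Inc m n f)
    (hgc : Comp M g) (hg : Inc l n g) (hec : Comp M e) (he : Inc k n e)
    (h1 : ∀ i, i < k → ∃ j, j < m ∧ f j = e i) (h2 : ∀ i, i < k → ∃ j, j < l ∧ g j = e i)
    (h3 : ∀ j, j < m → ∀ j', j' < l → f j = g j' → ∃ i, i < k ∧ e i = f j)
    (h : Rng D A m n f σ) (h' : Rng D A l n g σ) : Rng D A k n e σ := by
  obtain ⟨ρ, hρ, h⟩ := h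
  obtain ⟨ρ', hρ', h'⟩ := h'
  obtain ⟨ρ'', h4, h5⟩ := H.pullback hec hfc hgc he hf hg h1 h2 h3 hρ hρ' (h.trans h'.symm)
  exact ⟨ρ'', h4, h5.trans h⟩

end IsDilator

/-! ## Supports -/

/-- `S` is a support transformation for the functor. -/
def IsSupport (D : M → M → Prop) (App S : M → M → M → Prop) : Prop :=
  (∀ n σ, D n σ → (∃ s, S n σ s ∧ IsFin s ∧ ∀ i, Mem i s → i < n) ∧
    ∀ s s', S n σ s ∧ S n σ s' → s = s') ∧
  (∀ f m n, IsMor f m n → ∀ σ τ s t, App f σ τ ∧ S m σ s ∧ S n τ t →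
    ∀ j, Mem j t ↔ ∃ i, Mem i s ∧ Val f i j) ∧
  ∀ f m n, IsMor f m n → ∀ σ s, D n σ ∧ S n σ s ∧ (∀ j, Mem j s → ∃ i, Val f i j) → ∃ ρ, App f ρ σ

theorem isLin_lt : IsLin (fun _ : M => True) fun x y => x < y :=
  ⟨lt_irrefl, fun _ _ _ => lt_trans, fun x y _ _ => lt_trichotomy x y⟩

/-- The support of σ ∈ D(n) consists of those j < n without which σ cannot be obtained, i.e. such
that σ does not come from D applied to the inclusion of n ∖ {j}. Decidability of ranges makes this
set available by finite comprehension. -/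
theorem exists_isSupport {D : M → M → Prop} {App : M → M → M → Prop} {A : M → M → M}
    (H : IsDilator D App A) : ∃ S : M → M → M → Prop, Comp M (fun p : M × M × M => S p.1 p.2.1 p.2.2) ∧
      IsSupport D App S := by
  obtain ⟨N, el, ix, HE⟩ := exists_enumerates (M := M) (by fun_prop) (by fun_prop) isLin_lt
  have hN := HE.compN
  have hel := HE.compEl
  have hD := H.compD
  have hA := H.compA
  have hsub : ∀ a, SubsetOf (fun _ : M => True) a := fun a x _ => trivial
  have hinc : ∀ {a n}, (∀ x, Mem x a → x < n) → Inc (N a) n (el a) := fun {a n} h =>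
    ⟨fun i hi => h _ (HE.el_mem (hsub a) hi), fun i j hij hj => HE.el_rel (hsub a) hij hj⟩
  have helc : ∀ a, Comp M (el a) := fun a => HE.comp_el (by fun_prop) (by fun_prop)
  have hmem : ∀ {a x}, Mem x a ↔ ∃ i, i < N a ∧ el a i = x := fun {a x} =>
    ⟨fun h => ⟨_, HE.ix_lt (hsub a) h, HE.el_ix (hsub a) h⟩, by
      rintro ⟨i, hi, rfl⟩
      exact HE.el_mem (hsub a) hi⟩
  have hrngc : Comp M fun p : M × M × M => ∃ ρ, ρ < p.2.2 + 1 ∧ D (N p.1) ρ ∧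
      A (mkMor (N p.1) p.2.1 (el p.1)) ρ = p.2.2 := by
    fun_prop
  set rmv : M → M → M := fun n j => mkFin n fun x => x ≠ j with hrmv
  have hmrmv : ∀ {n j x}, Mem x (rmv n j) ↔ x < n ∧ x ≠ j := fun {n j x} =>
    mem_mkFin (by fun_prop)
  have hrmvI : ∀ n j, Inc (N (rmv n j)) n (el (rmv n j)) := fun n j =>
    hinc fun x hx => (hmrmv.1 hx).1
  set R : M → M → M → Prop := fun n j σ => IsDilator.Rng D A (N (rmv n j)) n (el (rmv n j)) σ with hR
  have hRc : Comp M fun p : M × M × M => R p.1 p.2.1 p.2.2 := by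
    refine Comp.of_iff (hrngc.comp (f := fun p : M × M × M => (rmv p.1 p.2.1, p.1, p.2.2))
      (by fun_prop)) fun p => ?_
    exact H.rng_iff_lt (helc _) (hrmvI _ _)
  -- If j is not a value of f, then f factors through n ∖ {j}.
  have need : ∀ {m n f σ}, Comp M f → Inc m n f → ∀ {j}, j < n → ¬ R n j σ →
      IsDilator.Rng D A m n f σ → ∃ i, i < m ∧ f i = j := by
    intro m n f σ hfc hf j hj hR h
    by_contra hc
    refine hR (IsDilator.Rng.mono H hfc hf (helc _) (hrmvI _ _) (fun i hi => hmem.1 ?_) h)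
    exact hmrmv.2 ⟨hf.1 i hi, fun h => hc ⟨i, hi, h⟩⟩
  -- Remove the points outside the range of f one at a time: the set `a k` contains the range of f
  -- and all x ≥ k, so it shrinks from n to the range of f. As a removed point is inessential, each
  -- step intersects with n ∖ {k}.
  have suff : ∀ {m n f σ}, Comp M f → Inc m n f → D n σ →
      (∀ j, j < n → ¬ R n j σ → ∃ i, i < m ∧ f i = j) → IsDilator.Rng D A m n f σ := by
    intro m n f σ hfc hf hσ hj
    set a : M → M := fun k => mkFin n fun x => k ≤ x ∨ ∃ i, i < m ∧ f i = x with ha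
    have hac : Comp M a := by fun_prop
    have hma : ∀ {k x}, Mem x (a k) ↔ x < n ∧ (k ≤ x ∨ ∃ i, i < m ∧ f i = x) := fun {k x} =>
      mem_mkFin (by fun_prop)
    have haI : ∀ k, Inc (N (a k)) n (el (a k)) := fun k => hinc fun x hx => (hma.1 hx).1
    have key : ∀ k, k ≤ n → IsDilator.Rng D A (N (a k)) n (el (a k)) σ := by
      refine comp_induction (P := fun k => k ≤ n → IsDilator.Rng D A (N (a k)) n (el (a k)) σ)
        (Comp.imp (by fun_prop) (Comp.of_iff (hrngc.comp (f := fun k => (a k, n, σ))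
          (by fun_prop)) fun k => H.rng_iff_lt (helc _) (haI k))) (fun _ => ?_) (fun k ih hk => ?_)
      · refine IsDilator.Rng.mono H (by fun_prop) (inc_id n) (helc _) (haI 0)
          (fun i hi => hmem.1 (hma.2 ⟨hi, .inl zero_le⟩)) ⟨σ, hσ, H.id hσ⟩
      · have hkn := succ_le_iff.1 hk
        have ih := ih hkn.le
        by_cases hkf : ∃ i, i < m ∧ f i = k
        · refine IsDilator.Rng.mono H (helc _) (haI k) (helc _) (haI (k + 1)) (fun i hi => ?_) ih
          obtain ⟨h1, h2⟩ := hma.1 (HE.el_mem (hsub (a k)) hi)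
          refine hmem.1 (hma.2 ⟨h1, ?_⟩)
          rcases h2 with h2 | h2
          · rcases h2.lt_or_eq with h3 | h3
            · exact .inl (succ_le_iff.2 h3)
            · exact .inr (h3 ▸ hkf)
          · exact .inr h2
        · have hRk : R n k σ := by
            by_contra hc
            exact hkf (hj k hkn hc)
          refine IsDilator.Rng.inter H (helc _) (haI k) (helc _) (hrmvI n k) (helc _)
            (haI (k + 1)) (fun i hi => ?_) (fun i hi => ?_) (fun j hj j' hj' hjj' => ?_) ih hRk
          · obtain ⟨h1, h2⟩ := hma.1 (HE.el_mem (hsub (a (k + 1))) hi)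
            exact hmem.1 (hma.2 ⟨h1, h2.imp (fun h => (lt_succ_self k).le.trans h) fun h => h⟩)
          · obtain ⟨h1, h2⟩ := hma.1 (HE.el_mem (hsub (a (k + 1))) hi)
            refine hmem.1 (hmrmv.2 ⟨h1, ?_⟩)
            rintro h
            rcases h2 with h2 | h2
            · exact absurd (succ_le_iff.1 h2) (not_lt.2 h.le)
            · exact hkf (h ▸ h2)
          · obtain ⟨h1, h2⟩ := hma.1 (HE.el_mem (hsub (a k)) hj)
            have h3 := (hmrmv.1 (HE.el_mem (hsub _) hj')).2
            rw [← hjj'] at h3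
            refine hmem.1 (hma.2 ⟨h1, h2.imp (fun h => succ_le_iff.2 (lt_of_le_of_ne h h3.symm))
              fun h => h⟩)
    refine IsDilator.Rng.mono H (helc _) (haI n) hfc hf (fun i hi => ?_) (key n le_rfl)
    obtain ⟨h1, h2⟩ := hma.1 (HE.el_mem (hsub (a n)) hi)
    exact h2.resolve_left (not_le.2 h1)
  have hSc : ∀ n σ, Comp M fun j => ¬ R n j σ := fun n σ =>
    Comp.not (hRc.comp (f := fun j => (n, j, σ)) (by fun_prop))
  refine ⟨fun n σ s => s = mkFin n fun j => ¬ R n j σ, ?_, ?_, ?_, ?_⟩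
  · have : Comp M fun p : (M × M × M) × M => R p.1.1 p.2 p.1.2.1 :=
      hRc.comp (f := fun p : (M × M × M) × M => (p.1.1, p.2, p.1.2.1)) (by fun_prop)
    fun_prop
  · refine fun n σ hσ => ⟨⟨_, rfl, isFin_mkFin (hSc n σ), fun i hi =>
      ((mem_mkFin (hSc n σ)).1 hi).1⟩, ?_⟩
    rintro s s' ⟨rfl, rfl⟩
    rfl
  · rintro φ m n hφ σ τ s t ⟨happ, rfl, rfl⟩ j
    obtain ⟨hσ, rfl⟩ := (H.app_iff hφ).1 happ
    obtain ⟨f, hfc, hf, rfl⟩ := exists_of_isMor hφ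
    have hfR : ∀ i, Comp M fun k => f (el (rmv m i) k) := fun i => hfc.comp (helc _)
    have hfI : ∀ i, Inc (N (rmv m i)) n fun k => f (el (rmv m i) k) := fun i => hf.comp (hrmvI m i)
    simp only [mem_mkFin (hSc _ _), val_mkMor hfc hf]
    constructor
    · rintro ⟨hj, hRj⟩
      obtain ⟨i, hi, rfl⟩ := need hfc hf hj hRj ⟨σ, hσ, rfl⟩
      refine ⟨i, ⟨hi, fun hRi => ?_⟩, hi, rfl⟩
      obtain ⟨ρ, hρ, rfl⟩ := hRi
      obtain ⟨k, hk, hk'⟩ := need (hfR i) (hfI i) hj hRj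
        ⟨ρ, hρ, H.comp (helc _) hfc (hrmvI m i) hf hρ⟩
      have h1 := hmrmv.1 (HE.el_mem (hsub (rmv m i)) hk)
      exact h1.2 (hf.injOn h1.1 hi hk')
    · rintro ⟨i, ⟨hi, hRi⟩, -, rfl⟩
      refine ⟨hf.1 i hi, fun hRj => hRi ?_⟩
      -- Removing i from m yields the intersection of the range of f with n ∖ {f(i)}. Hence an
      -- element that avoids f(i) comes from one that avoids i.
      have hr : IsDilator.Rng D A (N (rmv m i)) n (fun k => f (el (rmv m i) k))
          (A (mkMor m n f) σ) := by
        refine IsDilator.Rng.inter H hfc hf (helc _) (hrmvI n (f i)) (hfR i) (hfI i)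
          (fun k hk => ⟨_, (hrmvI m i).1 k hk, rfl⟩) (fun k hk => ?_) (fun j hj j' hj' hjj' => ?_)
          ⟨σ, hσ, rfl⟩ hRj
        · have h1 := hmrmv.1 (HE.el_mem (hsub (rmv m i)) hk)
          exact hmem.1 (hmrmv.2 ⟨hf.1 _ h1.1, fun h => h1.2 (hf.injOn h1.1 hi h)⟩)
        · have h1 := hmrmv.1 (HE.el_mem (hsub _) hj')
          obtain ⟨k, hk, hk'⟩ := hmem.1 (hmrmv.2 ⟨hj, fun h => h1.2 (by rw [← hjj', h])⟩)
          exact ⟨k, hk, by rw [hk']⟩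
      obtain ⟨ρ, hρ, hρ'⟩ := hr
      rw [H.comp (helc _) hfc (hrmvI m i) hf hρ] at hρ'
      exact ⟨ρ, hρ, H.inj hfc hf (H.mem (helc _) (hrmvI m i) hρ) hσ hρ'⟩
  · rintro φ m n hφ σ s ⟨hσ, rfl, h⟩
    obtain ⟨f, hfc, hf, rfl⟩ := exists_of_isMor hφ
    obtain ⟨ρ, hρ, hρ'⟩ := suff hfc hf hσ fun j hj hRj => by
      obtain ⟨i, hi⟩ := h j ((mem_mkFin (hSc _ _)).2 ⟨hj, hRj⟩)
      obtain ⟨hi', rfl⟩ := (val_mkMor hfc hf).1 hi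
      exact ⟨i, hi', rfl⟩
    exact ⟨ρ, (H.app_iff hφ).2 ⟨hρ, hρ'⟩⟩

end SOA

/-! ### Termination of Goodstein sequences implies preservation of well foundedness. -/

namespace SOA

universe u

variable {M : Type u} [RCA M] {α β γ : Type*} [Enc M α] [Enc M β] [Enc M γ]

/-! ## Goodstein systems and extensions of dilators -/

/-- `c_{ij}(x) = y` for the system of morphisms with codes `c i`. -/
def IterVal (c : M → M) (i j x y : M) : Prop :=
  ∃ s, IsFin s ∧ (∀ k u u', Mem (pr k u) s ∧ Mem (pr k u') s → u = u') ∧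
    Mem (pr i x) s ∧ Mem (pr j y) s ∧
    ∀ k, i ≤ k ∧ k < j → ∃ u u', Mem (pr k u) s ∧ Mem (pr (k + 1) u') s ∧ Val (c k) u u'

/-- Goodstein systems, given by computable functions. -/
structure IsGoodsteinSystem (b c : M → M) : Prop where
  compB : Comp M b
  compC : Comp M c
  mono : ∀ i j, i ≤ j → b i ≤ b j
  pos : 0 < b 0
  isMor : ∀ i, IsMor (c i) (b i) (b (i + 1))
  exists_le : ∀ d : M → M, ∀ Y : M → Prop, Comp M d → Comp M Y → (∀ i, d i < b i) →
    (∀ k, ∃ y, k < y ∧ Y y) →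
    ∃ i j, Y i ∧ Y j ∧ i < j ∧ ∃ z, IterVal c i j (d i) z ∧ z ≤ d j

/-- Goodstein sequences. -/
def IsGoodsteinSequence (App : M → M → M → Prop) (c : M → M) (m : M) (g : M → M) : Prop :=
  g 0 = m ∧ ∀ i, (g i = 0 → g (i + 1) = 0) ∧ (g i ≠ 0 → App (c i) (g i) (g (i + 1) + 1))

/-- The extended Goodstein theorem. -/
def GoodsteinTerminates (D : M → M → Prop) (App : M → M → M → Prop) : Prop :=
  ∀ b c : M → M, IsGoodsteinSystem b c → ∀ m, D (b 0) m →
    ∃ g, Comp M g ∧ IsGoodsteinSequence App c m g ∧ ∃ i, g i = 0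

/-- `p` is an element of the extension of the dilator to the order `X`. -/
def InExt (D : M → M → Prop) (S : M → M → M → Prop) (X : M → Prop) (R : M → M → Prop) (p : M) :
    Prop :=
  ∃ a σ, p = pr a σ ∧ IsFin a ∧ SubsetOf X a ∧
    ∃ n e s, IsEnum R a n e ∧ D n σ ∧ S n σ s ∧ ∀ i, Mem i s ↔ i < n

/-- The order on the extension of the dilator. -/
def LtExt (App : M → M → M → Prop) (R : M → M → Prop) (p q : M) : Prop :=
  ∃ a σ b τ, p = pr a σ ∧ q = pr b τ ∧
    ∃ u f g, IsFin u ∧ (∀ x, Mem x u ↔ Mem x a ∨ Mem x b) ∧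
      IsInclusion R a u f ∧ IsInclusion R b u g ∧
      ∃ σ' τ', App f σ σ' ∧ App g τ τ' ∧ σ' < τ'

/-- There is no infinite descending sequence. -/
def WellFoundedOn (X : M → Prop) (R : M → M → Prop) : Prop :=
  ¬ ∃ f : M → M, Comp M f ∧ (∀ i, X (f i)) ∧ ∀ i, R (f (i + 1)) (f i)

/-- The extension of the dilator preserves well foundedness. -/
def ExtPreserves (D : M → M → Prop) (App : M → M → M → Prop) (S : M → M → M → Prop) : Prop :=
  ∀ (X : M → Prop) (R : M → M → Prop), Comp M X → (Comp M fun p : M × M => R p.1 p.2) →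
    (∀ x y, R x y → X x ∧ X y) → IsLin X R → WellFoundedOn X R →
    WellFoundedOn (InExt D S X R) (LtExt App R)

theorem comp_induction_from {P : M → Prop} (hP : Comp M P) {i : M} (h0 : P i)
    (hs : ∀ n, i ≤ n → P n → P (n + 1)) {n : M} (hn : i ≤ n) : P n := by
  refine comp_induction (P := fun n => i ≤ n → P n) (by fun_prop) (fun h => ?_) (fun n ih h => ?_)
    n hn
  · have : i = 0 := le_antisymm h zero_le
    exact this ▸ h0
  · rcases h.lt_or_eq with h | rfl
    exacts [hs n (lt_succ_iff.1 h) (ih (lt_succ_iff.1 h)), h0]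

/-- The sum g(i) + i never exceeds g(0), which fails at i = g(0) + 1. -/
theorem not_descending {g : M → M} (hg : Comp M g) (h : ∀ i, g (i + 1) < g i) : False := by
  have key : ∀ i, g i + i ≤ g 0 := by
    refine comp_induction (by fun_prop) (by simp) fun i ih => le_trans ?_ ih
    have := add_le_add_left (succ_le_iff.2 (h i)) i
    rwa [add_right_comm, add_assoc] at this
  exact absurd (le_add_self.trans (key (g 0 + 1))) (not_le.2 (lt_succ_self _))

theorem lt_of_lt_succ {f : M → M} (hf : Comp M f) {R : M → M → Prop}
    (hR : Comp M fun p : M × M => R p.1 p.2) (htr : ∀ x y z, R x y → R y z → R x z)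
    (h : ∀ i, R (f (i + 1)) (f i)) {i j : M} (hij : i < j) : R (f j) (f i) := by
  refine comp_induction_from (P := fun j => R (f j) (f i)) (hR.comp (f := fun j => (f j, f i))
    (by fun_prop)) (h i) (fun n _ ih => htr _ _ _ (h n) ih) (succ_le_iff.2 hij)

theorem Inc.le {m n : M} {f : M → M} (hf : Inc m n f) (hfc : Comp M f) : m ≤ n :=
  not_lt.1 fun h => absurd (hf.1 n h) (not_lt.2 (hf.le_apply hfc h))

section Inclusion

variable {D : M → M → Prop} {App : M → M → M → Prop} {A : M → M → M} {X : M → Prop}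
  {R : M → M → Prop} {N : M → M} {el ix : M → M → M} {a b u w σ τ : M}

theorem incl_incl (H : IsDilator D App A) (HE : Enumerates X R N el ix) (hw : SubsetOf X w)
    (hau : ∀ x, Mem x a → Mem x u) (huw : ∀ x, Mem x u → Mem x w) (hσ : D (N a) σ) :
    A (mkMor (N u) (N w) fun i => ix w (el u i)) (A (mkMor (N a) (N u) fun i => ix u (el a i)) σ) =
      A (mkMor (N a) (N w) fun i => ix w (el a i)) σ := by
  have hu : SubsetOf X u := fun x hx => hw x (huw x hx)
  have ha : SubsetOf X a := fun x hx => hu x (hau x hx)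
  rw [← H.comp HE.comp_incl HE.comp_incl (HE.inc_incl hu hau) (HE.inc_incl hw huw) hσ]
  refine congrArg₂ _ (mkMor_congr fun i hi => ?_) rfl
  rw [HE.el_ix hu (hau _ (HE.el_mem ha hi))]

theorem ltExt_iff (H : IsDilator D App A) (HE : Enumerates X R N el ix) (ha : SubsetOf X a)
    (hb : SubsetOf X b) : LtExt App R (pr a σ) (pr b τ) ↔ ∃ u, IsFin u ∧
      (∀ x, Mem x u ↔ Mem x a ∨ Mem x b) ∧ D (N a) σ ∧ D (N b) τ ∧
      A (mkMor (N a) (N u) fun i => ix u (el a i)) σ <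
        A (mkMor (N b) (N u) fun i => ix u (el b i)) τ := by
  have key : ∀ u, (∀ x, Mem x u ↔ Mem x a ∨ Mem x b) → SubsetOf X u := fun u hu x hx =>
    ((hu x).1 hx).elim (ha x) (hb x)
  have hM : ∀ {a u}, SubsetOf X u → (∀ x, Mem x a → Mem x u) →
      IsMor (mkMor (N a) (N u) fun i => ix u (el a i)) (N a) (N u) := fun hu hau =>
    isMor_mkMor HE.comp_incl (HE.inc_incl hu hau)
  constructor
  · rintro ⟨a', σ', b', τ', h1, h2, u, f, g, hu, hu', hf, hg, σ'', τ'', hσ, hτ, hlt⟩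
    obtain ⟨rfl, rfl⟩ := pr_inj.1 h1
    obtain ⟨rfl, rfl⟩ := pr_inj.1 h2
    have hXu := key u hu'
    have hau : ∀ x, Mem x a → Mem x u := fun x hx => (hu' x).2 (.inl hx)
    have hbu : ∀ x, Mem x b → Mem x u := fun x hx => (hu' x).2 (.inr hx)
    rw [HE.isInclusion_iff hXu hau] at hf
    rw [HE.isInclusion_iff hXu hbu] at hg
    subst hf hg
    rw [H.app_iff (hM hXu hau)] at hσ
    rw [H.app_iff (hM hXu hbu)] at hτ
    exact ⟨u, hu, hu', hσ.1, hτ.1, by rwa [hσ.2, hτ.2]⟩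
  · rintro ⟨u, hu, hu', hσ, hτ, h⟩
    have hXu := key u hu'
    have hau : ∀ x, Mem x a → Mem x u := fun x hx => (hu' x).2 (.inl hx)
    have hbu : ∀ x, Mem x b → Mem x u := fun x hx => (hu' x).2 (.inr hx)
    exact ⟨a, σ, b, τ, rfl, rfl, u, _, _, hu, hu', (HE.isInclusion_iff hXu hau).2 rfl,
      (HE.isInclusion_iff hXu hbu).2 rfl, _, _, (H.app_iff (hM hXu hau)).2 ⟨hσ, rfl⟩,
      (H.app_iff (hM hXu hbu)).2 ⟨hτ, rfl⟩, h⟩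

theorem InExt.spec {S : M → M → M → Prop} (HE : Enumerates X R N el ix) {p : M}
    (hp : InExt D S X R p) : p = pr (π₁ p) (π₂ p) ∧ SubsetOf X (π₁ p) ∧ D (N (π₁ p)) (π₂ p) := by
  obtain ⟨a, σ, rfl, -, ha, n, e, s, he, hσ, -⟩ := hp
  rw [π₁_pr, π₂_pr]
  exact ⟨rfl, ha, (HE.eq_of_isEnum ha he).1 ▸ hσ⟩

end Inclusion

/-! ## From Goodstein sequences to extensions -/

/-- The finite sequence that witnesses the iterated value records the positions of the fixed point x
in the intermediate sets. -/
theorem exists_iterVal_of_incl {X : M → Prop} {R : M → M → Prop} {N : M → M} {el ix : M → M → M}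
    (HE : Enumerates X R N el ix) {U : M → M} (hU : Comp M U) (hUX : ∀ i, SubsetOf X (U i))
    (hUU : ∀ i j, i ≤ j → ∀ x, Mem x (U i) → Mem x (U j)) {i j x : M} (hij : i ≤ j)
    (hx : Mem x (U i)) :
    IterVal (fun i => mkMor (N (U i)) (N (U (i + 1))) fun k => ix (U (i + 1)) (el (U i) k)) i j
      (ix (U i) x) (ix (U j) x) := by
  have hix := HE.compIx
  have hcix : Comp M fun k => ix (U k) x := HE.comp_ix (by fun_prop) (by fun_prop)
  obtain ⟨B, hB⟩ := exists_bound hcix (j + 1)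
  have hmem : ∀ z, Mem z (mkFin (pr (j + 1) B) fun z => ∃ k, k < j + 1 ∧ i ≤ k ∧
      z = pr k (ix (U k) x)) ↔ ∃ k, k < j + 1 ∧ i ≤ k ∧ z = pr k (ix (U k) x) := by
    intro z
    rw [mem_mkFin (by fun_prop)]
    refine ⟨fun h => h.2, fun h => ⟨?_, h⟩⟩
    obtain ⟨k, hk, -, rfl⟩ := h
    exact pr_lt_pr hk (hB k hk)
  refine ⟨_, isFin_mkFin (by fun_prop), fun k u u' h => ?_, (hmem _).2 ⟨i, lt_succ_iff.2 hij,
    le_rfl, rfl⟩, (hmem _).2 ⟨j, lt_succ_self j, hij, rfl⟩, fun k ⟨hik, hkj⟩ => ?_⟩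
  · rw [hmem, hmem] at h
    obtain ⟨⟨k1, -, -, h1⟩, k2, -, -, h2⟩ := h
    obtain ⟨rfl, rfl⟩ := pr_inj.1 h1
    obtain ⟨rfl, rfl⟩ := pr_inj.1 h2
    rfl
  · have hxk := hUU i k hik x hx
    refine ⟨_, _, (hmem _).2 ⟨k, hkj.trans (lt_succ_self j), hik, rfl⟩,
      (hmem _).2 ⟨k + 1, lt_succ_iff.2 (succ_le_iff.2 hkj), hik.trans (lt_succ_self k).le, rfl⟩, ?_⟩
    rw [val_mkMor HE.comp_incl (HE.inc_incl (hUX _) (hUU k _ (lt_succ_self k).le))]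
    exact ⟨HE.ix_lt (hUX k) hxk, by rw [HE.el_ix (hUX k) hxk]⟩

/-- If d and Y violated the last condition, the points in position d(y) of U(y) would descend as y
increases through Y. The point `x₀` is there to make the first cardinality positive. -/
theorem isGoodsteinSystem_of_incl {X : M → Prop} {R : M → M → Prop} {N : M → M} {el ix : M → M → M}
    (HE : Enumerates X R N el ix) (hwf : WellFoundedOn X R) {U : M → M} (hU : Comp M U)
    (hUX : ∀ i, SubsetOf X (U i))
    (hUU : ∀ i j, i ≤ j → ∀ x, Mem x (U i) → Mem x (U j)) {x₀ : M} (hx₀ : Mem x₀ (U 0)) :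
    IsGoodsteinSystem (fun i => N (U i))
      (fun i => mkMor (N (U i)) (N (U (i + 1))) fun k => ix (U (i + 1)) (el (U i) k)) := by
  have hix := HE.compIx
  have hel := HE.compEl
  have hN := HE.compN
  refine ⟨by fun_prop, by fun_prop, fun i j hij => (HE.inc_incl (hUX j) (hUU i j hij)).le
    HE.comp_incl, zero_le.trans_lt (HE.ix_lt (hUX 0) hx₀), fun i =>
    isMor_mkMor HE.comp_incl (HE.inc_incl (hUX _) (hUU i _ (lt_succ_self i).le)),
    fun d Y hd hY hdb hYinf => ?_⟩
  by_contra hc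
  push Not at hc
  obtain ⟨nx, hnx, hnx'⟩ := exists_comp_choice (P := fun k y : M => k < y ∧ Y y) (by fun_prop) hYinf
  -- A strictly increasing sequence of elements of Y; its elements will index the descending
  -- sequence in X.
  obtain ⟨ys, hys, hys0, hyss⟩ := exists_primrec (α := M) (f := fun _ => nx 0)
    (g := fun _ _ y => nx y) (by fun_prop) (by fun_prop)
  have hysY : ∀ k, Y (ys 0 k) := by
    intro k
    by_cases hk : k = 0
    · rw [hk, hys0]; exact (hnx' 0).2
    · obtain ⟨k, rfl⟩ := exists_eq_succ hk
      rw [hyss]; exact (hnx' _).2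
  have hmem : ∀ y, Mem (el (U y) (d y)) (U y) := fun y => HE.el_mem (hUX y) (hdb y)
  refine hwf ⟨fun k => el (U (ys 0 k)) (d (ys 0 k)), by fun_prop, fun k => hUX _ _ (hmem _),
    fun k => ?_⟩
  have hlt : ys 0 k < ys 0 (k + 1) := by rw [hyss]; exact (hnx' _).1
  have h1 := exists_iterVal_of_incl HE hU hUX hUU hlt.le (hmem (ys 0 k))
  rw [HE.ix_el (hUX _) (hdb _)] at h1
  have h2 := hc _ _ (hysY k) (hysY (k + 1)) hlt _ h1
  refine HE.rel_of_ix_lt (hUX _) (hmem _) (hUU _ _ hlt.le _ (hmem _)) ?_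
  rwa [HE.ix_el (hUX _) (hdb _)]

/-- The finite sets that occur in a descending sequence are accumulated into a Goodstein system,
whose Goodstein sequence dominates the given one. Only the order on the extension matters, so `S`
can be arbitrary. -/
theorem extPreserves_of_goodsteinTerminates {D : M → M → Prop} {App : M → M → M → Prop}
    {A : M → M → M} (H : IsDilator D App A) (S : M → M → M → Prop)
    (hG : GoodsteinTerminates D App) : ExtPreserves D App S := by
  rintro X R hX hR - hL hwf ⟨p, hp, hpX, hpR⟩
  obtain ⟨N, el, ix, HE⟩ := exists_enumerates hX hR hL
  have hix := HE.compIx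
  have hel := HE.compEl
  have hN := HE.compN
  have hA := H.compA
  have hp1 := fun i => (hpX i).spec HE
  have hlt : ∀ i, ∃ u, (∀ x, Mem x u ↔ Mem x (π₁ (p (i + 1))) ∨ Mem x (π₁ (p i))) ∧
      A (mkMor (N (π₁ (p (i + 1)))) (N u) fun k => ix u (el (π₁ (p (i + 1))) k)) (π₂ (p (i + 1))) <
      A (mkMor (N (π₁ (p i))) (N u) fun k => ix u (el (π₁ (p i)) k)) (π₂ (p i)) := by
    intro i
    have h := hpR i
    rw [(hp1 i).1, (hp1 (i + 1)).1, ltExt_iff H HE (hp1 _).2.1 (hp1 _).2.1] at h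
    obtain ⟨u, -, hu, -, -, h⟩ := h
    exact ⟨u, hu, h⟩
  by_cases hx : ∃ x, X x
  · obtain ⟨x₀, hx₀⟩ := hx
    -- A running sum of codes: members of a finite set lie below its code, so B bounds everything
    -- collected up to position i.
    obtain ⟨B, hB, hB0, hBs⟩ := exists_primrec (α := M) (f := fun _ => x₀ + 1 + π₁ (p 0))
      (g := fun _ n y => y + π₁ (p (n + 1))) (by fun_prop) (by fun_prop)
    have hBx : ∀ i, x₀ < B 0 i := by
      refine comp_induction (by fun_prop) ?_ fun i ih => ?_
      · rw [hB0]; exact lt_of_lt_of_le (lt_succ_self x₀) le_self_add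
      · rw [hBs]; exact lt_of_lt_of_le ih le_self_add
    have hBa : ∀ k i, k ≤ i → π₁ (p k) ≤ B 0 i := by
      intro k i hk
      refine comp_induction_from (P := fun i => π₁ (p k) ≤ B 0 i) (by fun_prop) ?_
        (fun i _ ih => ?_) hk
      · by_cases h : k = 0
        · rw [h, hB0]; exact le_add_self
        · obtain ⟨k, rfl⟩ := exists_eq_succ h
          rw [hBs]; exact le_add_self
      · rw [hBs]; exact ih.trans le_self_add
    set U : M → M := fun i => mkFin (B 0 i) fun x => x = x₀ ∨ ∃ k, k < i + 1 ∧ Mem x (π₁ (p k))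
      with hUdef
    have hU : Comp M U := by fun_prop
    have hUm : ∀ i x, Mem x (U i) ↔ x = x₀ ∨ ∃ k, k < i + 1 ∧ Mem x (π₁ (p k)) := by
      intro i x
      rw [hUdef]
      simp only
      rw [mem_mkFin (by fun_prop)]
      refine ⟨fun h => h.2, fun h => ⟨?_, h⟩⟩
      rcases h with rfl | ⟨k, hk, hx⟩
      exacts [hBx i, hx.lt.trans_le (hBa k i (lt_succ_iff.1 hk))]
    have hUX : ∀ i, SubsetOf X (U i) := by
      intro i x hx
      rcases (hUm i x).1 hx with rfl | ⟨k, -, hk⟩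
      exacts [hx₀, (hp1 k).2.1 x hk]
    have hUU : ∀ i j, i ≤ j → ∀ x, Mem x (U i) → Mem x (U j) := by
      intro i j hij x hx
      rw [hUm] at hx ⊢
      exact hx.imp_right fun ⟨k, hk, h⟩ => ⟨k, lt_succ_iff.2 ((lt_succ_iff.1 hk).trans hij), h⟩
    have haU : ∀ i j, i ≤ j → ∀ x, Mem x (π₁ (p i)) → Mem x (U j) := fun i j hij x hx =>
      (hUm j x).2 (.inr ⟨i, lt_succ_iff.2 hij, hx⟩)
    have hsys := isGoodsteinSystem_of_incl HE hwf hU hUX hUU ((hUm 0 x₀).2 (.inl rfl))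
    set τ : M → M := fun i => A (mkMor (N (π₁ (p i))) (N (U i)) fun k => ix (U i) (el (π₁ (p i)) k))
      (π₂ (p i)) with hτ
    have hτc : Comp M τ := by fun_prop
    have hτD : ∀ i, D (N (U i)) (τ i) := fun i =>
      H.mem HE.comp_incl (HE.inc_incl (hUX i) (haU i i le_rfl)) (hp1 i).2.2
    have hcI : ∀ i, Inc (N (U i)) (N (U (i + 1))) fun k => ix (U (i + 1)) (el (U i) k) := fun i =>
      HE.inc_incl (hUX _) (hUU i _ (lt_succ_self i).le)
    -- The inequality given in the union of two consecutive sets is carried over to U(i + 1) by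
    -- functoriality.
    have hττ : ∀ i, τ (i + 1) < A (mkMor (N (U i)) (N (U (i + 1)))
        fun k => ix (U (i + 1)) (el (U i) k)) (τ i) := by
      intro i
      obtain ⟨u, hu, h⟩ := hlt i
      have huU : ∀ x, Mem x u → Mem x (U (i + 1)) := fun x hx =>
        ((hu x).1 hx).elim (haU _ _ le_rfl x) (haU i _ (lt_succ_self i).le x)
      have hXu : SubsetOf X u := fun x hx => hUX _ x (huU x hx)
      have hau : ∀ x, Mem x (π₁ (p (i + 1))) → Mem x u := fun x hx => (hu x).2 (.inl hx)
      have hbu : ∀ x, Mem x (π₁ (p i)) → Mem x u := fun x hx => (hu x).2 (.inr hx)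
      have h3 := H.lt HE.comp_incl (HE.inc_incl (hUX (i + 1)) huU)
        (H.mem HE.comp_incl (HE.inc_incl hXu hbu) (hp1 i).2.2) h
      rw [incl_incl H HE (hUX _) hau huU (hp1 _).2.2, incl_incl H HE (hUX _) hbu huU (hp1 _).2.2]
        at h3
      rw [hτ]
      simp only
      rwa [incl_incl H HE (hUX _) (haU i i le_rfl) (hUU i _ (lt_succ_self i).le) (hp1 _).2.2]
    have hτ0 : ∀ i, τ i ≠ 0 := by
      intro i h
      have := hττ i
      rw [h, H.zero HE.comp_incl (hcI i)] at this
      exact absurd this (not_lt.2 zero_le)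
    obtain ⟨g, hg, ⟨hg0, hgs⟩, i, hi⟩ := hG _ _ hsys (τ 0) (hτD 0)
    -- While τ strictly decreases under the transition maps, g drops by exactly 1, so domination is
    -- preserved.
    have key : ∀ i, τ i ≤ g i := by
      refine comp_induction (by fun_prop) (by rw [hg0]) fun i ih => ?_
      have h1 : g i ≠ 0 := fun h => hτ0 i (le_antisymm (h ▸ ih) zero_le)
      have h2 := (hgs i).2 h1
      rw [H.app_iff (isMor_mkMor HE.comp_incl (hcI i))] at h2
      have h3 := (H.le_iff HE.comp_incl (hcI i) (hτD i) h2.1).2 ih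
      rw [h2.2] at h3
      exact lt_succ_iff.1 ((hττ i).trans_le h3)
    exact hτ0 i (le_antisymm (hi ▸ key i) zero_le)
  -- The empty order must be treated apart, because a Goodstein system has b(0) > 0. All finite
  -- suborders are empty here, and the order on the extension is the usual order of D(0).
  · push Not at hx
    have hN0 : ∀ a, SubsetOf X a → N a = 0 := by
      intro a ha
      by_contra h
      exact hx _ (ha _ (HE.el_mem ha (pos_of_ne_zero' h)))
    refine not_descending (g := fun i => π₂ (p i)) (by fun_prop) fun i => ?_
    obtain ⟨u, hu, h⟩ := hlt i
    have hXu : SubsetOf X u := fun x hx => ((hu x).1 hx).elim ((hp1 _).2.1 x) ((hp1 _).2.1 x)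
    have hempty : ∀ i, A (mkMor (N (π₁ (p i))) (N u) fun k => ix u (el (π₁ (p i)) k)) (π₂ (p i)) =
        π₂ (p i) := by
      intro i
      have hD := (hp1 i).2.2
      rw [hN0 _ (hp1 i).2.1] at hD
      rw [hN0 _ (hp1 i).2.1, hN0 _ hXu]
      refine Eq.trans ?_ (H.id hD)
      exact congrArg₂ _ (mkMor_congr fun i hi => absurd hi (not_lt.2 zero_le)) rfl
    rwa [hempty, hempty] at h

end SOA

/-! ### Preservation of well foundedness implies termination, via the direct limit of a Goodstein
system. -/

namespace SOA

universe u

variable {M : Type u} [RCA M] {α β γ : Type*} [Enc M α] [Enc M β] [Enc M γ]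

/-! ## The limit of a Goodstein system -/

/-- `cf i` is the `i`-th function of a system `b`, and `r i x j` is the image of `x` under the
functions from position `i` to position `j`. -/
structure IsIteration (b : M → M) (cf : M → M → M) (r : M → M → M → M) : Prop where
  compB : Comp M b
  compR : Comp M fun p : M × M × M => r p.1 p.2.1 p.2.2
  inc : ∀ i, Inc (b i) (b (i + 1)) (cf i)
  of_le : ∀ {i x j}, j ≤ i → r i x j = x
  succ : ∀ {i x j}, i ≤ j → r i x (j + 1) = cf j (r i x j)

theorem exists_isIteration {b c : M → M} (hbc : IsGoodsteinSystem b c) :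
    ∃ cf r, (Comp M fun p : M × M => cf p.1 p.2) ∧ IsIteration b cf r ∧
      ∀ i, c i = mkMor (b i) (b (i + 1)) (cf i) := by
  have hb := hbc.compB
  have hc := hbc.compC
  obtain ⟨f, hf, hf'⟩ := exists_comp_choice_of (α := M × M) (P := fun p y => Val (c p.1) p.2 y)
    (Q := fun p => p.2 < b p.1) (by fun_prop) (by fun_prop) fun ⟨i, x⟩ hx => by
      obtain ⟨f, hf, hI, h⟩ := exists_of_isMor (hbc.isMor i)
      exact ⟨f x, by rw [h]; exact (val_mkMor hf hI).2 ⟨hx, rfl⟩⟩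
  -- The recursion runs over all positions from 0 and idles at x until position i is reached.
  obtain ⟨h, hh, hh0, hhs⟩ := exists_primrec (α := M × M) (f := fun p => p.2)
    (g := fun p j y => if j < p.1 then p.2 else f (j, y)) (by fun_prop) (by fun_prop)
  have hfI : ∀ i, Inc (b i) (b (i + 1)) (fun x => f (i, x)) ∧
      c i = mkMor (b i) (b (i + 1)) fun x => f (i, x) := by
    intro i
    obtain ⟨g, hg, hI, h⟩ := exists_of_isMor (hbc.isMor i)
    have hfg : ∀ x, x < b i → f (i, x) = g x := fun x hx => by
      have := hf' (i, x) hx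
      simp only [h] at this
      exact ((val_mkMor hg hI).1 this).2
    refine ⟨⟨fun x hx => ?_, fun x y hxy hy => ?_⟩, ?_⟩
    · beta_reduce
      rw [hfg x hx]
      exact hI.1 x hx
    · beta_reduce
      rw [hfg x (hxy.trans hy), hfg y hy]
      exact hI.2 x y hxy hy
    · rw [h]
      exact mkMor_congr fun x hx => (hfg x hx).symm
  refine ⟨fun i x => f (i, x), fun i x j => h (i, x) j, by fun_prop, ⟨hb, by fun_prop,
    fun i => (hfI i).1, fun {i x j} hj => ?_, fun {i x j} hij => ?_⟩, fun i => (hfI i).2⟩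
  · refine comp_induction (P := fun j => j ≤ i → h (i, x) j = x) (by fun_prop) (fun _ => hh0 _)
      (fun j _ hj => ?_) j hj
    rw [hhs, if_pos (succ_le_iff.1 hj)]
  · simp only [hhs]
    rw [if_neg (not_lt.2 hij)]

namespace IsIteration

variable {b : M → M} {cf : M → M → M} {r : M → M → M → M}

theorem comp_r (H : IsIteration b cf r) {f g h : α → M} (hf : Comp M f) (hg : Comp M g)
    (hh : Comp M h) : Comp M fun x => r (f x) (g x) (h x) :=
  H.compR.comp (hf.prodMk (hg.prodMk hh))

variable {i j k x y : M}

theorem lt (H : IsIteration b cf r) (hij : i ≤ j) (hx : x < b i) : r i x j < b j := by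
  have hr := H.compR
  have hb := H.compB
  refine comp_induction_from (P := fun j => r i x j < b j) (by fun_prop) ?_ (fun j hij ih => ?_) hij
  · rwa [H.of_le le_rfl]
  · rw [H.succ hij]
    exact (H.inc j).1 _ ih

theorem strictMono (H : IsIteration b cf r) (hij : i ≤ j) (hxy : x < y) (hy : y < b i) :
    r i x j < r i y j := by
  have hr := H.compR
  refine comp_induction_from (P := fun j => r i x j < r i y j) (by fun_prop) ?_
    (fun j hij ih => ?_) hij
  · rwa [H.of_le le_rfl, H.of_le le_rfl]
  · rw [H.succ hij, H.succ hij]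
    exact (H.inc j).2 _ _ ih (H.lt hij hy)

theorem inc_r (H : IsIteration b cf r) (hij : i ≤ j) : Inc (b i) (b j) fun x => r i x j :=
  ⟨fun _ hx => H.lt hij hx, fun _ _ hxy hy => H.strictMono hij hxy hy⟩

theorem trans (H : IsIteration b cf r) (hij : i ≤ j) (hjk : j ≤ k) : r j (r i x j) k = r i x k := by
  have hr := H.compR
  refine comp_induction_from (P := fun k => r j (r i x j) k = r i x k) (by fun_prop) ?_
    (fun k hjk ih => ?_) hjk
  · rw [H.of_le le_rfl]
  · rw [H.succ hjk, H.succ (hij.trans hjk), ih]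

/-- Along any coded sequence that witnesses the iterated value, the entries agree with the recursion
by induction on the position. -/
theorem eq_of_iterVal (H : IsIteration b cf r) {c : M → M}
    (hcf : Comp M fun p : M × M => cf p.1 p.2)
    (hc : ∀ i, c i = mkMor (b i) (b (i + 1)) (cf i)) {z : M} (hij : i ≤ j)
    (h : IterVal c i j x z) : z = r i x j := by
  have hr := H.compR
  obtain ⟨s, -, hs, hx, hz, hstep⟩ := h
  have key : ∀ k, i ≤ k → k ≤ j → Mem (pr k (r i x k)) s := by
    intro k hik
    refine comp_induction_from (P := fun k => k ≤ j → Mem (pr k (r i x k)) s) (by fun_prop)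
      (fun _ => ?_) (fun k hik ih hkj => ?_) hik
    · rwa [H.of_le le_rfl]
    · have hkj' := succ_le_iff.1 hkj
      obtain ⟨u, u', hu, hu', hv⟩ := hstep k ⟨hik, hkj'⟩
      obtain rfl := hs _ _ _ ⟨hu, ih hkj'.le⟩
      rw [hc, val_mkMor (hcf.comp (f := fun x => (k, x)) (by fun_prop)) (H.inc k)] at hv
      rw [H.succ hik, ← hv.2]
      exact hu'
  exact hs _ _ _ ⟨hz, key j hij le_rfl⟩

/-- The value of `z` in position `j`. -/
noncomputable def at' (r : M → M → M → M) (z j : M) : M := r (π₁ z) (π₂ z) j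

/-- The elements of the limit of the system. -/
def Lim (b : M → M) (r : M → M → M → M) (z : M) : Prop :=
  z = pr (π₁ z) (π₂ z) ∧ π₂ z < b (π₁ z) ∧
    ∀ i, i < π₁ z → ∀ x, x < b i → r i x (π₁ z) ≠ π₂ z

/-- The order on the limit of the system. -/
def LimLt (b : M → M) (r : M → M → M → M) (z w : M) : Prop :=
  Lim b r z ∧ Lim b r w ∧ at' r z (π₁ z + π₁ w) < at' r w (π₁ z + π₁ w)

theorem comp_at (H : IsIteration b cf r) : Comp M fun p : M × M => at' r p.1 p.2 :=
  H.comp_r (by fun_prop) (by fun_prop) (by fun_prop)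

theorem comp_lim (H : IsIteration b cf r) : Comp M (Lim b r) := by
  have hr := H.compR
  have hb := H.compB
  unfold Lim
  fun_prop

theorem comp_limLt (H : IsIteration b cf r) : Comp M fun p : M × M => LimLt b r p.1 p.2 := by
  have := H.comp_at
  have := H.comp_lim
  unfold LimLt
  fun_prop

variable {z w : M}

theorem at_lt (H : IsIteration b cf r) (hz : Lim b r z) (hj : π₁ z ≤ j) : at' r z j < b j :=
  H.lt hj hz.2.1

theorem at_trans (H : IsIteration b cf r) (hj : π₁ z ≤ j) (hjk : j ≤ k) :
    r j (at' r z j) k = at' r z k := H.trans hj hjk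

theorem at_succ (H : IsIteration b cf r) (hj : π₁ z ≤ j) : at' r z (j + 1) = cf j (at' r z j) :=
  H.succ hj

theorem at_lt_at_iff (H : IsIteration b cf r) (hz : Lim b r z) (hw : Lim b r w) (hj : π₁ z ≤ j)
    (hj' : π₁ w ≤ j) (hjk : j ≤ k) : at' r z k < at' r w k ↔ at' r z j < at' r w j := by
  rw [← H.at_trans hj hjk, ← H.at_trans hj' hjk]
  exact (H.inc_r hjk).lt_iff (H.at_lt hz hj) (H.at_lt hw hj')

theorem limLt_iff (H : IsIteration b cf r) (hz : Lim b r z) (hw : Lim b r w) (hj : π₁ z ≤ j)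
    (hj' : π₁ w ≤ j) : LimLt b r z w ↔ at' r z j < at' r w j := by
  have h1 : LimLt b r z w ↔ at' r z (π₁ z + π₁ w) < at' r w (π₁ z + π₁ w) :=
    ⟨fun h => h.2.2, fun h => ⟨hz, hw, h⟩⟩
  rw [h1, ← H.at_lt_at_iff hz hw le_self_add le_add_self
    (le_self_add : π₁ z + π₁ w ≤ π₁ z + π₁ w + j), H.at_lt_at_iff hz hw hj hj' le_add_self]

/-- The later element is by definition not an image from an earlier stage, and the transition maps
are injective. -/
theorem at_ne_of_lt (H : IsIteration b cf r) (hz : Lim b r z) (hw : Lim b r w)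
    (hzw : π₁ z < π₁ w) (hj' : π₁ w ≤ j) : at' r z j ≠ at' r w j := by
  intro h
  have h1 : r (π₁ w) (at' r z (π₁ w)) j = r (π₁ w) (π₂ w) j := by
    rw [H.at_trans hzw.le hj']
    exact h
  have h2 := (H.inc_r hj').injOn (H.at_lt hz hzw.le) hw.2.1 h1
  exact hw.2.2 _ hzw _ hz.2.1 h2

theorem at_inj (H : IsIteration b cf r) (hz : Lim b r z) (hw : Lim b r w) (hj : π₁ z ≤ j)
    (hj' : π₁ w ≤ j) (h : at' r z j = at' r w j) : z = w := by
  rcases lt_trichotomy (π₁ z) (π₁ w) with h' | h' | h'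
  · exact (H.at_ne_of_lt hz hw h' hj' h).elim
  · rw [hz.1, hw.1, pr_inj]
    refine ⟨h', (H.inc_r hj').injOn (h' ▸ hz.2.1) hw.2.1 ?_⟩
    simp only [at', h'] at h
    exact h
  · exact (H.at_ne_of_lt hw hz h' hj h.symm).elim

/-- Trace x back to the least stage where it has a preimage. Normalising to the least stage makes
elements of the limit unique, so no quotient is needed. -/
theorem exists_at_eq (H : IsIteration b cf r) (hx : x < b i) :
    ∃ z, Lim b r z ∧ π₁ z ≤ i ∧ at' r z i = x := by
  have hr := H.compR
  have hb := H.compB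
  obtain ⟨k, ⟨hk, y, hy, hyx⟩, hk'⟩ := exists_least
    (P := fun k => k ≤ i ∧ ∃ y, y < b k ∧ r k y i = x) (by fun_prop)
    ⟨i, le_rfl, x, hx, H.of_le le_rfl⟩
  refine ⟨pr k y, ⟨by simp, by simpa using hy, fun l hl w hw h => ?_⟩, by simpa using hk,
    by simpa [at'] using hyx⟩
  simp only [π₁_pr, π₂_pr] at hl h
  refine hk' l hl ⟨hl.le.trans hk, w, hw, ?_⟩
  rw [← H.trans hl.le hk, h, hyx]

theorem isLin (H : IsIteration b cf r) : IsLin (Lim b r) (LimLt b r) := by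
  refine ⟨fun x h => lt_irrefl _ h.2.2, fun x y z hxy hyz => ?_, fun x y hx hy => ?_⟩
  · have h1 : π₁ x ≤ π₁ x + π₁ y + π₁ z := le_self_add.trans le_self_add
    have h2 : π₁ y ≤ π₁ x + π₁ y + π₁ z := le_add_self.trans le_self_add
    have h3 : π₁ z ≤ π₁ x + π₁ y + π₁ z := le_add_self
    have hx := hxy.1
    have hy := hyz.1
    have hz := hyz.2.1
    exact (H.limLt_iff hx hz h1 h3).2
      (((H.limLt_iff hx hy h1 h2).1 hxy).trans ((H.limLt_iff hy hz h2 h3).1 hyz))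
  · have h1 : π₁ x ≤ π₁ x + π₁ y := le_self_add
    have h2 : π₁ y ≤ π₁ x + π₁ y := le_add_self
    rw [H.limLt_iff hx hy h1 h2, H.limLt_iff hy hx h2 h1]
    rcases lt_trichotomy (at' r x (π₁ x + π₁ y)) (at' r y (π₁ x + π₁ y)) with h | h | h
    exacts [.inl h, .inr (.inl (H.at_inj hx hy h1 h2 h)), .inr (.inr h)]

/-- Spread a descending sequence f over increasing stages J(k) at which f(k) is already present, and
let d(J(k)) be the position of f(k) there. The condition on Goodstein systems then gives k < l with
f(k) at most f(l). -/
theorem wellFoundedOn (H : IsIteration b cf r) {c : M → M}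
    (hcf : Comp M fun p : M × M => cf p.1 p.2)
    (hc : ∀ i, c i = mkMor (b i) (b (i + 1)) (cf i)) (hbc : IsGoodsteinSystem b c) :
    WellFoundedOn (Lim b r) (LimLt b r) := by
  rintro ⟨f, hf, hfX, hfR⟩
  have hat := H.comp_at
  -- The summand 1 makes J strictly increasing. Then k ≤ J(k), so the range of J is decidable and J
  -- can be inverted computably.
  obtain ⟨J, hJ, hJ0, hJs⟩ := exists_primrec (α := M) (f := fun _ => π₁ (f 0))
    (g := fun _ n y => y + π₁ (f (n + 1)) + 1) (by fun_prop) (by fun_prop)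
  have hJf : ∀ k, π₁ (f k) ≤ J 0 k := by
    intro k
    by_cases hk : k = 0
    · rw [hk, hJ0]
    · obtain ⟨k, rfl⟩ := exists_eq_succ hk
      rw [hJs]
      exact le_add_self.trans le_self_add
  have hJsucc : ∀ k, J 0 k < J 0 (k + 1) := fun k => by
    rw [hJs]
    exact lt_succ_iff.2 le_self_add
  have hJlt : ∀ {k l}, k < l → J 0 k < J 0 l := fun {k l} hkl =>
    lt_of_lt_succ (f := fun k => J 0 k) (R := fun x y => y < x) (by fun_prop) (by fun_prop)
      (fun x y z h h' => h'.trans h) hJsucc hkl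
  have hJle : ∀ k, k ≤ J 0 k := comp_induction (by fun_prop) zero_le fun k ih =>
    succ_le_iff.2 (ih.trans_lt (hJsucc k))
  have hYc : Comp M fun y => ∃ k, k < y + 1 ∧ J 0 k = y := by fun_prop
  obtain ⟨K, hK, hK'⟩ := exists_comp_choice_of (α := M) (P := fun y k => J 0 k = y)
    (Q := fun y => ∃ k, k < y + 1 ∧ J 0 k = y) (by fun_prop) hYc fun y ⟨k, _, hk⟩ => ⟨k, hk⟩
  have hKJ : ∀ k, K (J 0 k) = k := fun k => by
    have h := hK' (J 0 k) ⟨k, lt_succ_iff.2 (hJle k), rfl⟩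
    rcases lt_trichotomy (K (J 0 k)) k with h' | h' | h'
    exacts [absurd h (hJlt h').ne, h', absurd h (hJlt h').ne']
  classical
  obtain ⟨i, j, ⟨k, -, rfl⟩, ⟨l, -, rfl⟩, hij, z, hz, hzd⟩ := hbc.exists_le
    -- Outside the range of J the default 0 is admissible because every b(y) is positive.
    (fun y => if ∃ k, k < y + 1 ∧ J 0 k = y then at' r (f (K y)) y else 0)
    (fun y => ∃ k, k < y + 1 ∧ J 0 k = y) (by fun_prop) hYc (fun y => by
      split_ifs with h
      · obtain ⟨k, -, rfl⟩ := h
        rw [hKJ]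
        exact H.at_lt (hfX k) (hJf k)
      · exact hbc.pos.trans_le (hbc.mono 0 y zero_le)) fun k =>
      ⟨J 0 (k + 1), succ_le_iff.1 (hJle (k + 1)), k + 1, lt_succ_iff.2 (hJle _), rfl⟩
  have hkl : k < l := by
    rcases lt_trichotomy k l with h | h | h
    exacts [h, absurd hij (h ▸ lt_irrefl _), absurd hij (hJlt h).not_gt]
  rw [if_pos ⟨l, lt_succ_iff.2 (hJle l), rfl⟩, hKJ] at hzd
  rw [if_pos ⟨k, lt_succ_iff.2 (hJle k), rfl⟩, hKJ] at hz
  rw [H.eq_of_iterVal hcf hc hij.le hz, H.at_trans (hJf k) hij.le] at hzd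
  have h1 := lt_of_lt_succ hf H.comp_limLt H.isLin.trans hfR hkl
  rw [H.limLt_iff (hfX l) (hfX k) (hJf l) ((hJf k).trans hij.le)] at h1
  exact absurd h1 (not_lt.2 hzd)

end IsIteration

/-! ## From extensions to Goodstein sequences -/

/-- A positive term stays positive under D(c_i), so its predecessor exists, and it remains in D(b(i
+ 1)) since this is an initial segment. Neither fact needs well foundedness. -/
theorem exists_isGoodsteinSequence {D : M → M → Prop} {App : M → M → M → Prop} {A : M → M → M}
    (H : IsDilator D App A) {b c : M → M} (hbc : IsGoodsteinSystem b c) {m : M} (hm : D (b 0) m) :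
    ∃ g, Comp M g ∧ IsGoodsteinSequence App c m g ∧ ∀ i, D (b i) (g i) := by
  have hA := H.compA
  have hb := hbc.compB
  have hc := hbc.compC
  have hD := H.compD
  obtain ⟨pd, hpd, hpd'⟩ := exists_pred (M := M)
  classical
  obtain ⟨g, hg, hg0, hgs⟩ := exists_primrec (α := M) (f := fun _ => m)
    (g := fun _ i x => if x = 0 then 0 else pd (A (c i) x)) (by fun_prop) (by fun_prop)
  have hstep : ∀ i, D (b i) (g 0 i) → g 0 i ≠ 0 → D (b (i + 1)) (g 0 (i + 1)) ∧
      A (c i) (g 0 i) = g 0 (i + 1) + 1 := by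
    intro i hi hgi
    obtain ⟨f, hf, hI, hcf⟩ := exists_of_isMor (hbc.isMor i)
    have h1 : 0 < A (c i) (g 0 i) := by
      rw [hcf]
      exact (pos_of_ne_zero' hgi).trans_le (H.le_apply hf hI hi)
    obtain ⟨w, hw⟩ := exists_eq_succ h1.ne'
    rw [hgs, if_neg hgi, hw, hpd']
    refine ⟨H.mem_of_lt (σ := A (c i) (g 0 i)) ?_ (by rw [hw]; exact lt_succ_self w), rfl⟩
    rw [hcf]
    exact H.mem hf hI hi
  have hgD : ∀ i, D (b i) (g 0 i) := by
    refine comp_induction (by fun_prop) (by rwa [hg0]) fun i ih => ?_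
    by_cases hgi : g 0 i = 0
    · rw [hgs, if_pos hgi]
      exact H.zero_mem _
    · exact (hstep i ih hgi).1
  refine ⟨fun i => g 0 i, by fun_prop, ⟨hg0 0, fun i => ⟨fun h => ?_, fun h => ?_⟩⟩, hgD⟩
  · simp only at h ⊢
    rw [hgs, if_pos h]
  · exact (H.app_iff (hbc.isMor i)).2 ⟨hgD i, (hstep i (hgD i) h).2⟩

/-- A Goodstein sequence without zeros is lifted, via supports, to a descending sequence in the
extension over the limit of the system. -/
theorem goodsteinTerminates_of_extPreserves {D : M → M → Prop} {App : M → M → M → Prop}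
    {A : M → M → M} (H : IsDilator D App A) {S : M → M → M → Prop}
    (hS : Comp M fun p : M × M × M => S p.1 p.2.1 p.2.2) (hsupp : IsSupport D App S)
    (hE : ExtPreserves D App S) : GoodsteinTerminates D App := by
  intro b c hbc m hm
  obtain ⟨g, hg, hgs, hgD⟩ := exists_isGoodsteinSequence H hbc hm
  refine ⟨g, hg, hgs, ?_⟩
  by_contra hg0
  push Not at hg0
  obtain ⟨cf, r, hcf, hr, hc⟩ := exists_isIteration hbc
  have hb := hbc.compB
  have hat := hr.comp_at
  have hlim := hr.comp_lim
  have hA := H.compA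
  have hD := H.compD
  obtain ⟨N, el, ix, HE⟩ := exists_enumerates hr.comp_lim hr.comp_limLt hr.isLin
  have hN := HE.compN
  have hel := HE.compEl
  have hcfc : ∀ i, Comp M (cf i) := fun i => hcf.comp (f := fun x => (i, x)) (by fun_prop)
  set X := IsIteration.Lim b r with hX
  set R := IsIteration.LimLt b r with hR
  set v := IsIteration.at' r with hv
  -- embeddings of finite subsets of the limit into `b j`
  have hvc : ∀ u j, Comp M fun k => v (el u k) j := fun u j => by fun_prop
  have hvI : ∀ {u j}, SubsetOf X u → (∀ z, Mem z u → π₁ z ≤ j) →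
      Inc (N u) (b j) fun k => v (el u k) j := by
    intro u j hu hj
    refine ⟨fun k hk => hr.at_lt (hu _ (HE.el_mem hu hk)) (hj _ (HE.el_mem hu hk)),
      fun k l hkl hl => ?_⟩
    have h1 := HE.el_mem hu (hkl.trans hl)
    have h2 := HE.el_mem hu hl
    exact (hr.limLt_iff (hu _ h1) (hu _ h2) (hj _ h1) (hj _ h2)).1 (HE.el_rel hu hkl hl)
  obtain ⟨s, hs, hs'⟩ := exists_comp_choice (P := fun i s => S (b i) (g i) s)
    (hS.comp (f := fun p : M × M => (b p.1, g p.1, p.2)) (by fun_prop))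
    fun i => by
      obtain ⟨s, hs, -⟩ := (hsupp.1 (b i) (g i) (hgD i)).1
      exact ⟨s, hs⟩
  have hsb : ∀ i x, Mem x (s i) → x < b i := by
    intro i x hx
    obtain ⟨⟨t, ht, -, ht'⟩, hu⟩ := hsupp.1 (b i) (g i) (hgD i)
    exact ht' x (hu _ _ ⟨hs' i, ht⟩ ▸ hx)
  -- The points of the limit that represent the support of g(i) at stage i. A limit element born at
  -- stage k ≤ i has its second component below b(k) ≤ b(i), which gives the bound for the codes.
  set a : M → M := fun i => mkFin (pr (i + 1) (b i)) fun z => X z ∧ π₁ z ≤ i ∧ Mem (v z i) (s i)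
    with ha
  have hac : Comp M a := by fun_prop
  have ham : ∀ i z, Mem z (a i) ↔ X z ∧ π₁ z ≤ i ∧ Mem (v z i) (s i) := by
    intro i z
    rw [ha]
    simp only
    rw [mem_mkFin (by fun_prop)]
    refine ⟨fun h => h.2, fun h => ⟨?_, h⟩⟩
    rw [h.1.1]
    exact pr_lt_pr (lt_succ_iff.2 h.2.1) (h.1.2.1.trans_le (hbc.mono _ _ h.2.1))
  have haX : ∀ i, SubsetOf X (a i) := fun i z hz => ((ham i z).1 hz).1
  have hai : ∀ i j, i ≤ j → ∀ z, Mem z (a i) → π₁ z ≤ j := fun i j hij z hz =>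
    ((ham i z).1 hz).2.1.trans hij
  have haI : ∀ i, Inc (N (a i)) (b i) fun k => v (el (a i) k) i := fun i =>
    hvI (haX i) (hai i i le_rfl)
  have hrng : ∀ i x, Mem x (s i) → ∃ k, k < N (a i) ∧ v (el (a i) k) i = x := by
    intro i x hx
    obtain ⟨z, hz, hzi, rfl⟩ := hr.exists_at_eq (hsb i x hx)
    have hza : Mem z (a i) := (ham i z).2 ⟨hz, hzi, hx⟩
    exact ⟨ix (a i) z, HE.ix_lt (haX i) hza, by rw [HE.el_ix (haX i) hza]⟩
  -- As the support of g(i) lies in the range of the embedding of a(i) into b(i), the value g(i) has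
  -- a preimage.
  obtain ⟨σ, hσ, hσ'⟩ := exists_comp_choice
    (P := fun i σ => D (N (a i)) σ ∧ A (mkMor (N (a i)) (b i) fun k => v (el (a i) k) i) σ = g i)
    (by fun_prop) fun i => by
      obtain ⟨ρ, hρ⟩ := hsupp.2.2 _ _ _ (isMor_mkMor (hvc (a i) i) (haI i)) (g i) (s i)
        ⟨hgD i, hs' i, fun x hx => by
          obtain ⟨k, hk, hk'⟩ := hrng i x hx
          exact ⟨k, (val_mkMor (hvc _ _) (haI i)).2 ⟨hk, hk'.symm⟩⟩⟩
      exact ⟨ρ, (H.app_iff (isMor_mkMor (hvc (a i) i) (haI i))).1 hρ⟩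
  refine hE X R hr.comp_lim hr.comp_limLt (fun x y h => ⟨h.1, h.2.1⟩) hr.isLin
    (hr.wellFoundedOn hcf hc hbc) ⟨fun i => pr (a i) (σ i), by fun_prop, fun i => ?_, fun i => ?_⟩
  · obtain ⟨e, he, -⟩ := HE.exists_isEnum (haX i)
    obtain ⟨⟨t, ht, -, ht'⟩, -⟩ := hsupp.1 (N (a i)) (σ i) (hσ' i).1
    refine ⟨a i, σ i, rfl, isFin_mkFin (by fun_prop), haX i, N (a i), e, t, he, (hσ' i).1, ht,
      fun k => ⟨ht' k, fun hk => ?_⟩⟩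
    -- Naturality: the support of σ(i) is mapped onto that of g(i), which contains the images of all
    -- positions in a(i). By injectivity σ(i) has full support.
    have h1 := hsupp.2.1 _ _ _ (isMor_mkMor (hvc (a i) i) (haI i)) (σ i) (g i) t (s i)
      ⟨(H.app_iff (isMor_mkMor (hvc (a i) i) (haI i))).2 (hσ' i), ht, hs' i⟩
      (v (el (a i) k) i)
    obtain ⟨k', hk', hv'⟩ := h1.1 ((ham i _).1 (HE.el_mem (haX i) hk)).2.2
    rw [val_mkMor (hvc _ _) (haI i)] at hv'
    rwa [(haI i).injOn hk hv'.1 hv'.2]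
  · rw [ltExt_iff H HE (haX _) (haX _)]
    have hum : ∀ x, Mem x (mkFin (a (i + 1) + a i) fun x => Mem x (a (i + 1)) ∨ Mem x (a i)) ↔
        Mem x (a (i + 1)) ∨ Mem x (a i) := by
      intro x
      rw [mem_mkFin (by fun_prop)]
      refine ⟨fun h => h.2, fun h => ⟨?_, h⟩⟩
      rcases h with h | h
      exacts [h.lt.trans_le le_self_add, h.lt.trans_le le_add_self]
    refine ⟨_, isFin_mkFin (by fun_prop), hum, (hσ' _).1, (hσ' _).1, ?_⟩
    set u := mkFin (a (i + 1) + a i) fun x => Mem x (a (i + 1)) ∨ Mem x (a i) with hu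
    have hXu : SubsetOf X u := fun x hx => ((hum x).1 hx).elim (haX _ x) (haX _ x)
    have hui : ∀ z, Mem z u → π₁ z ≤ i + 1 := fun z hz =>
      ((hum z).1 hz).elim (hai _ _ le_rfl z) (hai _ _ (lt_succ_self i).le z)
    -- Both elements are compared at stage i + 1, where the whole union u is embedded into b(i + 1).
    have hJ : ∀ j, (∀ x, Mem x (a j) → Mem x u) →
        A (mkMor (N u) (b (i + 1)) fun k => v (el u k) (i + 1))
          (A (mkMor (N (a j)) (N u) fun k => ix u (el (a j) k)) (σ j)) =
        A (mkMor (N (a j)) (b (i + 1)) fun k => v (el (a j) k) (i + 1)) (σ j) := by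
      intro j hj
      rw [← H.comp HE.comp_incl (hvc u (i + 1)) (HE.inc_incl hXu hj) (hvI hXu hui) (hσ' j).1]
      refine congrArg₂ _ (mkMor_congr fun k hk => ?_) rfl
      rw [HE.el_ix hXu (hj _ (HE.el_mem (haX j) hk))]
    have h1 : ∀ x, Mem x (a (i + 1)) → Mem x u := fun x hx => (hum x).2 (.inl hx)
    have h2 : ∀ x, Mem x (a i) → Mem x u := fun x hx => (hum x).2 (.inr hx)
    rw [← H.lt_iff (hvc u (i + 1)) (hvI hXu hui)
      (H.mem HE.comp_incl (HE.inc_incl hXu h1) (hσ' _).1)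
      (H.mem HE.comp_incl (HE.inc_incl hXu h2) (hσ' _).1), hJ _ h1, hJ _ h2, (hσ' (i + 1)).2]
    -- One stage later σ(i) becomes D(c_i)(g(i)) = g(i + 1) + 1, whereas σ(i + 1) becomes g(i + 1).
    have h3 : A (mkMor (N (a i)) (b (i + 1)) fun k => v (el (a i) k) (i + 1)) (σ i) =
        A (c i) (g i) := by
      rw [← (hσ' i).2, hc, ← H.comp (hvc (a i) i) (hcfc i) (haI i) (hr.inc i) (hσ' i).1]
      refine congrArg₂ _ (mkMor_congr fun k hk => ?_) rfl
      exact hr.at_succ (hai i i le_rfl _ (HE.el_mem (haX i) hk))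
    have h4 := (H.app_iff (hbc.isMor i)).1 ((hgs.2 i).2 (hg0 i))
    rw [h3, h4.2]
    exact lt_succ_self _

end SOA

/-! ### Translation of formulas into statements about the model. -/

namespace SOA

universe u

open Fm

/-! ## Evaluation of formulas with named variables -/

variable (M : Type u) [RCA M] in
/-- The next unused variable, and assignments to the variables. -/
structure Env where
  n : ℕ
  v : ℕ → M
  w : ℕ → (toModel M).sets

variable {M : Type u} [RCA M] {E E' : Env M}

open Function (update) in
/-- The environment with another number variable. -/
def Env.push (E : Env M) (a : M) : Env M := ⟨E.n + 1, update E.v E.n a, E.w⟩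

open Function (update) in
/-- The environment with another set variable. -/
def Env.pushSet (E : Env M) (A : (toModel M).sets) : Env M := ⟨E.n + 1, E.v, update E.w E.n A⟩

/-- The term `t` uses the variables of `E` and has value `a`. -/
class Den (E : Env M) (t : Term) (a : M) : Prop where
  lt : ∀ i ∈ t.vars, i < E.n
  eval : t.eval (toModel M) E.v = a

/-- The set variable `X` belongs to `E` and has value `A`. -/
class SetDen (E : Env M) (X : SetVar) (A : Set M) : Prop where
  lt : X < E.n
  eval : (E.w X : Set M) = A

/-- In the environment `E`, the formula `φ` expresses `P`. -/
class Holds (E : Env M) (φ : Fm) (P : Prop) : Prop where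
  iff : (φ E.n).eval (toModel M) E.v E.w ↔ P

section Terms

variable {s t : Term} {a b c : M} {X : SetVar} {A : Set M}

/-- The bound name `E.n` exceeds all names in use, so earlier terms keep their values under a
quantifier. -/
instance [h : Den E t a] : Den (E.push b) t a where
  lt i hi := (h.lt i hi).trans (Nat.lt_succ_self _)
  eval := (Term.eval_congr _ fun i hi => Function.update_of_ne (h.lt i hi).ne _ _).trans h.eval

instance {B : (toModel M).sets} [h : Den E t a] : Den (E.pushSet B) t a where
  lt i hi := (h.lt i hi).trans (Nat.lt_succ_self _)
  eval := h.eval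

instance [h : SetDen E X A] : SetDen (E.push a) X A where
  lt := h.lt.trans (Nat.lt_succ_self _)
  eval := h.eval

instance {B : (toModel M).sets} [h : SetDen E X A] : SetDen (E.pushSet B) X A where
  lt := h.lt.trans (Nat.lt_succ_self _)
  eval := (congrArg _ (Function.update_of_ne h.lt.ne _ _)).trans h.eval

instance : Den (E.push a) (.var E.n) a :=
  ⟨fun _ hi => hi ▸ Nat.lt_succ_self _, Function.update_self _ _ _⟩

instance {B : (toModel M).sets} : SetDen (E.pushSet B) E.n B :=
  ⟨Nat.lt_succ_self _, congrArg _ (Function.update_self _ _ _)⟩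

instance : Den E 0 0 := ⟨by simp, rfl⟩
instance : Den E 1 1 := ⟨by simp, rfl⟩
instance [h : Den E s a] [h' : Den E t b] : Den E (s + t) (a + b) where
  lt i hi := hi.elim (h.lt i) (h'.lt i)
  eval := congrArg₂ (· + ·) h.eval h'.eval
instance [h : Den E s a] [h' : Den E t b] : Den E (s * t) (a * b) where
  lt i hi := hi.elim (h.lt i) (h'.lt i)
  eval := congrArg₂ (· * ·) h.eval h'.eval
instance [Den E s a] [Den E t b] : Den E (pair s t) (pr a b) := by
  unfold pair pr
  infer_instance
instance {r : Term} [Den E s a] [Den E t b] [Den E r c] : Den E (triple s t r) (pr a (pr b c)) := by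
  unfold triple
  infer_instance

instance [h : Den E s a] [h' : Den E t b] : Holds E (s ≐ t) (a = b) where
  iff := by
    rw [← h.eval, ← h'.eval]
    rfl
instance [h : Den E s a] [h' : Den E t b] : Holds E (s ≺ t) (a < b) where
  iff := by
    rw [← h.eval, ← h'.eval]
    rfl
instance [h : Den E s a] [h' : SetDen E X A] : Holds E (s ∊ X) (a ∈ A) where
  iff := by
    rw [← h.eval, ← h'.eval]
    rfl

end Terms

section Connectives

variable {φ ψ : Fm} {P Q : Prop}

theorem Holds.congr (h : Holds E φ P) (h' : P ↔ Q) : Holds E φ Q := ⟨h.iff.trans h'⟩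

instance [h : Holds E φ P] : Holds E (∼φ) (¬ P) := ⟨not_congr h.iff⟩
instance [h : Holds E φ P] [h' : Holds E ψ Q] : Holds E (φ ⋏ ψ) (P ∧ Q) := ⟨and_congr h.iff h'.iff⟩
instance [h : Holds E φ P] [h' : Holds E ψ Q] : Holds E (φ ⋎ ψ) (P ∨ Q) := ⟨or_congr h.iff h'.iff⟩
instance [h : Holds E φ P] [h' : Holds E ψ Q] : Holds E (φ ➝ ψ) (P → Q) := ⟨imp_congr h.iff h'.iff⟩
instance [h : Holds E φ P] [h' : Holds E ψ Q] : Holds E (φ ⭤ ψ) (P ↔ Q) :=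
  ⟨(and_congr (imp_congr h.iff h'.iff) (imp_congr h'.iff h.iff)).trans iff_def.symm⟩

end Connectives

section Quantifiers

instance {φ : Term → Fm} {P : M → Prop} [h : ∀ a, Holds (E.push a) (φ (.var E.n)) (P a)] :
    Holds E (Fm.all φ) (∀ a, P a) :=
  ⟨forall_congr' fun a => (h a).iff⟩

instance {φ : Term → Fm} {P : M → Prop} [h : ∀ a, Holds (E.push a) (φ (.var E.n)) (P a)] :
    Holds E (Fm.ex φ) (∃ a, P a) :=
  ⟨exists_congr fun a => (h a).iff⟩

instance {φ : SetVar → Fm} {P : Set M → Prop}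
    [h : ∀ A : (toModel M).sets, Holds (E.pushSet A) (φ E.n) (P A)] :
    Holds E (allSet φ) (∀ A, IsSet A → P A) :=
  ⟨(forall_congr' fun A => (h A).iff).trans Subtype.forall⟩

instance {φ : SetVar → Fm} {P : Set M → Prop}
    [h : ∀ A : (toModel M).sets, Holds (E.pushSet A) (φ E.n) (P A)] :
    Holds E (exSet φ) (∃ A, IsSet A ∧ P A) :=
  ⟨(exists_congr fun A => (h A).iff).trans (Subtype.exists.trans (by simp [IsSet]))⟩

instance {φ : Term → Term → Fm} {P : M → M → Prop} [h : Holds E (all fun s => all fun t => φ s t) (∀ a b, P a b)] :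
    Holds E (all₂ φ) (∀ a b, P a b) := h
instance {φ : Term → Term → Term → Fm} {P : M → M → M → Prop}
    [h : Holds E (all fun s => all₂ fun t r => φ s t r) (∀ a b c, P a b c)] :
    Holds E (all₃ φ) (∀ a b c, P a b c) := h
instance {φ : Term → Term → Term → Term → Fm} {P : M → M → M → M → Prop}
    [h : Holds E (all fun s => all₃ fun t r q => φ s t r q) (∀ a b c d, P a b c d)] :
    Holds E (all₄ φ) (∀ a b c d, P a b c d) := h
instance {φ : Term → Term → Fm} {P : M → M → Prop} [h : Holds E (ex fun s => ex fun t => φ s t) (∃ a b, P a b)] :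
    Holds E (ex₂ φ) (∃ a b, P a b) := h
instance {φ : Term → Term → Term → Fm} {P : M → M → M → Prop}
    [h : Holds E (ex fun s => ex₂ fun t r => φ s t r) (∃ a b c, P a b c)] :
    Holds E (ex₃ φ) (∃ a b c, P a b c) := h
instance {φ : Term → Term → Term → Term → Fm} {P : M → M → M → M → Prop}
    [h : Holds E (ex fun s => ex₃ fun t r q => φ s t r q) (∃ a b c d, P a b c d)] :
    Holds E (ex₄ φ) (∃ a b c d, P a b c d) := h

end Quantifiers

end SOA

namespace SOA

universe u

open Fm

variable {M : Type u} [RCA M] {E : Env M}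

/-! ## The meaning of the formulas -/

/-- The binary relation coded by a set. -/
def Rel (A : Set M) (x y : M) : Prop := pr x y ∈ A

/-- The ternary relation coded by a set. -/
def Rel₃ (A : Set M) (x y z : M) : Prop := pr x (pr y z) ∈ A

/-- The code `h` describes the composition of `g` and `f`. -/
def IsComp (g f h : M) : Prop := ∀ i j k, Val f i j ∧ Val g j k → Val h i k

/-- The compositions of `p` with `e` and of `p'` with `e'` coincide. -/
def Commutes (p p' e e' : M) : Prop := ∀ x i j y, Val p x i ∧ Val p' x j ∧ Val e i y → Val e' j y

/-- Pullback squares of natural numbers. -/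
def IsPullbackNat (l m m' p p' e e' : M) : Prop :=
  Commutes p p' e e' ∧ ∀ k g g', IsMor g k m ∧ IsMor g' k m' ∧ Commutes g g' e e' →
    (∃ h, IsMor h k l ∧ IsComp p h g ∧ IsComp p' h g') ∧
      ∀ h h', IsMor h k l ∧ IsComp p h g ∧ IsComp p' h g' ∧
        IsMor h' k l ∧ IsComp p h' g ∧ IsComp p' h' g' → h = h'

/-- The set `U` codes an order embedding of `(W, R)` into `X`. -/
def IsEmbedding (X : M → Prop) (W : Set M) (R : M → M → Prop) (U : Set M) : Prop :=
  (∀ w x, Rel U w x → w ∈ W ∧ X x) ∧ (∀ w, w ∈ W → ∃ x, Rel U w x) ∧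
    (∀ w x x', Rel U w x ∧ Rel U w x' → x = x') ∧
    ∀ w x w' x', Rel U w x ∧ Rel U w' x' ∧ R w w' → x < x'

/-- The function coded by `U` is the composition of the one coded by `H` with `D(p)`. -/
def Factors (App : M → M → M → Prop) (p : M) (H U : Set M) : Prop :=
  ∀ w x y, Rel H w x ∧ App p x y → Rel U w y

/-- The image of a square of natural numbers is a pullback square of linear orders. -/
def IsPullbackLO (D : M → M → Prop) (App : M → M → M → Prop) (l m m' p p' e e' : M) : Prop :=
  (∀ ρ σ σ' τ, App p ρ σ ∧ App p' ρ σ' ∧ App e σ τ → App e' σ' τ) ∧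
    ∀ W, IsSet W → ∀ L, IsSet L → ∀ U, IsSet U → ∀ U', IsSet U' →
      ((∀ x y, Rel L x y → x ∈ W ∧ y ∈ W) ∧ IsLin (fun x => x ∈ W) (Rel L)) ∧
        IsEmbedding (D m) W (Rel L) U ∧ IsEmbedding (D m') W (Rel L) U' ∧
        (∀ w x x' y, Rel U w x ∧ Rel U' w x' ∧ App e x y → App e' x' y) →
      (∃ H, IsSet H ∧ IsEmbedding (D l) W (Rel L) H ∧ Factors App p H U ∧ Factors App p' H U') ∧
        ∀ H, IsSet H → ∀ H', IsSet H' → IsEmbedding (D l) W (Rel L) H ∧ Factors App p H U ∧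
          Factors App p' H U' ∧ IsEmbedding (D l) W (Rel L) H' ∧ Factors App p H' U ∧
          Factors App p' H' U' → ∀ w x, Rel H w x ↔ Rel H' w x

/-- Functors from natural numbers to linear orders. -/
def IsFunctor (D : M → M → Prop) (App : M → M → M → Prop) : Prop :=
  (∀ f m n, IsMor f m n → (∀ σ τ, App f σ τ → D m σ ∧ D n τ) ∧ (∀ σ, D m σ → ∃ τ, App f σ τ) ∧
    (∀ σ τ τ', App f σ τ ∧ App f σ τ' → τ = τ') ∧
    ∀ σ τ σ' τ', App f σ τ ∧ App f σ' τ' ∧ σ < σ' → τ < τ') ∧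
  (∀ f n, IsMor f n n ∧ (∀ i, i < n → Val f i i) → ∀ σ, D n σ → App f σ σ) ∧
  ∀ l m n f g h, IsMor f l m ∧ IsMor g m n ∧ IsMor h l n ∧ IsComp g f h →
    ∀ ρ σ τ, App f ρ σ ∧ App g σ τ → App h ρ τ

/-- Goodstein dilators. -/
def IsGoodsteinDilator (D : M → M → Prop) (App : M → M → M → Prop) : Prop :=
  (∀ n σ τ, D n σ ∧ τ < σ → D n τ) ∧ IsFunctor D App ∧
    (∀ l m m' n p p' e e', IsMor p l m ∧ IsMor p' l m' ∧ IsMor e m n ∧ IsMor e' m' n ∧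
      IsPullbackNat l m m' p p' e e' → IsPullbackLO D App l m m' p p' e e') ∧
    D 0 0 ∧ ∀ b f, IsMor f 0 b → App f 0 0 ∧ D b 0

/-- The set codes a function. -/
def IsFun (A : Set M) : Prop :=
  (∀ i, ∃ j, Rel A i j) ∧ ∀ i j j', Rel A i j ∧ Rel A i j' → j = j'

set_option synthInstance.maxSize 4000
set_option synthInstance.maxHeartbeats 1000000

section Finite

variable {a b c d : M} {q r s t : Term} {L : SetVar} {A : Set M}

instance [Den E s a] [Den E t b] : Holds E (le s t) (a ≤ b) :=
  Holds.congr (P := a < b ∨ a = b) (by unfold le; infer_instance) le_iff_lt_or_eq.symm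

instance [Den E s a] [Den E t b] : Holds E (inFin s t) (Mem a b) := by
  unfold inFin Mem
  infer_instance

instance [Den E s a] : Holds E (isTriple s) (IsTriple a) := by
  unfold isTriple IsTriple
  infer_instance

instance [Den E s a] : Holds E (isFin s) (IsFin a) := by
  unfold isFin IsFin
  infer_instance

instance [Den E r a] [Den E s b] [Den E t c] : Holds E (val r s t) (Val a b c) := by
  unfold val Val
  infer_instance

instance [Den E r a] [Den E s b] [Den E t c] : Holds E (isMor r s t) (IsMor a b c) := by
  unfold isMor IsMor
  infer_instance

instance [Den E r a] [Den E s b] [Den E t c] : Holds E (isComp r s t) (IsComp a b c) := by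
  unfold isComp IsComp
  infer_instance

instance [Den E q a] [Den E r b] [Den E s c] [Den E t d] :
    Holds E (commutes q r s t) (Commutes a b c d) := by
  unfold commutes Commutes
  infer_instance

instance [SetDen E L A] [Den E r a] [Den E s b] [Den E t c] :
    Holds E (isEnum L r s t) (IsEnum (Rel A) a b c) := by
  unfold isEnum IsEnum Rel
  infer_instance

instance [SetDen E L A] [Den E r a] [Den E s b] [Den E t c] :
    Holds E (isInclusion L r s t) (IsInclusion (Rel A) a b c) := by
  unfold isInclusion IsInclusion
  infer_instance

instance [SetDen E L A] [Den E s a] [Den E t b] : Holds E (maps L s t) (Rel A a b) := by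
  unfold maps Rel
  infer_instance

instance [SetDen E L A] [Den E s a] [Den E t b] : Holds E (inD L s t) (Rel A a b) := by
  unfold inD Rel
  infer_instance

instance [SetDen E L A] [Den E r a] [Den E s b] [Den E t c] :
    Holds E (app L r s t) (Rel₃ A a b c) := by
  unfold app Rel₃
  infer_instance

instance [SetDen E L A] : Holds E (isFun L) (IsFun A) := by
  unfold isFun IsFun
  infer_instance

end Finite

section Dilators

variable {l m m' p p' e e' : Term} {l₀ m₀ m₁ p₀ p₁ e₀ e₁ : M} {O D W L U H : SetVar}
  {O₀ D₀ W₀ L₀ U₀ H₀ : Set M}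

instance [Den E l l₀] [Den E m m₀] [Den E m' m₁] [Den E p p₀] [Den E p' p₁] [Den E e e₀]
    [Den E e' e₁] :
    Holds E (isPullbackNat l m m' p p' e e') (IsPullbackNat l₀ m₀ m₁ p₀ p₁ e₀ e₁) := by
  unfold isPullbackNat IsPullbackNat
  infer_instance

instance [SetDen E W W₀] [SetDen E L L₀] : Holds E (isLinearOrder W L)
    ((∀ x y, Rel L₀ x y → x ∈ W₀ ∧ y ∈ W₀) ∧ IsLin (fun x => x ∈ W₀) (Rel L₀)) :=
  Holds.congr (P := (∀ x y, pr x y ∈ L₀ → x ∈ W₀ ∧ y ∈ W₀) ∧ (∀ x, ¬ pr x x ∈ L₀) ∧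
    (∀ x y z, pr x y ∈ L₀ ∧ pr y z ∈ L₀ → pr x z ∈ L₀) ∧
    ∀ x y, x ∈ W₀ ∧ y ∈ W₀ → pr x y ∈ L₀ ∨ x = y ∨ pr y x ∈ L₀)
    (by unfold isLinearOrder; infer_instance)
    (and_congr_right fun _ => ⟨fun h => ⟨h.1, fun x y z h1 h2 => h.2.1 x y z ⟨h1, h2⟩,
      fun x y hx hy => h.2.2 x y ⟨hx, hy⟩⟩, fun h => ⟨h.irrefl, fun x y z h' =>
      h.trans x y z h'.1 h'.2, fun x y h' => h.total x y h'.1 h'.2⟩⟩)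

instance [SetDen E O O₀] [SetDen E W W₀] [SetDen E L L₀] [SetDen E U U₀] [Den E m m₀] :
    Holds E (isEmbedding O W L m U) (IsEmbedding (Rel O₀ m₀) W₀ (Rel L₀) U₀) := by
  unfold isEmbedding IsEmbedding
  -- Instance search would read this atom as plain membership; the local instance offers the reading
  -- through `Rel`, which the target uses.
  have : ∀ {E : Env M} {s t : Term} {a b : M} [SetDen E L L₀] [Den E s a] [Den E t b],
      Holds E (pair s t ∊ L) (Rel L₀ a b) := by
    unfold Rel
    infer_instance
  infer_instance

instance [SetDen E D D₀] [SetDen E H H₀] [SetDen E U U₀] [Den E p p₀] :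
    Holds E (factors D p H U) (Factors (Rel₃ D₀) p₀ H₀ U₀) := by
  unfold factors Factors
  infer_instance

instance [SetDen E O O₀] [SetDen E D D₀] [Den E l l₀] [Den E m m₀] [Den E m' m₁] [Den E p p₀]
    [Den E p' p₁] [Den E e e₀] [Den E e' e₁] : Holds E (isPullbackLO O D l m m' p p' e e')
      (IsPullbackLO (Rel O₀) (Rel₃ D₀) l₀ m₀ m₁ p₀ p₁ e₀ e₁) := by
  unfold isPullbackLO IsPullbackLO
  infer_instance

instance [SetDen E O O₀] [SetDen E D D₀] :
    Holds E (isFunctor O D) (IsFunctor (Rel O₀) (Rel₃ D₀)) := by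
  unfold isFunctor IsFunctor
  infer_instance

instance [SetDen E O O₀] [SetDen E D D₀] :
    Holds E (isGoodsteinDilator O D) (IsGoodsteinDilator (Rel O₀) (Rel₃ D₀)) := by
  unfold isGoodsteinDilator IsGoodsteinDilator hasInitialSegments preservesPullbacks
  infer_instance

instance {S : SetVar} {S₀ : Set M} [SetDen E O O₀] [SetDen E D D₀] [SetDen E S S₀] :
    Holds E (isSupport O D S) (IsSupport (Rel O₀) (Rel₃ D₀) (Rel₃ S₀)) := by
  have : ∀ {E : Env M} {r s t : Term} {a b c : M} [SetDen E S S₀] [Den E r a] [Den E s b]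
      [Den E t c], Holds E (triple r s t ∊ S) (Rel₃ S₀ a b c) := by
    unfold Rel₃
    infer_instance
  unfold isSupport IsSupport
  infer_instance

instance {S X : SetVar} {S₀ X₀ : Set M} [SetDen E O O₀] [SetDen E S S₀] [SetDen E X X₀]
    [SetDen E L L₀] [Den E p p₀] :
    Holds E (inExt O S X L p) (InExt (Rel O₀) (Rel₃ S₀) (fun x => x ∈ X₀) (Rel L₀) p₀) := by
  have : ∀ {E : Env M} {r s t : Term} {a b c : M} [SetDen E S S₀] [Den E r a] [Den E s b]
      [Den E t c], Holds E (triple r s t ∊ S) (Rel₃ S₀ a b c) := by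
    unfold Rel₃
    infer_instance
  unfold inExt InExt SubsetOf
  infer_instance

instance [SetDen E D D₀] [SetDen E L L₀] [Den E p p₀] [Den E p' p₁] :
    Holds E (ltExt D L p p') (LtExt (Rel₃ D₀) (Rel L₀) p₀ p₁) := by
  unfold ltExt LtExt
  infer_instance

end Dilators

end SOA

namespace SOA

universe u

open Fm

variable {M : Type u} [RCA M] {E : Env M}

/-! ## Functions as sets of pairs -/

/-- The set `A` is the graph of the function `f`. -/
def Graphs (A : Set M) (f : M → M) : Prop := ∀ i j, Rel A i j ↔ f i = j

theorem Rel.comp {A : Set M} (hA : IsSet A) : Comp M fun p : M × M => Rel A p.1 p.2 :=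
  (Comp.mem_set hA).comp (f := fun p : M × M => pr p.1 p.2) (by fun_prop)

theorem Rel₃.comp {A : Set M} (hA : IsSet A) : Comp M fun p : M × M × M => Rel₃ A p.1 p.2.1 p.2.2 :=
  (Comp.mem_set hA).comp (f := fun p : M × M × M => pr p.1 (pr p.2.1 p.2.2)) (by fun_prop)

theorem exists_rel {R : M → M → Prop} (hR : Comp M fun p : M × M => R p.1 p.2) :
    ∃ A, IsSet A ∧ Rel A = R := by
  refine ⟨{z | R (π₁ z) (π₂ z)}, Comp.isSet (hR.comp (f := fun z => (π₁ z, π₂ z)) (by fun_prop)), ?_⟩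
  ext x y
  simp [Rel]

theorem exists_rel₃ {R : M → M → M → Prop} (hR : Comp M fun p : M × M × M => R p.1 p.2.1 p.2.2) :
    ∃ A, IsSet A ∧ Rel₃ A = R := by
  refine ⟨{z | R (π₁ z) (π₁ (π₂ z)) (π₂ (π₂ z))},
    Comp.isSet (hR.comp (f := fun z => (π₁ z, π₁ (π₂ z), π₂ (π₂ z))) (by fun_prop)), ?_⟩
  ext x y
  simp [Rel₃]

theorem IsFun.exists_graphs {A : Set M} (hA : IsSet A) (h : IsFun A) : ∃ f, Comp M f ∧ Graphs A f := by
  choose f hf using h.1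
  have hg : Graphs A f := fun i j => ⟨fun hij => h.2 i _ _ ⟨hf i, hij⟩, fun hij => hij ▸ hf i⟩
  exact ⟨f, Comp.of_graph (Rel.comp hA) fun i j => (hg i j).symm, hg⟩

theorem exists_graphs {f : M → M} (hf : Comp M f) : ∃ A, IsSet A ∧ Graphs A f := by
  obtain ⟨A, hA, h⟩ := exists_rel (R := fun i j => f i = j) (by fun_prop)
  exact ⟨A, hA, fun i j => by rw [h]⟩

theorem Graphs.isFun {A : Set M} {f : M → M} (h : Graphs A f) : IsFun A :=
  ⟨fun i => ⟨f i, (h _ _).2 rfl⟩, fun _ _ _ h' => ((h _ _).1 h'.1).symm.trans ((h _ _).1 h'.2)⟩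

theorem Graphs.rel {A : Set M} {f : M → M} (h : Graphs A f) : Rel A = fun i j => f i = j := by
  ext i j
  exact h i j

/-- Quantification over the functions of a model. -/
theorem exists_isFun {P : Set M → Prop} {Q : (M → M) → Prop}
    (h : ∀ A f, Graphs A f → (P A ↔ Q f)) :
    (∃ A, IsSet A ∧ IsFun A ∧ P A) ↔ ∃ f, Comp M f ∧ Q f := by
  constructor
  · rintro ⟨A, hA, hA', hP⟩
    obtain ⟨f, hf, hAf⟩ := hA'.exists_graphs hA
    exact ⟨f, hf, (h A f hAf).1 hP⟩
  · rintro ⟨f, hf, hQ⟩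
    obtain ⟨A, hA, hAf⟩ := exists_graphs hf
    exact ⟨A, hA, hAf.isFun, (h A f hAf).2 hQ⟩

/-! ## The meaning of the formulas that involve functions -/

set_option synthInstance.maxSize 4000
set_option synthInstance.maxHeartbeats 1000000

variable {O D S X Y L B C G : SetVar} {O₀ D₀ S₀ X₀ Y₀ L₀ B₀ C₀ G₀ : Set M}

/-- Descending sequences as sets of pairs and as computable functions are the same thing. -/
theorem wellFoundedOn_iff {Z : M → Prop} {R : M → M → Prop} :
    (¬ ∃ F : Set M, IsSet F ∧ IsFun F ∧ (∀ i x, Rel F i x → Z x) ∧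
      ∀ i x y, Rel F i x ∧ Rel F (i + 1) y → R y x) ↔ WellFoundedOn Z R := by
  refine not_congr (exists_isFun fun A f hf => ?_)
  simp only [hf.rel]
  exact ⟨fun h => ⟨fun i => h.1 i _ rfl, fun i => h.2 i _ _ ⟨rfl, rfl⟩⟩, fun h =>
    ⟨fun i x hx => hx ▸ h.1 i, fun i x y hxy => hxy.1 ▸ hxy.2 ▸ h.2 i⟩⟩

instance [SetDen E X X₀] [SetDen E L L₀] : Holds E (isWellOrder X L)
    (((∀ x y, Rel L₀ x y → x ∈ X₀ ∧ y ∈ X₀) ∧ IsLin (fun x => x ∈ X₀) (Rel L₀)) ∧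
      WellFoundedOn (fun x => x ∈ X₀) (Rel L₀)) := by
  refine Holds.congr ?_ (and_congr_right fun _ => wellFoundedOn_iff)
  have : ∀ {E : Env M} {s t : Term} {a b : M} [SetDen E L L₀] [Den E s a] [Den E t b],
      Holds E (pair s t ∊ L) (Rel L₀ a b) := by
    unfold Rel
    infer_instance
  unfold isWellOrder
  infer_instance

instance [SetDen E O O₀] [SetDen E D D₀] [SetDen E S S₀] [SetDen E X X₀] [SetDen E L L₀] :
    Holds E (extIsWellFounded O D S X L) (WellFoundedOn
      (InExt (Rel O₀) (Rel₃ S₀) (fun x => x ∈ X₀) (Rel L₀)) (LtExt (Rel₃ D₀) (Rel L₀))) := by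
  refine Holds.congr ?_ wellFoundedOn_iff
  unfold extIsWellFounded
  infer_instance

instance [SetDen E O O₀] [SetDen E D D₀] : Holds E (extPreservesWellFoundedness O D)
    (∃ S : M → M → M → Prop, Comp M (fun p : M × M × M => S p.1 p.2.1 p.2.2) ∧
      IsSupport (Rel O₀) (Rel₃ D₀) S ∧ ExtPreserves (Rel O₀) (Rel₃ D₀) S) := by
  refine Holds.congr (P := ∃ S, IsSet S ∧ IsSupport (Rel O₀) (Rel₃ D₀) (Rel₃ S) ∧
    ∀ X, IsSet X → ∀ L, IsSet L →
      ((∀ x y, Rel L x y → x ∈ X ∧ y ∈ X) ∧ IsLin (fun x => x ∈ X) (Rel L)) ∧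
        WellFoundedOn (fun x => x ∈ X) (Rel L) →
      WellFoundedOn (InExt (Rel O₀) (Rel₃ S) (fun x => x ∈ X) (Rel L))
        (LtExt (Rel₃ D₀) (Rel L))) ?_ ?_
  · unfold extPreservesWellFoundedness
    infer_instance
  constructor
  · rintro ⟨S, hS, hsupp, h⟩
    refine ⟨Rel₃ S, Rel₃.comp hS, hsupp, fun X R hX hR h1 h2 h3 => ?_⟩
    obtain ⟨L, hL, rfl⟩ := exists_rel hR
    exact h {z | X z} hX.isSet L hL ⟨⟨h1, h2⟩, h3⟩
  · rintro ⟨R, hR, hsupp, h⟩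
    obtain ⟨S, hS, rfl⟩ := exists_rel₃ hR
    exact ⟨S, hS, hsupp, fun X hX L hL h' =>
      h _ _ (Comp.mem_set hX) (Rel.comp hL) h'.1.1 h'.1.2 h'.2⟩

/-- Iterated values for a system of morphisms that is given by a set. -/
def RelIterVal (R : M → M → Prop) (i j x y : M) : Prop :=
  ∃ s, IsFin s ∧ (∀ k u u', Mem (pr k u) s ∧ Mem (pr k u') s → u = u') ∧
    Mem (pr i x) s ∧ Mem (pr j y) s ∧
    ∀ k, i ≤ k ∧ k < j → ∃ f u u', R k f ∧ Mem (pr k u) s ∧ Mem (pr (k + 1) u') s ∧ Val f u u'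

theorem relIterVal_iff {c : M → M} {i j x y : M} :
    RelIterVal (fun i f => c i = f) i j x y ↔ IterVal c i j x y := by
  simp only [RelIterVal, IterVal, exists_and_left, exists_eq_left']

instance {r s t q : Term} {a b c d : M} [SetDen E C C₀] [Den E q a] [Den E r b] [Den E s c]
    [Den E t d] : Holds E (iterVal C q r s t) (RelIterVal (Rel C₀) a b c d) := by
  unfold iterVal RelIterVal
  infer_instance

/-- Goodstein systems that are given by sets. -/
def RelGoodsteinSystem (B C : Set M) : Prop :=
  IsFun B ∧ (∀ i j m n, Rel B i m ∧ Rel B j n ∧ i ≤ j → m ≤ n) ∧ (∀ n, Rel B 0 n → 0 < n) ∧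
    IsFun C ∧ (∀ i f m n, Rel C i f ∧ Rel B i m ∧ Rel B (i + 1) n → IsMor f m n) ∧
    ∀ d, IsSet d → ∀ Y, IsSet Y → IsFun d ∧ (∀ i x n, Rel d i x ∧ Rel B i n → x < n) ∧
        (∀ k, ∃ y, k < y ∧ y ∈ Y) →
      ∃ i j, i ∈ Y ∧ j ∈ Y ∧ i < j ∧ ∃ x y z, Rel d i x ∧ Rel d j y ∧
        RelIterVal (Rel C) i j x z ∧ z ≤ y

instance [SetDen E B B₀] [SetDen E C C₀] :
    Holds E (isGoodsteinSystem B C) (RelGoodsteinSystem B₀ C₀) := by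
  unfold isGoodsteinSystem RelGoodsteinSystem isInfinite
  infer_instance

theorem relGoodsteinSystem_iff {b c : M → M} (hb : Comp M b) (hc : Comp M c) (hB : Graphs B₀ b)
    (hC : Graphs C₀ c) : RelGoodsteinSystem B₀ C₀ ↔ IsGoodsteinSystem b c := by
  simp only [RelGoodsteinSystem, hB.rel, hC.rel, hB.isFun, hC.isFun, true_and, relIterVal_iff]
  constructor
  · rintro ⟨h1, h2, h3, h4⟩
    refine ⟨hb, hc, fun i j hij => h1 i j _ _ ⟨rfl, rfl, hij⟩, h2 _ rfl,
      fun i => h3 i _ _ _ ⟨rfl, rfl, rfl⟩, fun d Y hd hY hdb hYi => ?_⟩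
    obtain ⟨A, hA, hAd⟩ := exists_graphs hd
    have h5 := h4 A hA {z | Y z} hY.isSet
    simp only [hAd.rel] at h5
    obtain ⟨i, j, hi, hj, hij, x, y, z, rfl, rfl, h⟩ := h5
      ⟨hAd.isFun, fun i x n h => h.1 ▸ h.2 ▸ hdb i, hYi⟩
    exact ⟨i, j, hi, hj, hij, z, h⟩
  · intro H
    refine ⟨fun i j m n h => h.1 ▸ h.2.1 ▸ H.mono i j h.2.2, fun n h => h ▸ H.pos,
      fun i f m n h => h.1 ▸ h.2.1 ▸ h.2.2 ▸ H.isMor i, fun A hA Y hY ⟨h1, h2, h3⟩ => ?_⟩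
    obtain ⟨d, hd, hAd⟩ := h1.exists_graphs hA
    simp only [hAd.rel] at h2 ⊢
    obtain ⟨i, j, hi, hj, hij, z, h⟩ := H.exists_le d (fun y => y ∈ Y) hd (Comp.mem_set hY)
      (fun i => h2 i _ _ ⟨rfl, rfl⟩) h3
    exact ⟨i, j, hi, hj, hij, _, _, z, rfl, rfl, h⟩

instance [SetDen E O O₀] [SetDen E D D₀] : Holds E (extendedGoodsteinTheorem O D)
    (GoodsteinTerminates (Rel O₀) (Rel₃ D₀)) := by
  refine Holds.congr (P := ∀ B, IsSet B → ∀ C, IsSet C → RelGoodsteinSystem B C →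
    ∀ n m, Rel B 0 n ∧ Rel O₀ n m → ∃ G, IsSet G ∧ (IsFun G ∧ Rel G 0 m ∧
      ∀ i f x y, Rel C i f ∧ Rel G i x ∧ Rel G (i + 1) y →
        (x = 0 → y = 0) ∧ (¬ x = 0 → Rel₃ D₀ f x (y + 1))) ∧ ∃ i, Rel G i 0) ?_ ?_
  · unfold extendedGoodsteinTheorem isGoodsteinSequence
    infer_instance
  have key : ∀ {C c m}, Graphs C c → ((∃ G, IsSet G ∧ (IsFun G ∧ Rel G 0 m ∧
      ∀ i f x y, Rel C i f ∧ Rel G i x ∧ Rel G (i + 1) y →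
        (x = 0 → y = 0) ∧ (¬ x = 0 → Rel₃ D₀ f x (y + 1))) ∧ ∃ i, Rel G i 0) ↔
      ∃ g : M → M, Comp M g ∧ IsGoodsteinSequence (Rel₃ D₀) c m g ∧ ∃ i, g i = 0) := by
    intro C c m hC
    simp only [and_assoc]
    refine exists_isFun fun G g hG => ?_
    simp only [hG.rel, hC.rel, IsGoodsteinSequence, and_assoc]
    refine and_congr_right fun _ => and_congr_left fun _ => ⟨fun h i => h i _ _ _ ⟨rfl, rfl, rfl⟩, ?_⟩
    rintro h i _ _ _ ⟨rfl, rfl, rfl⟩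
    exact h i
  constructor
  · intro h b c hbc m hm
    obtain ⟨B, hB, hBb⟩ := exists_graphs hbc.compB
    obtain ⟨C, hC, hCc⟩ := exists_graphs hbc.compC
    exact (key hCc).1 (h B hB C hC ((relGoodsteinSystem_iff hbc.compB hbc.compC hBb hCc).2 hbc) _ m
      ⟨(hBb _ _).2 rfl, hm⟩)
  · rintro h B hB C hC hBC n m ⟨hn, hm⟩
    obtain ⟨b, hb, hBb⟩ := hBC.1.exists_graphs hB
    obtain ⟨c, hc, hCc⟩ := hBC.2.2.2.1.exists_graphs hC
    obtain rfl := (hBb _ _).1 hn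
    exact (key hCc).2 (h b c ((relGoodsteinSystem_iff hb hc hBb hCc).1 hBC) m hm)

end SOA

/-! ### From the formal definition of Goodstein dilators to computable functors, and the conclusion.
-/

namespace SOA

universe u

open Fm

variable {M : Type u} [RCA M]

/-! ## Goodstein dilators as computable functors -/

/-- A square of injections is a pullback if its diagonal q exhausts the intersection of the two
ranges. The mediating morphism looks up the common value in the range of q, and injectivity of p
makes it unique. -/
theorem isPullbackNat_mkMor {l m m' n : M} {q e e' p p' : M → M} (hqc : Comp M q) (hec : Comp M e)
    (hec' : Comp M e') (hq : Inc l n q) (he : Inc m n e) (he' : Inc m' n e') (hpc : Comp M p)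
    (hpc' : Comp M p') (hp : Inc l m p) (hp' : Inc l m' p') (hep : ∀ i, i < l → e (p i) = q i)
    (hep' : ∀ i, i < l → e' (p' i) = q i)
    (h : ∀ j, j < m → ∀ j', j' < m' → e j = e' j' → ∃ i, i < l ∧ q i = e j) :
    IsPullbackNat l m m' (mkMor l m p) (mkMor l m' p') (mkMor m n e) (mkMor m' n e') := by
  simp only [IsPullbackNat, Commutes, IsComp, val_mkMor hpc hp, val_mkMor hpc' hp',
    val_mkMor hec he, val_mkMor hec' he']
  refine ⟨?_, ?_⟩
  · rintro x _ _ _ ⟨⟨hx, rfl⟩, ⟨-, rfl⟩, -, rfl⟩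
    exact ⟨hp'.1 x hx, (hep x hx).trans (hep' x hx).symm⟩
  rintro k _ _ ⟨hg, hg', hgg'⟩
  obtain ⟨g, hgc, hgI, rfl⟩ := exists_of_isMor hg
  obtain ⟨g', hgc', hgI', rfl⟩ := exists_of_isMor hg'
  simp only [val_mkMor hgc hgI, val_mkMor hgc' hgI'] at hgg' ⊢
  have hegg : ∀ x, x < k → e (g x) = e' (g' x) := fun x hx =>
    (hgg' x _ _ _ ⟨⟨hx, rfl⟩, ⟨hx, rfl⟩, hgI.1 x hx, rfl⟩).2
  constructor
  · obtain ⟨η, hηc, hη⟩ := exists_comp_choice_of (α := M) (P := fun x i => i < l ∧ q i = e (g x))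
      (Q := fun x => x < k) (by fun_prop) (by fun_prop) fun x hx =>
        h _ (hgI.1 x hx) _ (hgI'.1 x hx) (hegg x hx)
    have hηI : Inc k l η := by
      refine ⟨fun x hx => (hη x hx).1, fun x y hxy hy => ?_⟩
      have hx := hxy.trans hy
      rw [← hq.lt_iff (hη x hx).1 (hη y hy).1, (hη x hx).2, (hη y hy).2]
      exact he.2 _ _ (hgI.2 x y hxy hy) (hgI.1 y hy)
    refine ⟨mkMor k l η, isMor_mkMor hηc hηI, ?_, ?_⟩ <;> simp only [val_mkMor hηc hηI]
    · rintro i _ _ ⟨⟨hi, rfl⟩, hi', rfl⟩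
      exact ⟨hi, he.injOn (hp.1 _ hi') (hgI.1 i hi) ((hep _ hi').trans (hη i hi).2)⟩
    · rintro i _ _ ⟨⟨hi, rfl⟩, hi', rfl⟩
      exact ⟨hi, he'.injOn (hp'.1 _ hi') (hgI'.1 i hi)
        ((hep' _ hi').trans ((hη i hi).2.trans (hegg i hi)))⟩
  · rintro _ _ ⟨hη, h1, -, hθ, h2, -⟩
    obtain ⟨η, hηc, hηI, rfl⟩ := exists_of_isMor hη
    obtain ⟨θ, hθc, hθI, rfl⟩ := exists_of_isMor hθ
    simp only [val_mkMor hηc hηI, val_mkMor hθc hθI] at h1 h2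
    refine mkMor_congr fun i hi => hp.injOn (hηI.1 i hi) (hθI.1 i hi) ?_
    rw [(h1 i _ _ ⟨⟨hi, rfl⟩, hηI.1 i hi, rfl⟩).2, (h2 i _ _ ⟨⟨hi, rfl⟩, hθI.1 i hi, rfl⟩).2]

/-- Test the pullback property with a one-point order, for which a cone is just a compatible pair of
elements. -/
theorem IsPullbackLO.exists_preimage {D : M → M → Prop} {App : M → M → M → Prop}
    {l m m' p p' e e' σ σ' : M} (h : IsPullbackLO D App l m m' p p' e e') (hσ : D m σ)
    (hσ' : D m' σ') (he : ∀ y, App e σ y → App e' σ' y) :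
    ∃ ρ, D l ρ ∧ ∀ y, App p ρ y → y = σ := by
  have hU : ∀ σ w x : M, Rel {z | z = pr 0 σ} w x ↔ w = 0 ∧ x = σ := fun σ w x => pr_inj
  obtain ⟨⟨H, -, hH, hHU, -⟩, -⟩ := h.2 {z | z = 0} (Comp.isSet (by fun_prop)) {_z | False}
    (Comp.isSet (by fun_prop)) {z | z = pr 0 σ} (Comp.isSet (by fun_prop)) {z | z = pr 0 σ'}
    (Comp.isSet (by fun_prop)) ⟨⟨fun _ _ h => h.elim, fun _ h => h, fun _ _ _ h => h.elim,
      fun x y hx hy => .inr (.inl (hx.trans hy.symm))⟩, by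
        simp only [IsEmbedding, hU]
        exact ⟨fun w x h => ⟨h.1, h.2 ▸ hσ⟩, fun w hw => ⟨σ, hw, rfl⟩,
          fun w x x' h => h.1.2.trans h.2.2.symm, fun w x w' x' h => h.2.2.elim⟩, by
        simp only [IsEmbedding, hU]
        exact ⟨fun w x h => ⟨h.1, h.2 ▸ hσ'⟩, fun w hw => ⟨σ', hw, rfl⟩,
          fun w x x' h => h.1.2.trans h.2.2.symm, fun w x w' x' h => h.2.2.elim⟩, by
        simp only [hU]
        rintro w x x' y ⟨⟨-, rfl⟩, ⟨-, rfl⟩, hy⟩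
        exact he y hy⟩
  obtain ⟨ρ, hρ⟩ := hH.2.1 0 rfl
  exact ⟨ρ, (hH.1 _ _ hρ).2, fun y hy => ((hU _ _ _).1 (hHU _ _ _ ⟨hρ, hy⟩)).2⟩

/-- The action of D on morphisms becomes a function by choice. The choice is restricted to codes of
morphisms and elements of their domain, which is decidable because the domain and codomain are
components of the code. -/
theorem exists_isDilator {D : M → M → Prop} {App : M → M → M → Prop}
    (hD : Comp M fun p : M × M => D p.1 p.2) (hApp : Comp M fun p : M × M × M => App p.1 p.2.1 p.2.2)
    (h : IsGoodsteinDilator D App) : ∃ A, IsDilator D App A := by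
  obtain ⟨hlt, ⟨hF, hid, hcomp⟩, hpb, hD0, hzero⟩ := h
  obtain ⟨A, hA, hA'⟩ := exists_comp_choice_of (α := M × M) (P := fun p y => App p.1 p.2 y)
    (Q := fun p => ∃ m, m < p.1 + 1 ∧ ∃ n, n < p.1 + 1 ∧ IsMor p.1 m n ∧ D m p.2)
    (hApp.comp (f := fun p : (M × M) × M => (p.1.1, p.1.2, p.2)) (by fun_prop)) (by fun_prop) (by
      rintro ⟨φ, σ⟩ ⟨m, -, n, -, hφ, hσ⟩
      exact (hF φ m n hφ).2.1 σ hσ)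
  have hAspec : ∀ {φ m n σ}, IsMor φ m n → D m σ → App φ σ (A (φ, σ)) := fun {φ m n σ} hφ hσ => by
    refine hA' (φ, σ) ⟨m, ?_, n, ?_, hφ, hσ⟩ <;> obtain ⟨g, rfl, -⟩ := hφ
    · exact left_lt_succ_pr _ _
    · exact lt_succ_iff.2 ((left_le_pr _ _).trans (right_le_pr _ _))
  have happ : ∀ {φ m n σ τ}, IsMor φ m n → (App φ σ τ ↔ D m σ ∧ A (φ, σ) = τ) :=
    fun {φ m n σ τ} hφ => ⟨fun h => by
      have hσ := ((hF φ m n hφ).1 _ _ h).1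
      exact ⟨hσ, (hF φ m n hφ).2.2.1 _ _ _ ⟨hAspec hφ hσ, h⟩⟩, by
      rintro ⟨hσ, rfl⟩
      exact hAspec hφ hσ⟩
  have hcomp' : ∀ {l m n f g σ}, Comp M f → Comp M g → Inc l m f → Inc m n g → D l σ →
      A (mkMor l n fun i => g (f i), σ) = A (mkMor m n g, A (mkMor l m f, σ)) := by
    intro l m n f g σ hfc hgc hf hg hσ
    have hf' := isMor_mkMor hfc hf
    have hg' := isMor_mkMor hgc hg
    have hgfc : Comp M fun i => g (f i) := by fun_prop
    have hgf' := isMor_mkMor hgfc (hg.comp hf)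
    refine ((happ hgf').1 (hcomp l m n _ _ _ ⟨hf', hg', hgf', ?_⟩ σ _ _
      ⟨hAspec hf' hσ, hAspec hg' ((hF _ _ _ hf').1 _ _ (hAspec hf' hσ)).2⟩)).2
    simp only [IsComp, val_mkMor hfc hf, val_mkMor hgc hg, val_mkMor hgfc (hg.comp hf)]
    rintro i _ _ ⟨⟨hi, rfl⟩, -, rfl⟩
    exact ⟨hi, rfl⟩
  have hemp : ∀ {n f}, Comp M f → App (mkMor 0 n f) 0 0 ∧ D n 0 := fun {n f} hfc =>
    hzero n _ (isMor_mkMor hfc ⟨fun i hi => absurd hi not_lt_zero, fun i j _ hj =>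
      absurd hj not_lt_zero⟩)
  have hemp0 : ∀ {n f}, Comp M f → A (mkMor 0 n f, 0) = 0 := fun {n f} hfc =>
    ((happ (isMor_mkMor hfc ⟨fun i hi => absurd hi not_lt_zero, fun i j _ hj =>
      absurd hj not_lt_zero⟩)).1 (hemp hfc).1).2
  refine ⟨fun φ σ => A (φ, σ), hD, by fun_prop, fun {n σ τ} hσ h => hlt n σ τ ⟨hσ, h⟩,
    fun n => (hemp (f := fun i => i) (by fun_prop)).2, happ, ?_, ?_, ?_, hcomp', ?_, ?_⟩
  · intro m n f σ hfc hf hσ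
    have hf' := isMor_mkMor hfc hf
    exact ((hF _ _ _ hf').1 _ _ (hAspec hf' hσ)).2
  · intro m n f σ τ hfc hf hτ h
    have hf' := isMor_mkMor hfc hf
    exact (hF _ _ _ hf').2.2.2 _ _ _ _ ⟨hAspec hf' (hlt m τ σ ⟨hτ, h⟩), hAspec hf' hτ, h⟩
  · intro n σ hσ
    have h1 : Comp M fun i : M => i := by fun_prop
    have h2 := isMor_mkMor h1 (inc_id n)
    exact ((happ h2).1 (hid _ n ⟨h2, fun i hi => (val_mkMor h1 (inc_id n)).2 ⟨hi, rfl⟩⟩ σ hσ)).2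
  · intro m n f hfc hf
    -- The element 0 of D(m) comes from D(0) along the empty function, and the empty function
    -- followed by f is again empty.
    have h1 := hcomp' (l := 0) (f := fun i : M => i) (by fun_prop) hfc
      ⟨fun i hi => absurd hi not_lt_zero, fun i j _ hj => absurd hj not_lt_zero⟩ hf hD0
    rw [hemp0 (by fun_prop), hemp0 (by fun_prop)] at h1
    exact h1.symm
  · intro l m m' n q e e' σ σ' hqc hec hec' hq he he' h1 h2 h3 hσ hσ' h
    -- The hypotheses speak only about ranges, so the two projections of the square are recovered by
    -- factoring q through e and e'.
    have lift : ∀ {m e}, Comp M e → Inc m n e → (∀ i, i < l → ∃ j, j < m ∧ e j = q i) →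
        ∃ p, Comp M p ∧ Inc l m p ∧ ∀ i, i < l → e (p i) = q i := by
      intro m e hec he h
      obtain ⟨p, hpc, hp⟩ := exists_comp_choice_of (α := M) (P := fun i j => j < m ∧ e j = q i)
        (Q := fun i => i < l) (by fun_prop) (by fun_prop) h
      refine ⟨p, hpc, ⟨fun i hi => (hp i hi).1, fun i j hij hj => ?_⟩, fun i hi => (hp i hi).2⟩
      have hi := hij.trans hj
      rw [← he.lt_iff (hp i hi).1 (hp j hj).1, (hp i hi).2, (hp j hj).2]
      exact hq.2 i j hij hj
    obtain ⟨p, hpc, hp, hep⟩ := lift hec he h1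
    obtain ⟨p', hpc', hp', hep'⟩ := lift hec' he' h2
    have hpM := isMor_mkMor hpc hp
    have heM := isMor_mkMor hec he
    have heM' := isMor_mkMor hec' he'
    obtain ⟨ρ, hρ, hρσ⟩ := (hpb _ _ _ _ _ _ _ _ ⟨hpM, isMor_mkMor hpc' hp', heM, heM',
      isPullbackNat_mkMor hqc hec hec' hq he he' hpc hpc' hp hp' hep hep' h3⟩).exists_preimage hσ hσ'
      fun y hy => (happ heM').2 ⟨hσ', h.symm.trans ((happ heM).1 hy).2⟩
    refine ⟨ρ, hρ, ?_⟩
    have h4 := hcomp' hpc hec hp he hρ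
    rw [hρσ _ (hAspec hpM hρ), mkMor_congr hep] at h4
    exact h4

set_option synthInstance.maxSize 4000
set_option synthInstance.maxHeartbeats 1000000

/-- The translation is assembled by instance search along the structure of the formula. -/
theorem holds_goodstein_iff (E : Env M) : Holds E (allSet fun DO => allSet fun DM =>
      isGoodsteinDilator DO DM ➝
        (extendedGoodsteinTheorem DO DM ⭤ extPreservesWellFoundedness DO DM))
    (∀ O, IsSet O → ∀ D, IsSet D → IsGoodsteinDilator (Rel O) (Rel₃ D) →
      (GoodsteinTerminates (Rel O) (Rel₃ D) ↔ ∃ S : M → M → M → Prop,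
        Comp M (fun p : M × M × M => S p.1 p.2.1 p.2.2) ∧
          IsSupport (Rel O) (Rel₃ D) S ∧ ExtPreserves (Rel O) (Rel₃ D) S)) :=
  inferInstance

theorem goodsteinTerminates_iff {D : M → M → Prop} {App : M → M → M → Prop}
    (hD : Comp M fun p : M × M => D p.1 p.2) (hApp : Comp M fun p : M × M × M => App p.1 p.2.1 p.2.2)
    (h : IsGoodsteinDilator D App) : GoodsteinTerminates D App ↔ ∃ S : M → M → M → Prop,
      Comp M (fun p : M × M × M => S p.1 p.2.1 p.2.2) ∧ IsSupport D App S ∧ ExtPreserves D App S := by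
  obtain ⟨A, H⟩ := exists_isDilator hD hApp h
  constructor
  · intro hG
    obtain ⟨S, hS, hsupp⟩ := exists_isSupport H
    exact ⟨S, hS, hsupp, extPreserves_of_goodsteinTerminates H S hG⟩
  · rintro ⟨S, hS, hsupp, hE⟩
    exact goodsteinTerminates_of_extPreserves H hS hsupp hE

end SOA

open SOA SOA.Fm in
/-- RCA₀ proves: for any Goodstein dilator `D`, the extended Goodstein theorem for `D` holds if and
only if the extension of `D` to linear orders preserves well foundedness. -/
theorem theorem2 : RCA0.Entails (sentence (allSet fun DO => allSet fun DM =>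
    isGoodsteinDilator DO DM ➝
      (extendedGoodsteinTheorem DO DM ⭤ extPreservesWellFoundedness DO DM))) := by
  intro 𝔐 h𝔐 v w
  have : 𝔐.IsRCA0 := ⟨h𝔐⟩
  let _ : RCA 𝔐.Num := Model.rca
  -- The sentence has no free variables, so the supply of names starts at 0 and the assignments are
  -- irrelevant.
  exact (holds_goodstein_iff (⟨0, v, w⟩ : Env 𝔐.Num)).iff.2 fun O hO D hD h =>
    goodsteinTerminates_iff (Rel.comp hO) (Rel₃.comp hD) h
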